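/- Let $n\ge 1$, $1<p<\infty$, $p'=p/(p-1)$, let $\Omega\subset\mathbb R^n$ be a bounded open set and $f\in L^{p'}(\Omega)$. Let $m:\mathbb R^n\times\mathbb R^n\to\mathbb R$ be measurable with - $0<m_-\le m(x,h)\le m_+<\infty$ for a.e. $(x,h)$, for some constants $m_\pm$; - $m(x,h)=m(x-h,-h)$ for a.e. $(x,h)$; - there is $a:\mathbb R^n\times\mathbb S^{n-1}\to\mathbb R$ such that, for a.e. $x$, $m(x,r\omega)=a(x,\omega)+O(r)$ as $r\downarrow0$, uniformly in $\omega\in\mathbb S^{n-1}$. Put $$\mathcal A(x,\xi)=\frac1p\int_{\mathbb S^{n-1}}a(x,\omega)\,|\xi\cdot\omega|^p\,d\mathcal H^{n-1}(\omega).$$ For $s\in(0,1)$ let $W^{s,p}_0(\Omega)$ be the set of $u\in L^p(\mathbb R^n)$ with $\iint_{\mathbb R^n\times\mathbb R^n}\frac{|u(x)-u(x-h)|^p}{|h|^{n+sp}}\,dx\,dh<\infty$ and $u=0$ a.e. in $\mathbb R^n\setminus\Omega$. Likewise let $W^{1,p}_0(\Omega)$ be the set of $u\in W^{1,p}(\mathbb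 R^n)$ with $u=0$ a.e. in $\mathbb R^n\setminus\Omega$. Let $\mathcal L_{m,s}$ be the Fréchet derivative of $$J_{m,s}(u)=\frac{1-s}{p}\iint_{\mathbb R^n\times\mathbb R^n}m(x,h)\frac{|u(x)-u(x-h)|^p}{|h|^{n+sp}}\,dx\,dh$$ on $W^{s,p}_0(\Omega)$, that is, $$\langle\mathcal L_{m,s}u,v\rangle=(1-s)\iint_{\mathbb R^n\times\mathbb R^n}m(x,h)\frac{|u(x)-u(x-h)|^{p-2}(u(x)-u(x-h))(v(x)-v(x-h))}{|h|^{n+sp}}\,dx\,dh.$$ Then: 1. For every $s\in(0,1)$ the problem $\mathcal L_{m,s}u_s=f$ in $\Omega$, $u_s=0$ in $\mathbb R^n\setminus\Omega$, has a unique weak solution, i.e. there is a unique $u_s\in W^{s,p}_0(\Omega)$ with $\langle\mathcal L_{m,s}u_s,v\rangle=\int_\Omega fv\,dx$ for all $v\in W^{s,p}_0(\Omega)$. 2. As $s\uparrow1$, $u_s$ converges in $L^p(\Omega)$ to a function $u\in W^{1,p}_0(\Omega)$, which is the unique weak solution of $$-\operatorname{div}\big(\nabla_\xi\mathcal A(x,\nabla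 u)\big)=p\,f\ \text{ in }\Omega,\qquad u=0\ \text{ on }\partial\Omega,$$ i.e. the unique $u\in W^{1,p}_0(\Omega)$ with $\int_{\mathbb R^n}\nabla_\xi\mathcal A(x,\nabla u)\cdot\nabla v\,dx=p\int_\Omega fv\,dx$ for all $v\in W^{1,p}_0(\Omega)$. 3. If $\Omega$ has Lipschitz boundary, the same $u$ is also the unique weak solution of this local problem when $W^{1,p}_0(\Omega)$ (for the solution and for the test functions) is understood as the closure of $C_c^\infty(\Omega)$ in $W^{1,p}(\mathbb R^n)$. -/

import Mathlib

open MeasureTheory Filter Topology Metric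
open scoped ContDiff

namespace AnisoFrac

noncomputable section

/-- Euclidean space `ℝⁿ`. -/
abbrev E (n : ℕ) : Type := EuclideanSpace ℝ (Fin n)

/-! ### Fractional Sobolev spaces and the nonlocal problem -/

/-- The `p`-th power of the Gagliardo seminorm, as an extended nonnegative number:
`∬ |u(x) - u(x-h)|^p / |h|^(n+sp) dx dh`. -/
def gagliardo {n : ℕ} (s p : ℝ) (u : E n → ℝ) : ENNReal :=
  ∫⁻ z : E n × E n, ENNReal.ofReal (|u z.1 - u (z.1 - z.2)| ^ p / ‖z.2‖ ^ ((n : ℝ) + s * p))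

/-- `W^{s,p}_0(Ω)`: functions of `W^{s,p}(ℝⁿ)` that vanish a.e. outside `Ω`. -/
def fracSobolev₀ {n : ℕ} (s p : ℝ) (Ω : Set (E n)) : Set (E n → ℝ) :=
  {u | MemLp u (ENNReal.ofReal p) volume ∧ gagliardo s p u < ⊤ ∧
    ∀ᵐ x : E n, x ∉ Ω → u x = 0}

/-- The pairing `⟨𝓛_{m,s} u, v⟩`, i.e. the derivative at `u` in the direction `v` of the energy
`J_{m,s}(u) = (1-s)/p ∬ m(x,h) |u(x) - u(x-h)|^p / |h|^(n+sp) dx dh`. -/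
def nonlocalForm {n : ℕ} (s p : ℝ) (m : E n → E n → ℝ) (u v : E n → ℝ) : ℝ :=
  (1 - s) * ∫ z : E n × E n,
    m z.1 z.2 *
      (|u z.1 - u (z.1 - z.2)| ^ (p - 2) * (u z.1 - u (z.1 - z.2)) * (v z.1 - v (z.1 - z.2)))
        / ‖z.2‖ ^ ((n : ℝ) + s * p)

/-- `u` is a weak solution of `𝓛_{m,s} u = f` in `Ω`, `u = 0` in `ℝⁿ \ Ω`. -/
def IsNonlocalSolution {n : ℕ} (s p : ℝ) (Ω : Set (E n)) (m : E n → E n → ℝ) (f : E n → ℝ)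
    (u : E n → ℝ) : Prop :=
  u ∈ fracSobolev₀ s p Ω ∧
    ∀ v ∈ fracSobolev₀ s p Ω, nonlocalForm s p m u v = ∫ x in Ω, f x * v x

/-! ### First order Sobolev spaces and the local problem -/

/-- `g` is the weak (distributional) gradient of `u` on `ℝⁿ`. -/
def HasWeakGradient {n : ℕ} (u : E n → ℝ) (g : E n → E n) : Prop :=
  ∀ φ : E n → ℝ, ContDiff ℝ ∞ φ → HasCompactSupport φ → ∀ e : E n,
    ∫ x, u x * fderiv ℝ φ x e = - ∫ x, inner ℝ (g x) e * φ x

/-- `u ∈ W^{1,p}(ℝⁿ)`, with weak gradient `g`. -/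
def IsSobolevWith {n : ℕ} (p : ℝ) (u : E n → ℝ) (g : E n → E n) : Prop :=
  MemLp u (ENNReal.ofReal p) volume ∧ MemLp g (ENNReal.ofReal p) volume ∧ HasWeakGradient u g

/-- `W^{1,p}_0(Ω)`: functions of `W^{1,p}(ℝⁿ)` that vanish a.e. outside `Ω`
(the case `s = 1` of `W^{s,p}_0(Ω)`). -/
def sobolev₀ {n : ℕ} (p : ℝ) (Ω : Set (E n)) : Set (E n → ℝ) :=
  {u | (∃ g, IsSobolevWith p u g) ∧ ∀ᵐ x : E n, x ∉ Ω → u x = 0}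

/-- The closure of `C_c^∞(Ω)` (functions extended by zero) in `W^{1,p}(ℝⁿ)`. -/
def testClosure {n : ℕ} (p : ℝ) (Ω : Set (E n)) : Set (E n → ℝ) :=
  {u | ∃ g, IsSobolevWith p u g ∧ ∀ ε : ℝ, 0 < ε → ∃ φ : E n → ℝ,
    ContDiff ℝ ∞ φ ∧ HasCompactSupport φ ∧ tsupport φ ⊆ Ω ∧
    eLpNorm (fun x => u x - φ x) (ENNReal.ofReal p) volume ≤ ENNReal.ofReal ε ∧
    eLpNorm (fun x => g x - gradient φ x) (ENNReal.ofReal p) volume ≤ ENNReal.ofReal ε}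

/-- Lipschitz boundary: near each boundary point `Ω` is, in a suitable direction `e`, the strict
epigraph of a Lipschitz function `γ` of the variables orthogonal to `e` (that is, `γ` is constant
along `e`). -/
def HasLipschitzBoundary {n : ℕ} (Ω : Set (E n)) : Prop :=
  ∀ x₀ ∈ frontier Ω, ∃ (e : E n) (γ : E n → ℝ) (K : NNReal) (r : ℝ),
    ‖e‖ = 1 ∧ LipschitzWith K γ ∧ (∀ (y : E n) (t : ℝ), γ (y + t • e) = γ y) ∧ 0 < r ∧
    ∀ y ∈ ball x₀ r, (y ∈ Ω ↔ γ y < inner ℝ e y)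

/-- `𝓐(x,ξ) = (1/p) ∫_{S^{n-1}} a(x,ω) |ξ·ω|^p dℋ^{n-1}(ω)`. The surface measure of the unit sphere
is `volume.toSphere`, whose total mass is `n` times the volume of the unit ball. -/
def density {n : ℕ} (p : ℝ) (a : E n → sphere (0 : E n) 1 → ℝ) (x ξ : E n) : ℝ :=
  (1 / p) * ∫ θ : sphere (0 : E n) 1, a x θ * |inner ℝ ξ (θ : E n)| ^ p
    ∂(volume : Measure (E n)).toSphere

/-- `u` is a weak solution of `-div(∇_ξ 𝓐(x,∇u)) = F` in `Ω`, both `u` and the test functions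
being taken in the class `V` (a realisation of `W^{1,p}_0(Ω)`). -/
def IsLocalSolution {n : ℕ} (p : ℝ) (Ω : Set (E n)) (V : Set (E n → ℝ))
    (a : E n → sphere (0 : E n) 1 → ℝ) (F : E n → ℝ) (u : E n → ℝ) : Prop :=
  u ∈ V ∧ ∃ g, IsSobolevWith p u g ∧
    ∀ v ∈ V, ∀ gv, IsSobolevWith p v gv →
      ∫ x, inner ℝ (gradient (density p a x) (g x)) (gv x) = ∫ x in Ω, F x * v x

end

end AnisoFrac

namespace AnisoFrac

noncomputable section

/-! ### The power nonlinearity -/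

/-! The obstacle is that the energy space, the kernel and the factor `1 - s` all move with `s`. Put
`α = p(1-s)` and write `h = t^(1/α) ω` with `ω` on the unit sphere and `t > 0`. The Jacobian turns
`α |h|^(α-n) dh` into `dω dt` (`map_hvec`), and `p(1-s)/|h|^(n+sp) = α |h|^(α-n)/|h|^p`. So `p`
times the nonlocal form is `∫ m |Du|^(p-2) Du Dv` over the measure space `zMeas`, which does not
depend on `s`; here `Du = dq α u` is the difference quotient `(u(x) - u(x-h))/|h|`
(`nonlocalForm_eq`). As `s ↑ 1` the radius `t^(1/α)` tends to `0` for `t < 1` and to infinity for `t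
> 1`. For a Sobolev function `v` the quotients therefore converge strongly in `L^p` to `∇v·ω` on `t
< 1` and to `0` on `t > 1` (`tendsto_dq`), while `m` converges to `a` on `t < 1`. Since that
interval has length one, the limit form is exactly the one of `𝓐`, with right-hand side `p f`.

For fixed `s` the problem is the Euler-Lagrange equation of a strictly convex coercive functional.
Coercivity is a Poincaré inequality with constant independent of `α` (`exists_poincare`); a
quantitative midpoint convexity estimate makes minimizing sequences Cauchy, so the direct method
needs no weak compactness (`exists_weak_solution`). The same theorem, applied to the inclusion of
`L^q`, represents the dual of `L^q` and thereby yields weak limits along ultrafilters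
(`exists_weak_limit`).

For the limit `s ↑ 1`, take weak limits `u` of the solutions and `G` of their quotients along an
ultrafilter. Discrete integration by parts shows that `u` is Sobolev and that `G = ∇u·ω` on `t < 1`
(`exists_gradient_of_weak_limit`). The solution `u_s` is compared with a fixed Sobolev `v` through
the monotonicity defect of the form: the equation removes the only product of two weakly convergent
factors, so the limit of the defect is computable (`tendsto_defect`). Its nonnegativity for all `v`
gives the local equation by Minty's trick (`minty`). For `v = u` the limit is zero, and strong
monotonicity together with the Poincaré inequality yields `u_s → u` in `L^p`, without a compact
embedding. Uniqueness of the local solution makes all ultrafilter limits agree (`exists_tendsto`).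

For Lipschitz domains both realisations of `W^{1,p}_0` are the same set (`testClosure_eq_sobolev₀`):
localise by a partition of unity, then mollify with a kernel centred off the origin, which pushes
the support into the domain. -/

/-- The odd power `|a|^(p-2) a`. -/
def dpow (p a : ℝ) : ℝ := |a| ^ (p - 2) * a

lemma hasDerivAt_abs_rpow_div {p : ℝ} (hp : 1 < p) (x : ℝ) :
    HasDerivAt (fun x : ℝ => |x| ^ p / p) (dpow p x) x := by
  have h := (hasDerivAt_abs_rpow x hp).div_const p
  rwa [show p * |x| ^ (p - 2) * x / p = dpow p x by rw [dpow]; field_simp] at h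

lemma dpow_zero (p : ℝ) : dpow p 0 = 0 := by simp [dpow]

lemma dpow_neg (p a : ℝ) : dpow p (-a) = -dpow p a := by simp [dpow]

lemma dpow_of_nonneg {p : ℝ} (hp : 1 < p) {a : ℝ} (ha : 0 ≤ a) : dpow p a = a ^ (p - 1) := by
  rcases ha.eq_or_lt with rfl | h
  · rw [dpow_zero, Real.zero_rpow (by linarith)]
  · rw [dpow, abs_of_pos h, show p - 1 = (p - 2) + 1 by ring, Real.rpow_add_one h.ne']

lemma abs_dpow {p : ℝ} (hp : 1 < p) (a : ℝ) : |dpow p a| = |a| ^ (p - 1) := by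
  rw [← dpow_of_nonneg hp (abs_nonneg a)]
  simp [dpow, abs_mul, abs_of_nonneg (Real.rpow_nonneg (abs_nonneg a) _)]

lemma dpow_mul_self {p : ℝ} (hp : 1 < p) (a : ℝ) : dpow p a * a = |a| ^ p := by
  rcases eq_or_ne a 0 with rfl | h
  · simp [Real.zero_rpow (by linarith : p ≠ 0)]
  · have h' : 0 < |a| := abs_pos.2 h
    rw [dpow, mul_assoc, ← abs_mul_abs_self a, ← mul_assoc, ← Real.rpow_add_one h'.ne',
      ← Real.rpow_add_one h'.ne']
    congr 1
    ring

lemma dpow_mul {p : ℝ} {t : ℝ} (ht : 0 < t) (a : ℝ) :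
    dpow p (t * a) = t ^ (p - 1) * dpow p a := by
  rw [dpow, dpow, abs_mul, abs_of_pos ht, Real.mul_rpow ht.le (abs_nonneg a),
    show p - 1 = (p - 2) + 1 by ring, Real.rpow_add_one ht.ne']
  ring

lemma strictMono_dpow {p : ℝ} (hp : 1 < p) : StrictMono (dpow p) := by
  refine strictMono_of_odd_strictMonoOn_nonneg (dpow_neg p) ?_
  intro a ha b hb hab
  rw [dpow_of_nonneg hp ha, dpow_of_nonneg hp hb]
  exact Real.rpow_lt_rpow ha hab (by linarith)

lemma continuous_dpow {p : ℝ} (hp : 1 < p) : Continuous (dpow p) := by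
  -- For `p < 2` the factor `|a|^(p-2)` is unbounded near zero, so continuity is read off from
  -- `|x|^p` being continuously differentiable rather than from the product.
  have h : dpow p = fun x => deriv (fun x : ℝ => ‖x‖ ^ p) x / p := by
    funext x
    have := (hasDerivAt_norm_rpow x hp).deriv
    rw [this, dpow, Real.norm_eq_abs]
    field_simp
  rw [h]
  exact ((contDiff_norm_rpow (E := ℝ) hp).continuous_deriv le_rfl).div_const p

lemma continuous_abs_rpow {p : ℝ} (hp : 1 < p) : Continuous (fun x : ℝ => |x| ^ p) :=
  continuous_abs.rpow_const (fun _ => Or.inr (by linarith))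

lemma strictConvexOn_abs_rpow {p : ℝ} (hp : 1 < p) :
    StrictConvexOn ℝ Set.univ (fun x : ℝ => |x| ^ p / p) := by
  apply StrictMono.strictConvexOn_univ_of_deriv
  · exact (continuous_abs_rpow hp).div_const p
  · have : deriv (fun x : ℝ => |x| ^ p / p) = dpow p :=
      funext fun x => (hasDerivAt_abs_rpow_div hp x).deriv
    rw [this]
    exact strictMono_dpow hp

/-- The tangent line inequality for `|x|^p / p`. -/
lemma dpow_mul_sub_le {p : ℝ} (hp : 1 < p) (a b : ℝ) :
    dpow p b * (a - b) ≤ |a| ^ p / p - |b| ^ p / p := by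
  have hc := (strictConvexOn_abs_rpow hp).convexOn
  rcases lt_trichotomy a b with h | h | h
  · have := hc.slope_le_of_hasDerivAt (Set.mem_univ a) (Set.mem_univ b) h
      (hasDerivAt_abs_rpow_div hp b)
    rw [slope_def_field, div_le_iff₀ (by linarith)] at this
    nlinarith
  · simp [h]
  · have := hc.le_slope_of_hasDerivAt (Set.mem_univ b) (Set.mem_univ a) h
      (hasDerivAt_abs_rpow_div hp b)
    rw [slope_def_field, le_div_iff₀ (by linarith)] at this
    exact this

lemma dpow_sub_mul_nonneg {p : ℝ} (hp : 1 < p) (a b : ℝ) :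
    0 ≤ (dpow p a - dpow p b) * (a - b) := by
  rcases le_total a b with h | h
  · exact mul_nonneg_of_nonpos_of_nonpos (sub_nonpos.2 ((strictMono_dpow hp).monotone h))
      (sub_nonpos.2 h)
  · exact mul_nonneg (sub_nonneg.2 ((strictMono_dpow hp).monotone h)) (sub_nonneg.2 h)

lemma eq_of_dpow_sub_mul_eq_zero {p : ℝ} (hp : 1 < p) {a b : ℝ}
    (h : (dpow p a - dpow p b) * (a - b) = 0) : a = b := by
  rcases mul_eq_zero.1 h with h | h
  · exact (strictMono_dpow hp).injective (sub_eq_zero.1 h)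
  · exact sub_eq_zero.1 h

/-- Two nonnegative continuous `p`-homogeneous functions on the plane such that the first vanishes
where the second does: the first is bounded by a multiple of the second up to an arbitrarily small
multiple of `|a|^p + |b|^p`. -/
lemma exists_le_of_homogeneous {p : ℝ} {F G : ℝ × ℝ → ℝ} (hF : Continuous F)
    (hG : Continuous G) (hFh : ∀ t : ℝ, 0 < t → ∀ z, F (t • z) = t ^ p * F z)
    (hGh : ∀ t : ℝ, 0 < t → ∀ z, G (t • z) = t ^ p * G z) (hF0 : F 0 = 0) (hGn : ∀ z, 0 ≤ G z)
    (hFG : ∀ z, G z = 0 → F z = 0) {ε : ℝ} (hε : 0 < ε) :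
    ∃ C : ℝ, 0 ≤ C ∧ ∀ z, F z ≤ ε * (|z.1| ^ p + |z.2| ^ p) + C * G z := by
  have hS : IsCompact (sphere (0 : ℝ × ℝ) 1) := isCompact_sphere _ _
  have hK : IsCompact (sphere (0 : ℝ × ℝ) 1 ∩ {z | ε ≤ F z}) :=
    hS.inter_right (isClosed_le continuous_const hF)
  -- Compactness on the unit sphere: where `ε ≤ F`, the function `G` has no zero and hence a
  -- positive minimum; where `F < ε` nothing is required of `C`. Homogeneity extends the bound to
  -- the plane.
  have key : ∃ C : ℝ, 0 ≤ C ∧ ∀ z ∈ sphere (0 : ℝ × ℝ) 1, F z ≤ ε + C * G z := by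
    obtain ⟨M, hM⟩ := hS.exists_bound_of_continuousOn hF.continuousOn
    rcases (sphere (0 : ℝ × ℝ) 1 ∩ {z | ε ≤ F z}).eq_empty_or_nonempty with he | hne
    · refine ⟨0, le_rfl, fun z hz => ?_⟩
      by_contra hcon
      have : z ∈ sphere (0 : ℝ × ℝ) 1 ∩ {z | ε ≤ F z} := ⟨hz, by
        simp only [zero_mul, add_zero, not_le] at hcon
        exact hcon.le⟩
      simp [he] at this
    · obtain ⟨z₀, hz₀, hmin⟩ := hK.exists_isMinOn hne hG.continuousOn
      have hpos : 0 < G z₀ := by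
        refine lt_of_le_of_ne (hGn _) fun h => ?_
        have h1 := hFG z₀ h.symm
        have h2 : ε ≤ F z₀ := hz₀.2
        linarith
      have hM0 : 0 ≤ M := (norm_nonneg _).trans (hM z₀ hz₀.1)
      refine ⟨M / G z₀, by positivity, fun z hz => ?_⟩
      by_cases hFz : ε ≤ F z
      · have h1 : G z₀ ≤ G z := hmin ⟨hz, hFz⟩
        have h2 : F z ≤ M := (le_abs_self _).trans (hM z hz)
        have h3 : M ≤ M / G z₀ * G z := by
          rw [div_mul_eq_mul_div, le_div_iff₀ hpos]
          exact mul_le_mul_of_nonneg_left h1 hM0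
        linarith
      · have : 0 ≤ M / G z₀ * G z := mul_nonneg (by positivity) (hGn z)
        linarith
  obtain ⟨C, hC, h⟩ := key
  refine ⟨C, hC, fun z => ?_⟩
  rcases eq_or_ne z 0 with rfl | hz
  · have h1 : 0 ≤ C * G 0 := mul_nonneg hC (hGn 0)
    have h2 : (0:ℝ) ≤ |(0 : ℝ × ℝ).1| ^ p + |(0 : ℝ × ℝ).2| ^ p := by positivity
    rw [hF0]
    positivity
  · have hn : 0 < ‖z‖ := norm_pos_iff.2 hz
    have hz' : z = ‖z‖ • (‖z‖⁻¹ • z) := by rw [smul_smul, mul_inv_cancel₀ hn.ne', one_smul]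
    have hs : ‖z‖⁻¹ • z ∈ sphere (0 : ℝ × ℝ) 1 := by
      rw [mem_sphere_zero_iff_norm, norm_smul, norm_inv, norm_norm, inv_mul_cancel₀ hn.ne']
    have h1 := h _ hs
    -- The norm on the product is the maximum, so its power is one of the two summands.
    have h2 : ‖z‖ ^ p ≤ |z.1| ^ p + |z.2| ^ p := by
      rw [Prod.norm_def, Real.norm_eq_abs, Real.norm_eq_abs]
      rcases max_choice |z.1| |z.2| with h | h <;> rw [h]
      · have : (0:ℝ) ≤ |z.2| ^ p := by positivity
        linarith
      · have : (0:ℝ) ≤ |z.1| ^ p := by positivity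
        linarith
    have hF' : F z = ‖z‖ ^ p * F (‖z‖⁻¹ • z) := by
      conv_lhs => rw [hz']
      exact hFh _ hn _
    have hG' : G z = ‖z‖ ^ p * G (‖z‖⁻¹ • z) := by
      conv_lhs => rw [hz']
      exact hGh _ hn _
    rw [hF', hG']
    calc ‖z‖ ^ p * F (‖z‖⁻¹ • z) ≤ ‖z‖ ^ p * (ε + C * G (‖z‖⁻¹ • z)) := by gcongr
      _ = ε * ‖z‖ ^ p + C * (‖z‖ ^ p * G (‖z‖⁻¹ • z)) := by ring
      _ ≤ _ := by gcongr

lemma continuous_abs_sub_rpow {p : ℝ} (hp : 1 < p) :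
    Continuous (fun z : ℝ × ℝ => |z.1 - z.2| ^ p) :=
  (continuous_abs_rpow hp).comp (continuous_fst.sub continuous_snd)

lemma abs_sub_rpow_homogeneous {p t : ℝ} (ht : 0 < t) (z : ℝ × ℝ) :
    |(t • z).1 - (t • z).2| ^ p = t ^ p * |z.1 - z.2| ^ p := by
  simp only [Prod.smul_fst, Prod.smul_snd, smul_eq_mul]
  rw [← mul_sub, abs_mul, abs_of_pos ht, Real.mul_rpow ht.le (abs_nonneg _)]

/-- The midpoint convexity defect of `|·|^p`. -/
def midDefect (p a b : ℝ) : ℝ := (|a| ^ p + |b| ^ p) / 2 - |(a + b) / 2| ^ p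

lemma midDefect_nonneg {p : ℝ} (hp : 1 < p) (a b : ℝ) : 0 ≤ midDefect p a b := by
  have h := (strictConvexOn_abs_rpow hp).convexOn.2 (Set.mem_univ a) (Set.mem_univ b)
    (by norm_num : (0:ℝ) ≤ 1 / 2) (by norm_num : (0:ℝ) ≤ 1 / 2) (by norm_num)
  simp only [smul_eq_mul] at h
  rw [show 1 / 2 * a + 1 / 2 * b = (a + b) / 2 by ring,
    show 1 / 2 * (|a| ^ p / p) + 1 / 2 * (|b| ^ p / p) = ((|a| ^ p + |b| ^ p) / 2) / p by ring,
    div_le_div_iff_of_pos_right (by linarith)] at h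
  unfold midDefect
  linarith

lemma eq_of_midDefect_eq_zero {p : ℝ} (hp : 1 < p) {a b : ℝ} (h0 : midDefect p a b = 0) :
    a = b := by
  by_contra hab
  have h := (strictConvexOn_abs_rpow hp).2 (Set.mem_univ a) (Set.mem_univ b) hab
    (by norm_num : (0:ℝ) < 1 / 2) (by norm_num : (0:ℝ) < 1 / 2) (by norm_num)
  simp only [smul_eq_mul] at h
  rw [show 1 / 2 * a + 1 / 2 * b = (a + b) / 2 by ring,
    show 1 / 2 * (|a| ^ p / p) + 1 / 2 * (|b| ^ p / p) = ((|a| ^ p + |b| ^ p) / 2) / p by ring,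
    div_lt_div_iff_of_pos_right (by linarith)] at h
  unfold midDefect at h0
  linarith

/-- Strict convexity, homogeneity and compactness replace Clarkson's inequalities and treat all `p >
1` at once. This is the form of uniform convexity that makes minimizing sequences Cauchy. -/
lemma exists_abs_sub_rpow_le_midDefect {p : ℝ} (hp : 1 < p) {ε : ℝ} (hε : 0 < ε) :
    ∃ C : ℝ, 0 ≤ C ∧ ∀ a b : ℝ,
      |a - b| ^ p ≤ ε * (|a| ^ p + |b| ^ p) + C * midDefect p a b := by
  have hc := continuous_abs_rpow hp
  obtain ⟨C, hC, h⟩ := exists_le_of_homogeneous (p := p)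
    (F := fun z => |z.1 - z.2| ^ p) (G := fun z => midDefect p z.1 z.2)
    (continuous_abs_sub_rpow hp) (by
      unfold midDefect
      exact (((hc.comp continuous_fst).add (hc.comp continuous_snd)).div_const 2).sub
        (hc.comp ((continuous_fst.add continuous_snd).div_const 2)))
    (fun t ht z => abs_sub_rpow_homogeneous ht z) (fun t ht z => by
      simp only [midDefect, Prod.smul_fst, Prod.smul_snd, smul_eq_mul]
      rw [← mul_add, mul_div_assoc, abs_mul, abs_mul, abs_mul, abs_of_pos ht,
        Real.mul_rpow ht.le (abs_nonneg _), Real.mul_rpow ht.le (abs_nonneg _),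
        Real.mul_rpow ht.le (abs_nonneg _)]
      ring)
    (by simp [Real.zero_rpow (by linarith : p ≠ 0)]) (fun z => midDefect_nonneg hp _ _)
    (fun z hz => by
      simp [eq_of_midDefect_eq_zero hp hz, Real.zero_rpow (by linarith : p ≠ 0)]) hε
  exact ⟨C, hC, fun a b => h (a, b)⟩

/-- The monotonicity product vanishes only on the diagonal, so the compactness argument applies and
avoids the usual case split at `p = 2`. It converts a vanishing monotonicity defect into norm
convergence. -/
lemma exists_abs_sub_rpow_le_dpow {p : ℝ} (hp : 1 < p) {ε : ℝ} (hε : 0 < ε) :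
    ∃ C : ℝ, 0 ≤ C ∧ ∀ a b : ℝ,
      |a - b| ^ p ≤ ε * (|a| ^ p + |b| ^ p) + C * ((dpow p a - dpow p b) * (a - b)) := by
  have hd := continuous_dpow hp
  obtain ⟨C, hC, h⟩ := exists_le_of_homogeneous (p := p)
    (F := fun z => |z.1 - z.2| ^ p) (G := fun z => (dpow p z.1 - dpow p z.2) * (z.1 - z.2))
    (continuous_abs_sub_rpow hp)
    (((hd.comp continuous_fst).sub (hd.comp continuous_snd)).mul
      (continuous_fst.sub continuous_snd))
    (fun t ht z => abs_sub_rpow_homogeneous ht z) (fun t ht z => by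
      simp only [Prod.smul_fst, Prod.smul_snd, smul_eq_mul, dpow_mul ht]
      have : t ^ p = t ^ (p - 1) * t := by rw [← Real.rpow_add_one ht.ne']; congr 1; ring
      rw [this]
      ring)
    (by simp [Real.zero_rpow (by linarith : p ≠ 0)]) (fun z => dpow_sub_mul_nonneg hp _ _)
    (fun z hz => by
      simp [eq_of_dpow_sub_mul_eq_zero hp hz, Real.zero_rpow (by linarith : p ≠ 0)]) hε
  exact ⟨C, hC, fun a b => h (a, b)⟩

/-- Both sides have the same degree of homogeneity because `(p-1) q = p`. It is the pointwise source
of the continuity of `f ↦ |f|^(p-2) f` from `L^p` to `L^q`. -/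
lemma exists_abs_dpow_sub_rpow_le {p q : ℝ} (hpq : p.HolderConjugate q) {ε : ℝ} (hε : 0 < ε) :
    ∃ C : ℝ, 0 ≤ C ∧ ∀ a b : ℝ,
      |dpow p a - dpow p b| ^ q ≤ ε * (|a| ^ p + |b| ^ p) + C * |a - b| ^ p := by
  have hp : 1 < p := hpq.lt
  have hq : 1 < q := hpq.symm.lt
  have hd := continuous_dpow hp
  obtain ⟨C, hC, h⟩ := exists_le_of_homogeneous (p := p)
    (F := fun z => |dpow p z.1 - dpow p z.2| ^ q) (G := fun z => |z.1 - z.2| ^ p)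
    ((continuous_abs_rpow hq).comp ((hd.comp continuous_fst).sub (hd.comp continuous_snd)))
    (continuous_abs_sub_rpow hp)
    (fun t ht z => by
      simp only [Prod.smul_fst, Prod.smul_snd, smul_eq_mul, dpow_mul ht]
      rw [← mul_sub, abs_mul, abs_of_pos (Real.rpow_pos_of_pos ht _),
        Real.mul_rpow (Real.rpow_pos_of_pos ht _).le (abs_nonneg _), ← Real.rpow_mul ht.le,
        hpq.sub_one_mul_conj])
    (fun t ht z => abs_sub_rpow_homogeneous ht z)
    (by simp [dpow_zero, Real.zero_rpow (by linarith : q ≠ 0)]) (fun z => by positivity)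
    (fun z hz => by
      have hz' : z.1 = z.2 := by
        by_contra hne
        have : 0 < |z.1 - z.2| ^ p := Real.rpow_pos_of_pos (abs_pos.2 (sub_ne_zero.2 hne)) _
        exact this.ne' hz
      simp [hz', Real.zero_rpow (by linarith : q ≠ 0)]) hε
  exact ⟨C, hC, fun a b => h (a, b)⟩

lemma abs_dpow_rpow {p q : ℝ} (hpq : p.HolderConjugate q) (a : ℝ) :
    |dpow p a| ^ q = |a| ^ p := by
  rw [abs_dpow hpq.lt, ← Real.rpow_mul (abs_nonneg a), hpq.sub_one_mul_conj]

/-! ### Real valued `L^p` norms -/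

section LpTools

variable {Z : Type*} [MeasurableSpace Z] {μ : Measure Z} {p q : ℝ}

/-- The `L^p` norm as a real number. -/
def nrm {F : Type*} [NormedAddCommGroup F] (p : ℝ) (μ : Measure Z) (f : Z → F) : ℝ :=
  (eLpNorm f (ENNReal.ofReal p) μ).toReal

/-- Membership in `L^p` with a real exponent. -/
abbrev InLp {F : Type*} [NormedAddCommGroup F] (p : ℝ) (μ : Measure Z) (f : Z → F) : Prop :=
  MemLp f (ENNReal.ofReal p) μ

section Vector

variable {F : Type*} [NormedAddCommGroup F] {f g : Z → F}

lemma nrm_nonneg : 0 ≤ nrm p μ f := ENNReal.toReal_nonneg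

lemma one_le_ofReal (hp : 1 < p) : 1 ≤ ENNReal.ofReal p := by
  rw [← ENNReal.ofReal_one]
  exact ENNReal.ofReal_le_ofReal hp.le

lemma ofReal_ne_zero (hp : 1 < p) : ENNReal.ofReal p ≠ 0 :=
  (zero_lt_one.trans_le (one_le_ofReal hp)).ne'

lemma InLp.integrable_rpow (hp : 1 < p) (hf : InLp p μ f) :
    Integrable (fun x => ‖f x‖ ^ p) μ := by
  have := hf.integrable_norm_rpow (ofReal_ne_zero hp) ENNReal.ofReal_ne_top
  rwa [ENNReal.toReal_ofReal (by linarith)] at this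

lemma inLp_of_integrable_rpow (hp : 1 < p) (hm : AEStronglyMeasurable f μ)
    (hf : Integrable (fun x => ‖f x‖ ^ p) μ) : InLp p μ f := by
  rw [InLp, ← integrable_norm_rpow_iff hm (ofReal_ne_zero hp) ENNReal.ofReal_ne_top,
    ENNReal.toReal_ofReal (by linarith)]
  exact hf

lemma nrm_rpow (hp : 1 < p) (hf : InLp p μ f) : nrm p μ f ^ p = ∫ x, ‖f x‖ ^ p ∂μ := by
  have h0 : 0 ≤ ∫ x, ‖f x‖ ^ p ∂μ := integral_nonneg fun x => by positivity
  rw [nrm, hf.eLpNorm_eq_integral_rpow_norm (ofReal_ne_zero hp) ENNReal.ofReal_ne_top,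
    ENNReal.toReal_ofReal (by linarith : (0:ℝ) ≤ p), ENNReal.toReal_ofReal (by positivity),
    ← Real.rpow_mul h0, inv_mul_cancel₀ (by linarith), Real.rpow_one]

lemma nrm_eq (hp : 1 < p) (hf : InLp p μ f) : nrm p μ f = (∫ x, ‖f x‖ ^ p ∂μ) ^ (1 / p) := by
  rw [← nrm_rpow hp hf, ← Real.rpow_mul nrm_nonneg, mul_one_div_cancel (by linarith),
    Real.rpow_one]

lemma nrm_add_le (hp : 1 < p) (hf : InLp p μ f) (hg : InLp p μ g) :
    nrm p μ (f + g) ≤ nrm p μ f + nrm p μ g := by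
  rw [nrm, nrm, nrm, ← ENNReal.toReal_add hf.eLpNorm_ne_top hg.eLpNorm_ne_top]
  exact ENNReal.toReal_mono (ENNReal.add_ne_top.2 ⟨hf.eLpNorm_ne_top, hg.eLpNorm_ne_top⟩)
    (eLpNorm_add_le hf.1 hg.1 (one_le_ofReal hp))

lemma nrm_neg : nrm p μ (-f) = nrm p μ f := by rw [nrm, nrm, eLpNorm_neg]

lemma nrm_sub_comm : nrm p μ (f - g) = nrm p μ (g - f) := by rw [← nrm_neg, neg_sub]

lemma nrm_sub_le (hp : 1 < p) (hf : InLp p μ f) (hg : InLp p μ g) :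
    nrm p μ (f - g) ≤ nrm p μ f + nrm p μ g := by
  rw [sub_eq_add_neg, ← nrm_neg (f := g)]
  exact nrm_add_le hp hf hg.neg

lemma nrm_le_add_sub (hp : 1 < p) (hf : InLp p μ f) (hg : InLp p μ g) :
    nrm p μ f ≤ nrm p μ g + nrm p μ (f - g) := by
  have := nrm_add_le hp hg (hf.sub hg)
  rwa [add_sub_cancel] at this

lemma nrm_congr_ae (h : f =ᵐ[μ] g) : nrm p μ f = nrm p μ g := by
  rw [nrm, nrm, eLpNorm_congr_ae h]

lemma nrm_eq_zero_iff (hp : 1 < p) (hf : InLp p μ f) : nrm p μ f = 0 ↔ f =ᵐ[μ] 0 := by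
  rw [nrm, ENNReal.toReal_eq_zero_iff, eLpNorm_eq_zero_iff hf.1 (ofReal_ne_zero hp)]
  simp [hf.eLpNorm_ne_top]

lemma nrm_le_mul {G : Type*} [NormedAddCommGroup G] {g : Z → G} (hg : InLp p μ g) {c : ℝ}
    (hc : 0 ≤ c) (h : ∀ᵐ x ∂μ, ‖f x‖ ≤ c * ‖g x‖) : nrm p μ f ≤ c * nrm p μ g := by
  have h1 := eLpNorm_le_mul_eLpNorm_of_ae_le_mul h (ENNReal.ofReal p)
  have h2 := ENNReal.toReal_mono (ENNReal.mul_ne_top ENNReal.ofReal_ne_top hg.eLpNorm_ne_top) h1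
  rwa [ENNReal.toReal_mul, ENNReal.toReal_ofReal hc] at h2

lemma nrm_const_smul [NormedSpace ℝ F] (c : ℝ) : nrm p μ (c • f) = |c| * nrm p μ f := by
  rw [nrm, nrm, eLpNorm_const_smul, ENNReal.toReal_mul, toReal_enorm, Real.norm_eq_abs]

lemma tendsto_eLpNorm_iff_nrm {ι : Type*} {l : Filter ι} {f : ι → Z → F}
    (hf : ∀ᶠ i in l, InLp p μ (f i)) :
    Tendsto (fun i => eLpNorm (f i) (ENNReal.ofReal p) μ) l (𝓝 0) ↔
      Tendsto (fun i => nrm p μ (f i)) l (𝓝 0) := by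
  constructor
  · intro h
    have := (ENNReal.tendsto_toReal (ENNReal.zero_ne_top)).comp h
    exact this
  · intro h
    have h2 := ENNReal.tendsto_ofReal h
    rw [ENNReal.ofReal_zero] at h2
    refine h2.congr' ?_
    filter_upwards [hf] with i hi
    rw [nrm, ENNReal.ofReal_toReal hi.eLpNorm_ne_top]

lemma tendsto_nrm_of_rpow (hp : 1 < p) {ι : Type*} {l : Filter ι} {f : ι → Z → F}
    (hf : ∀ᶠ i in l, InLp p μ (f i))
    (h : Tendsto (fun i => ∫ x, ‖f i x‖ ^ p ∂μ) l (𝓝 0)) :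
    Tendsto (fun i => nrm p μ (f i)) l (𝓝 0) := by
  have h1 := h.rpow_const (p := 1 / p) (Or.inr (by positivity))
  rw [Real.zero_rpow (by positivity)] at h1
  refine h1.congr' ?_
  filter_upwards [hf] with i hi
  rw [nrm_eq hp hi]

lemma tendsto_integral_rpow (hp : 1 < p) {ι : Type*} {l : Filter ι} {f : ι → Z → F}
    (hf : ∀ᶠ i in l, InLp p μ (f i)) (h : Tendsto (fun i => nrm p μ (f i)) l (𝓝 0)) :
    Tendsto (fun i => ∫ x, ‖f i x‖ ^ p ∂μ) l (𝓝 0) := by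
  have h1 := h.rpow_const (p := p) (Or.inr (by positivity))
  rw [Real.zero_rpow (by positivity)] at h1
  refine h1.congr' ?_
  filter_upwards [hf] with i hi
  rw [nrm_rpow hp hi]

end Vector

lemma integral_comb {a b c : Z → ℝ} (ha : Integrable a μ) (hb : Integrable b μ)
    (hc : Integrable c μ) (s t : ℝ) :
    ∫ x, (s * (a x + b x) + t * c x) ∂μ = s * (∫ x, a x ∂μ + ∫ x, b x ∂μ) + t * ∫ x, c x ∂μ := by
  have hab : Integrable (fun x => a x + b x) μ := ha.add hb
  rw [integral_add (hab.const_mul s) (hc.const_mul t), integral_const_mul,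
    integral_const_mul, integral_add ha hb]

/-- A limit criterion: quantities bounded by `ε B + C_ε Y` with `Y → 0`. -/
lemma tendsto_zero_of_le_eps {ι : Type*} {l : Filter ι} {X Y : ι → ℝ} (B : ℝ)
    (hX : ∀ᶠ i in l, 0 ≤ X i) (hY : Tendsto Y l (𝓝 0))
    (h : ∀ ε > 0, ∃ C : ℝ, ∀ᶠ i in l, X i ≤ ε * B + C * Y i) : Tendsto X l (𝓝 0) := by
  rw [Metric.tendsto_nhds]
  intro δ hδ
  obtain ⟨C, hC⟩ := h (δ / (2 * (|B| + 1))) (by positivity)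
  have h1 : Tendsto (fun i => C * Y i) l (𝓝 0) := by simpa using hY.const_mul C
  have h2 := h1.eventually (gt_mem_nhds (by positivity : (0:ℝ) < δ / 2))
  filter_upwards [hC, h2, hX] with i h3 h4 h5
  rw [Real.dist_eq, sub_zero, abs_of_nonneg h5]
  have h6 : δ / (2 * (|B| + 1)) * B ≤ δ / 2 := by
    rw [div_mul_eq_mul_div, div_le_div_iff₀ (by positivity) (by positivity)]
    nlinarith [le_abs_self B]
  linarith

variable {f g : Z → ℝ}

lemma integrable_mul_of_inLp (hpq : p.HolderConjugate q) (hf : InLp p μ f) (hg : InLp q μ g) :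
    Integrable (fun x => f x * g x) μ := by
  have := hpq.ennrealOfReal
  exact hf.integrable_mul hg

lemma abs_integral_mul_le (hpq : p.HolderConjugate q) (hf : InLp p μ f) (hg : InLp q μ g) :
    |∫ x, f x * g x ∂μ| ≤ nrm p μ f * nrm q μ g := by
  rw [nrm_eq hpq.lt hf, nrm_eq hpq.symm.lt hg]
  refine le_trans ?_ (integral_mul_norm_le_Lp_mul_Lq hpq hf hg)
  refine (abs_integral_le_integral_abs).trans (le_of_eq ?_)
  simp [abs_mul]

lemma InLp.bdd_mul_left {k : Z → ℝ} {B : ℝ} (hk : AEStronglyMeasurable k μ)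
    (hB : ∀ᵐ x ∂μ, |k x| ≤ B) (hf : InLp p μ f) : InLp p μ (fun x => k x * f x) := by
  refine hf.of_le_mul (hk.mul hf.1) (c := B) ?_
  filter_upwards [hB] with x hx
  rw [norm_mul, Real.norm_eq_abs]
  gcongr

lemma nrm_bdd_mul_le {k : Z → ℝ} {B : ℝ} (hB0 : 0 ≤ B)
    (hB : ∀ᵐ x ∂μ, |k x| ≤ B) (hf : InLp p μ f) :
    nrm p μ (fun x => k x * f x) ≤ B * nrm p μ f := by
  refine nrm_le_mul hf hB0 ?_
  filter_upwards [hB] with x hx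
  rw [norm_mul, Real.norm_eq_abs]
  gcongr

lemma inLp_dpow (hpq : p.HolderConjugate q) (hf : InLp p μ f) :
    InLp q μ (fun x => dpow p (f x)) := by
  refine inLp_of_integrable_rpow hpq.symm.lt
    ((continuous_dpow hpq.lt).comp_aestronglyMeasurable hf.1) ?_
  refine (InLp.integrable_rpow hpq.lt hf).congr (ae_of_all _ fun x => ?_)
  simp only [Real.norm_eq_abs, abs_dpow_rpow hpq]

/-- `f ↦ |f|^(p-2) f` is continuous from `L^p` to the dual Lebesgue space. -/
lemma tendsto_dpow (hpq : p.HolderConjugate q) {ι : Type*} {l : Filter ι} {F : ι → Z → ℝ}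
    (hF : ∀ᶠ i in l, InLp p μ (F i)) (hf : InLp p μ f)
    (h : Tendsto (fun i => nrm p μ (F i - f)) l (𝓝 0)) :
    Tendsto (fun i => nrm q μ ((fun x => dpow p (F i x)) - fun x => dpow p (f x))) l (𝓝 0) := by
  have hp := hpq.lt
  refine tendsto_nrm_of_rpow hpq.symm.lt
    (hF.mono fun i hi => (inLp_dpow hpq hi).sub (inLp_dpow hpq hf)) ?_
  have hY := tendsto_integral_rpow hp (hF.mono fun i hi => hi.sub hf) h
  -- The constant bounds the sum of the two `p`-th powers as soon as `F i` is within distance one of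
  -- `f`.
  refine tendsto_zero_of_le_eps ((nrm p μ f + 1) ^ p + nrm p μ f ^ p)
    (Eventually.of_forall fun i => integral_nonneg fun x => by positivity) hY fun ε hε => ?_
  obtain ⟨C, hC, hle⟩ := exists_abs_dpow_sub_rpow_le hpq hε
  refine ⟨C, ?_⟩
  filter_upwards [hF, h.eventually (gt_mem_nhds zero_lt_one)] with i hi h1
  have hb : nrm p μ (F i) ^ p ≤ (nrm p μ f + 1) ^ p :=
    Real.rpow_le_rpow nrm_nonneg ((nrm_le_add_sub hp hi hf).trans (by linarith)) (by linarith)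
  have i1 := InLp.integrable_rpow hp hi
  have i2 := InLp.integrable_rpow hp hf
  have i3 := InLp.integrable_rpow hp (hi.sub hf)
  calc ∫ x, ‖((fun x => dpow p (F i x)) - fun x => dpow p (f x)) x‖ ^ q ∂μ
      ≤ ∫ x, (ε * (‖F i x‖ ^ p + ‖f x‖ ^ p) + C * ‖(F i - f) x‖ ^ p) ∂μ := by
        refine integral_mono_of_nonneg (ae_of_all _ fun x => by positivity)
          (((i1.add i2).const_mul ε).add (i3.const_mul C)) (ae_of_all _ fun x => ?_)
        exact hle (F i x) (f x)
    _ = ε * (nrm p μ (F i) ^ p + nrm p μ f ^ p) + C * ∫ x, ‖(F i - f) x‖ ^ p ∂μ := by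
        rw [integral_comb i1 i2 i3, nrm_rpow hp hi, nrm_rpow hp hf]
    _ ≤ _ := by gcongr

/-- Strong monotonicity in limit form. -/
lemma tendsto_nrm_of_monotone_form (hpq : p.HolderConjugate q) {ι : Type*} {l : Filter ι}
    {F G k : ι → Z → ℝ} {c B M : ℝ} (hc : 0 < c)
    (hk : ∀ᶠ i in l, AEStronglyMeasurable (k i) μ ∧ ∀ᵐ x ∂μ, c ≤ k i x ∧ k i x ≤ M)
    (hF : ∀ᶠ i in l, InLp p μ (F i) ∧ nrm p μ (F i) ≤ B)
    (hG : ∀ᶠ i in l, InLp p μ (G i) ∧ nrm p μ (G i) ≤ B)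
    (h : Tendsto (fun i => ∫ x, k i x * ((dpow p (F i x) - dpow p (G i x)) * (F i x - G i x)) ∂μ)
      l (𝓝 0)) :
    Tendsto (fun i => nrm p μ (F i - G i)) l (𝓝 0) := by
  have hp := hpq.lt
  refine tendsto_nrm_of_rpow hp (by filter_upwards [hF, hG] with i h1 h2 using h1.1.sub h2.1) ?_
  refine tendsto_zero_of_le_eps (B ^ p + B ^ p)
    (Eventually.of_forall fun i => integral_nonneg fun x => by positivity) h fun ε hε => ?_
  obtain ⟨C, hC, hle⟩ := exists_abs_sub_rpow_le_dpow hp hε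
  -- The weight is at least `c`, so dividing by `c` pays for inserting it into the monotonicity
  -- product.
  refine ⟨C / c, ?_⟩
  filter_upwards [hF, hG, hk] with i ⟨hFi, hFB⟩ ⟨hGi, hGB⟩ ⟨hkm, hki⟩
  have i1 := InLp.integrable_rpow hp hFi
  have i2 := InLp.integrable_rpow hp hGi
  have hkb : ∀ᵐ x ∂μ, |k i x| ≤ M := by
    filter_upwards [hki] with x hx
    rw [abs_of_nonneg (hc.le.trans hx.1)]
    exact hx.2
  have i3 : Integrable (fun x => k i x * ((dpow p (F i x) - dpow p (G i x)) *
      (F i x - G i x))) μ := by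
    have := integrable_mul_of_inLp hpq.symm
      (InLp.bdd_mul_left hkm hkb ((inLp_dpow hpq hFi).sub (inLp_dpow hpq hGi))) (hFi.sub hGi)
    refine this.congr (ae_of_all _ fun x => ?_)
    simp only [Pi.sub_apply]
    ring
  calc ∫ x, ‖(F i - G i) x‖ ^ p ∂μ
      ≤ ∫ x, (ε * (‖F i x‖ ^ p + ‖G i x‖ ^ p) + C / c * (k i x *
          ((dpow p (F i x) - dpow p (G i x)) * (F i x - G i x)))) ∂μ := by
        refine integral_mono_of_nonneg (ae_of_all _ fun x => by positivity)
          (((i1.add i2).const_mul ε).add (i3.const_mul _)) ?_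
        filter_upwards [hki] with x hx
        refine (hle (F i x) (G i x)).trans ?_
        have h0 := dpow_sub_mul_nonneg hp (F i x) (G i x)
        rw [div_mul_eq_mul_div, Real.norm_eq_abs, Real.norm_eq_abs]
        gcongr
        rw [le_div_iff₀ hc, mul_assoc]
        refine mul_le_mul_of_nonneg_left ?_ hC
        rw [mul_comm]
        exact mul_le_mul_of_nonneg_right hx.1 h0
    _ = ε * (nrm p μ (F i) ^ p + nrm p μ (G i) ^ p) + C / c * ∫ x, k i x *
          ((dpow p (F i x) - dpow p (G i x)) * (F i x - G i x)) ∂μ := by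
        rw [integral_comb i1 i2 i3, nrm_rpow hp hFi, nrm_rpow hp hGi]
    _ ≤ _ := by
        have e1 : nrm p μ (F i) ^ p ≤ B ^ p := Real.rpow_le_rpow nrm_nonneg hFB (by linarith)
        have e2 : nrm p μ (G i) ^ p ≤ B ^ p := Real.rpow_le_rpow nrm_nonneg hGB (by linarith)
        gcongr

lemma exists_limit_of_cauchy {F : Type*} [NormedAddCommGroup F] [CompleteSpace F] (hp : 1 < p)
    {f : ℕ → Z → F} (hf : ∀ i, InLp p μ (f i))
    (hc : ∀ ε > 0, ∃ N, ∀ i ≥ N, ∀ j ≥ N, nrm p μ (f i - f j) < ε) :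
    ∃ g, InLp p μ g ∧ Tendsto (fun i => nrm p μ (f i - g)) atTop (𝓝 0) := by
  have : Fact (1 ≤ ENNReal.ofReal p) := ⟨one_le_ofReal hp⟩
  have hcau : CauchySeq (fun i => (hf i).toLp (f i)) := by
    rw [Metric.cauchySeq_iff]
    intro ε hε
    obtain ⟨N, hN⟩ := hc ε hε
    refine ⟨N, fun i hi j hj => ?_⟩
    rw [Lp.dist_def, eLpNorm_congr_ae ((hf i).coeFn_toLp.sub (hf j).coeFn_toLp)]
    exact hN i hi j hj
  obtain ⟨g, hg⟩ := cauchySeq_tendsto_of_complete hcau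
  refine ⟨g, Lp.memLp g, ?_⟩
  have := tendsto_iff_dist_tendsto_zero.1 hg
  refine this.congr fun i => ?_
  rw [Lp.dist_def, eLpNorm_congr_ae ((hf i).coeFn_toLp.sub (EventuallyEq.refl _ _))]
  rfl

end LpTools

/-! ### Existence for monotone problems and weak limits -/

section Existence

variable {Z : Type*} [MeasurableSpace Z] {μ : Measure Z} {p q : ℝ}

/-- Coercivity: as `p > 1`, the power beats the linear term. Above the threshold one has `A <
X^(p-1)`, and `X > 1` lets `|K|` be absorbed into `|K| X`. -/
lemma exists_bound_of_rpow_le {p c : ℝ} (hp : 1 < p) (hc : 0 < c) (C K : ℝ) :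
    ∃ B : ℝ, 0 ≤ B ∧ ∀ X : ℝ, 0 ≤ X → c * X ^ p ≤ C * X + K → X ≤ B := by
  set A : ℝ := (|C| + |K|) / c
  have hA : 0 ≤ A := by positivity
  refine ⟨max 1 (A ^ (1 / (p - 1))), by positivity, fun X hX h => ?_⟩
  by_contra! hcon
  have h1 : 1 < X := (le_max_left _ _).trans_lt hcon
  have h2 : A ^ (1 / (p - 1)) < X := (le_max_right _ _).trans_lt hcon
  have h3 : A < X ^ (p - 1) := by
    have := Real.rpow_lt_rpow (by positivity) h2 (by linarith : 0 < p - 1)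
    rwa [← Real.rpow_mul hA, one_div_mul_cancel (by linarith), Real.rpow_one] at this
  have h4 : X ^ p = X ^ (p - 1) * X := by
    rw [← Real.rpow_add_one (by linarith)]
    congr 1
    ring
  have h5 : |C| + |K| < c * X ^ (p - 1) := by
    rwa [div_lt_iff₀' hc] at h3
  have h6 : (|C| + |K|) * X < c * X ^ p := by
    rw [h4, ← mul_assoc]
    exact mul_lt_mul_of_pos_right h5 (by linarith)
  nlinarith [le_abs_self C, le_abs_self K, abs_nonneg K]

/-- Continuity of `k |f|^(p-2) f` tested against a fixed function, along `f + t g`. -/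
lemma tendsto_form_add_smul (hpq : p.HolderConjugate q) {k f g : Z → ℝ} {M : ℝ}
    (hk : AEStronglyMeasurable k μ) (hkM : ∀ᵐ x ∂μ, |k x| ≤ M)
    (hf : InLp p μ f) (hg : InLp p μ g) :
    Tendsto (fun t : ℝ => ∫ x, k x * (dpow p (f x + t * g x) * g x) ∂μ) (𝓝 0)
      (𝓝 (∫ x, k x * (dpow p (f x) * g x) ∂μ)) := by
  have hF : ∀ t : ℝ, InLp p μ (f + t • g) := fun t => hf.add (hg.const_smul t)
  have h1 : Tendsto (fun t : ℝ => nrm p μ ((f + t • g) - f)) (𝓝 0) (𝓝 0) := by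
    simp only [add_sub_cancel_left, nrm_const_smul]
    have : Tendsto (fun t : ℝ => |t| * nrm p μ g) (𝓝 0) (𝓝 (|0| * nrm p μ g)) :=
      (continuous_abs.tendsto 0).mul_const _
    simpa using this
  have h2 := tendsto_dpow hpq (Eventually.of_forall hF) hf h1
  have hkg : InLp p μ (fun x => k x * g x) := hg.bdd_mul_left hk hkM
  have h3 := h2.mul_const (nrm p μ (fun x => k x * g x))
  rw [zero_mul] at h3
  rw [tendsto_iff_dist_tendsto_zero]
  refine squeeze_zero (fun _ => dist_nonneg) (fun t => ?_) h3
  have hd1 := inLp_dpow hpq (hF t)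
  have hd2 := inLp_dpow hpq hf
  refine le_trans (le_of_eq ?_) (abs_integral_mul_le hpq.symm (hd1.sub hd2) hkg)
  rw [Real.dist_eq, ← integral_sub]
  · congr 1
    refine integral_congr_ae (ae_of_all _ fun x => ?_)
    simp only [Pi.sub_apply, Pi.add_apply, Pi.smul_apply, smul_eq_mul]
    ring
  · refine (integrable_mul_of_inLp hpq.symm hd1 hkg).congr (ae_of_all _ fun x => ?_)
    simp only [Pi.add_apply, Pi.smul_apply, smul_eq_mul]
    ring
  · refine (integrable_mul_of_inLp hpq.symm hd2 hkg).congr (ae_of_all _ fun x => ?_)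
    ring

/-- Existence of weak solutions for the Euler-Lagrange equation of
`v ↦ (1/p) ∫ k |T v|^p - ℓ v`, for a linear map `T` with closed range in `L^p`. -/
theorem exists_weak_solution (hpq : p.HolderConjugate q) {V : Type*} [AddCommGroup V]
    [Module ℝ V] (T : V →ₗ[ℝ] (Z → ℝ)) (hT : ∀ v, InLp p μ (T v))
    (hcl : ∀ (v : ℕ → V) (g : Z → ℝ), InLp p μ g →
      Tendsto (fun j => nrm p μ (T (v j) - g)) atTop (𝓝 0) → ∃ u, T u =ᵐ[μ] g)
    {k : Z → ℝ} {c M : ℝ} (hc : 0 < c) (hk : AEStronglyMeasurable k μ)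
    (hkb : ∀ᵐ x ∂μ, c ≤ k x ∧ k x ≤ M) (ℓ : V →ₗ[ℝ] ℝ) {C : ℝ}
    (hℓ : ∀ v, |ℓ v| ≤ C * nrm p μ (T v)) :
    ∃ u, ∀ v, ∫ x, k x * (dpow p (T u x) * T v x) ∂μ = ℓ v := by
  have hp := hpq.lt
  have hp0 : 0 < p := by linarith
  have hkM : ∀ᵐ x ∂μ, |k x| ≤ M := by
    filter_upwards [hkb] with x hx
    rw [abs_of_nonneg (hc.le.trans hx.1)]
    exact hx.2
  have ik : ∀ {h : Z → ℝ}, Integrable h μ → Integrable (fun x => k x * h x) μ := fun hh =>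
    hh.bdd_mul hk hkM
  have iT : ∀ v, Integrable (fun x => |T v x| ^ p) μ := fun v => InLp.integrable_rpow hp (hT v)
  set e : V → ℝ := fun v => ∫ x, k x * |T v x| ^ p ∂μ with he
  set J : V → ℝ := fun v => e v / p - ℓ v with hJ
  have e_ge : ∀ v, c * nrm p μ (T v) ^ p ≤ e v := fun v => by
    rw [nrm_rpow hp (hT v), ← integral_const_mul]
    refine integral_mono_ae ((iT v).const_mul c) (ik (iT v)) ?_
    filter_upwards [hkb] with x hx
    exact mul_le_mul_of_nonneg_right hx.1 (by positivity)
  -- Sublevel sets of `J` are bounded in the seminorm `nrm p μ (T v)`. This serves to bound `J`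
  -- below and to bound the minimizing sequence.
  have bound : ∀ K : ℝ, ∃ B, 0 ≤ B ∧ ∀ v, J v ≤ K → nrm p μ (T v) ≤ B := fun K => by
    obtain ⟨B, hB0, hB⟩ := exists_bound_of_rpow_le hp (div_pos hc hp0) C K
    refine ⟨B, hB0, fun v hv => hB _ nrm_nonneg ?_⟩
    have h1 : c / p * nrm p μ (T v) ^ p ≤ e v / p := by
      rw [div_mul_eq_mul_div]
      exact div_le_div_of_nonneg_right (e_ge v) hp0.le
    have h2 := (le_abs_self _).trans (hℓ v)
    simp only [hJ] at hv
    linarith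
  have e_nonneg : ∀ v, 0 ≤ e v := fun v =>
    le_trans (mul_nonneg hc.le (Real.rpow_nonneg nrm_nonneg _)) (e_ge v)
  have bdd : BddBelow (Set.range J) := by
    obtain ⟨B, hB0, hB⟩ := bound 0
    refine ⟨-(|C| * B), ?_⟩
    rintro _ ⟨v, rfl⟩
    by_cases hv : J v ≤ 0
    · have h1 := (le_abs_self _).trans (hℓ v)
      have h2 : C * nrm p μ (T v) ≤ |C| * B :=
        mul_le_mul (le_abs_self C) (hB v hv) nrm_nonneg (abs_nonneg C)
      have h3 : 0 ≤ e v / p := div_nonneg (e_nonneg v) hp0.le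
      simp only [hJ]
      linarith
    · push Not at hv
      have : 0 ≤ |C| * B := by positivity
      linarith
  set I : ℝ := ⨅ v, J v with hI
  have I_le : ∀ v, I ≤ J v := fun v => ciInf_le bdd v
  have seq : ∀ j : ℕ, ∃ v, J v < I + 1 / ((j : ℝ) + 1) := fun j =>
    exists_lt_of_ciInf_lt (by
      have : (0:ℝ) < 1 / ((j : ℝ) + 1) := by positivity
      linarith)
  choose v hv using seq
  have hvI : Tendsto (fun j => J (v j)) atTop (𝓝 I) := by
    have h0 : Tendsto (fun j : ℕ => I + 1 / ((j : ℝ) + 1)) atTop (𝓝 (I + 0)) :=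
      tendsto_one_div_add_atTop_nhds_zero_nat.const_add I
    rw [add_zero] at h0
    exact tendsto_of_tendsto_of_tendsto_of_le_of_le tendsto_const_nhds h0
      (fun j => I_le _) (fun j => (hv j).le)
  obtain ⟨B, hB0, hB⟩ := bound (I + 1)
  have hvB : ∀ j, nrm p μ (T (v j)) ≤ B := fun j => hB _ ((hv j).le.trans (by
    have : 1 / ((j : ℝ) + 1) ≤ 1 := by
      rw [div_le_one (by positivity)]
      linarith [(Nat.cast_nonneg j : (0:ℝ) ≤ j)]
    linarith))
  -- the minimizing sequence is Cauchy
  have imid : ∀ a b, Integrable (fun x => midDefect p (T a x) (T b x)) μ := fun a b => by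
    have h1 := iT ((1 / 2 : ℝ) • (a + b))
    refine (((iT a).add (iT b)).div_const 2 |>.sub h1).congr (ae_of_all _ fun x => ?_)
    simp only [Pi.sub_apply, Pi.add_apply, map_smul, map_add, Pi.smul_apply, smul_eq_mul,
      midDefect]
    rw [show 1 / 2 * (T a x + T b x) = (T a x + T b x) / 2 by ring]
  -- The linear term `ℓ` cancels in the midpoint defect of `J`, and the midpoint itself cannot go
  -- below the infimum `I`; so the convexity defect of two near-minimizers is small.
  have mid : ∀ a b, c * ∫ x, midDefect p (T a x) (T b x) ∂μ
      ≤ p * ((J a + J b) / 2 - I) := fun a b => by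
    have h1 : c * ∫ x, midDefect p (T a x) (T b x) ∂μ
        ≤ ∫ x, k x * midDefect p (T a x) (T b x) ∂μ := by
      rw [← integral_const_mul]
      refine integral_mono_ae ((imid a b).const_mul c) (ik (imid a b)) ?_
      filter_upwards [hkb] with x hx
      exact mul_le_mul_of_nonneg_right hx.1 (midDefect_nonneg hp _ _)
    have h2 : ∫ x, k x * midDefect p (T a x) (T b x) ∂μ
        = (e a + e b) / 2 - e ((1 / 2 : ℝ) • (a + b)) := by
      rw [he]
      simp only
      have isum : Integrable (fun x => (k x * |T a x| ^ p + k x * |T b x| ^ p) / 2) μ :=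
        ((ik (iT a)).add (ik (iT b))).div_const 2
      rw [← integral_add (ik (iT a)) (ik (iT b)), ← integral_div, ← integral_sub isum (ik (iT _))]
      refine integral_congr_ae (ae_of_all _ fun x => ?_)
      simp only [map_smul, map_add, Pi.smul_apply, Pi.add_apply, smul_eq_mul, midDefect]
      rw [show 1 / 2 * (T a x + T b x) = (T a x + T b x) / 2 by ring]
      ring
    have h3 := I_le ((1 / 2 : ℝ) • (a + b))
    have h4 : e ((1 / 2 : ℝ) • (a + b)) = p * (J ((1 / 2 : ℝ) • (a + b)) + (ℓ a + ℓ b) / 2) := by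
      simp only [hJ, map_smul, map_add, smul_eq_mul]
      field_simp
      ring
    have h5 : (e a + e b) / 2 = p * ((J a + J b) / 2 + (ℓ a + ℓ b) / 2) := by
      simp only [hJ]
      field_simp
      ring
    rw [h2, h4, h5] at h1
    nlinarith
  have hcauchy : ∀ ε > 0, ∃ N, ∀ i ≥ N, ∀ j ≥ N, nrm p μ (T (v i) - T (v j)) < ε := by
    intro ε hε
    have hεp : 0 < ε ^ p := Real.rpow_pos_of_pos hε p
    -- Chosen so that `δ (B^p + B^p) ≤ ε^p / 2`; the added `1` covers the case `B = 0`.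
    set δ : ℝ := ε ^ p / (2 * (2 * B ^ p + 1)) with hδ
    have hBp : 0 ≤ B ^ p := Real.rpow_nonneg hB0 p
    have hδ0 : 0 < δ := by positivity
    obtain ⟨D, hD, hle⟩ := exists_abs_sub_rpow_le_midDefect hp hδ0
    have hlim : Tendsto (fun j => D * (p * (J (v j) - I) / c)) atTop
        (𝓝 (D * (p * (I - I) / c))) :=
      (((hvI.sub_const I).const_mul p).div_const c).const_mul D
    rw [sub_self, mul_zero, zero_div, mul_zero] at hlim
    obtain ⟨N, hN⟩ := eventually_atTop.1
      (hlim.eventually (gt_mem_nhds (by positivity : (0:ℝ) < ε ^ p / 2)))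
    refine ⟨N, fun i hi j hj => ?_⟩
    have key : nrm p μ (T (v i) - T (v j)) ^ p < ε ^ p := by
      rw [nrm_rpow hp ((hT _).sub (hT _))]
      calc ∫ x, ‖(T (v i) - T (v j)) x‖ ^ p ∂μ
          ≤ ∫ x, (δ * (|T (v i) x| ^ p + |T (v j) x| ^ p)
            + D * midDefect p (T (v i) x) (T (v j) x)) ∂μ := by
            refine integral_mono_of_nonneg (ae_of_all _ fun x => by positivity)
              ((((iT _).add (iT _)).const_mul δ).add ((imid _ _).const_mul D))
              (ae_of_all _ fun x => hle _ _)
        _ = δ * (nrm p μ (T (v i)) ^ p + nrm p μ (T (v j)) ^ p)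
            + D * ∫ x, midDefect p (T (v i) x) (T (v j) x) ∂μ := by
            rw [integral_comb (iT _) (iT _) (imid _ _), nrm_rpow hp (hT _), nrm_rpow hp (hT _)]
            rfl
        _ ≤ δ * (B ^ p + B ^ p) + D * (p * ((J (v i) + J (v j)) / 2 - I) / c) := by
            have e1 : nrm p μ (T (v i)) ^ p ≤ B ^ p :=
              Real.rpow_le_rpow nrm_nonneg (hvB i) hp0.le
            have e2 : nrm p μ (T (v j)) ^ p ≤ B ^ p :=
              Real.rpow_le_rpow nrm_nonneg (hvB j) hp0.le
            have e3 : ∫ x, midDefect p (T (v i) x) (T (v j) x) ∂μ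
                ≤ p * ((J (v i) + J (v j)) / 2 - I) / c := by
              rw [le_div_iff₀ hc, mul_comm]
              exact mid _ _
            gcongr
        _ < ε ^ p / 2 + ε ^ p / 2 := by
            have e1 : δ * (B ^ p + B ^ p) ≤ ε ^ p / 2 := by
              rw [hδ, div_mul_eq_mul_div, div_le_div_iff₀ (by positivity) (by positivity)]
              nlinarith
            have e2 := hN i hi
            have e3 := hN j hj
            have e4 : D * (p * ((J (v i) + J (v j)) / 2 - I) / c)
                = (D * (p * (J (v i) - I) / c) + D * (p * (J (v j) - I) / c)) / 2 := by
              ring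
            linarith
        _ = ε ^ p := by ring
    exact (Real.rpow_lt_rpow_iff nrm_nonneg hε.le hp0).1 key
  obtain ⟨g, hg, hgl⟩ := exists_limit_of_cauchy hp (fun j => hT (v j)) hcauchy
  obtain ⟨u, hu⟩ := hcl v g hg hgl
  have hul : Tendsto (fun j => nrm p μ (T u - T (v j))) atTop (𝓝 0) := by
    refine hgl.congr fun j => ?_
    rw [nrm_sub_comm]
    exact nrm_congr_ae (hu.symm.sub (EventuallyEq.refl _ _))
  have hkd : InLp q μ (fun x => k x * dpow p (T u x)) := (inLp_dpow hpq (hT u)).bdd_mul_left hk hkM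
  have hmin : J u ≤ I := by
    -- The tangent inequality at `u` bounds `J u - J (v j)` by a multiple of the distance from `T u`
    -- to `T (v j)`, which is all the semicontinuity needed.
    have h1 : ∀ j, J u ≤ J (v j)
        + (nrm q μ (fun x => k x * dpow p (T u x)) + C) * nrm p μ (T u - T (v j)) := fun j => by
      have i1 := integrable_mul_of_inLp hpq.symm hkd ((hT u).sub (hT (v j)))
      have h2 : e u / p - e (v j) / p
          ≤ ∫ x, k x * dpow p (T u x) * (T u - T (v j)) x ∂μ := by
        rw [he]
        simp only
        rw [← integral_div, ← integral_div, ← integral_sub ((ik (iT _)).div_const p)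
          ((ik (iT _)).div_const p)]
        refine integral_mono_ae (((ik (iT _)).div_const p).sub ((ik (iT _)).div_const p)) i1 ?_
        filter_upwards [hkb] with x hx
        have := dpow_mul_sub_le hp (T (v j) x) (T u x)
        have h0 : 0 ≤ k x := hc.le.trans hx.1
        simp only [Pi.sub_apply]
        rw [mul_div_assoc, mul_div_assoc, ← mul_sub, mul_assoc]
        refine mul_le_mul_of_nonneg_left ?_ h0
        linarith
      have h3 := (le_abs_self _).trans (abs_integral_mul_le hpq.symm hkd ((hT u).sub (hT (v j))))
      have h4 := (neg_abs_le _).trans' (neg_le_neg (hℓ (u - v j)))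
      rw [map_sub, map_sub] at h4
      simp only [hJ]
      linarith
    have h2 : Tendsto (fun j => J (v j)
        + (nrm q μ (fun x => k x * dpow p (T u x)) + C) * nrm p μ (T u - T (v j))) atTop
        (𝓝 (I + (nrm q μ (fun x => k x * dpow p (T u x)) + C) * 0)) :=
      hvI.add (hul.const_mul _)
    rw [mul_zero, add_zero] at h2
    exact ge_of_tendsto' h2 h1
  -- The tangent is taken at the perturbed point `u + t w`, so minimality gives a one-sided
  -- inequality after division by `t`, without differentiating under the integral. Then `t ↓ 0`, and
  -- `-w` in place of `w` gives the other inequality.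
  have ineq : ∀ w, ℓ w ≤ ∫ x, k x * (dpow p (T u x) * T w x) ∂μ := fun w => by
    have h1 : ∀ t : ℝ, 0 < t → ℓ w ≤ ∫ x, k x * (dpow p (T u x + t * T w x) * T w x) ∂μ := by
      intro t ht
      have h2 : J u ≤ J (u + t • w) := hmin.trans (I_le _)
      have hd : InLp q μ (fun x => k x * dpow p (T (u + t • w) x)) :=
        (inLp_dpow hpq (hT _)).bdd_mul_left hk hkM
      have i1 := integrable_mul_of_inLp hpq.symm hd (hT w)
      have h3 : e (u + t • w) / p - e u / p
          ≤ ∫ x, t * (k x * dpow p (T (u + t • w) x) * T w x) ∂μ := by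
        rw [he]
        simp only
        rw [← integral_div, ← integral_div, ← integral_sub ((ik (iT _)).div_const p)
          ((ik (iT _)).div_const p)]
        refine integral_mono_ae (((ik (iT _)).div_const p).sub ((ik (iT _)).div_const p))
          (i1.const_mul t) ?_
        filter_upwards [hkb] with x hx
        have h4 := dpow_mul_sub_le hp (T u x) (T (u + t • w) x)
        have h0 : 0 ≤ k x := hc.le.trans hx.1
        have h5 : T u x - T (u + t • w) x = -(t * T w x) := by
          simp only [map_add, map_smul, Pi.add_apply, Pi.smul_apply, smul_eq_mul]
          ring
        rw [h5] at h4
        rw [mul_div_assoc, mul_div_assoc, ← mul_sub,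
          show t * (k x * dpow p (T (u + t • w) x) * T w x)
            = k x * (dpow p (T (u + t • w) x) * (t * T w x)) by ring]
        refine mul_le_mul_of_nonneg_left ?_ h0
        linarith
      rw [integral_const_mul] at h3
      have h6 : t * ℓ w ≤ e (u + t • w) / p - e u / p := by
        simp only [hJ, map_add, map_smul, smul_eq_mul] at h2
        linarith
      have h7 := le_of_mul_le_mul_left (h6.trans h3) ht
      refine h7.trans (le_of_eq (integral_congr_ae (ae_of_all _ fun x => ?_)))
      simp only [map_add, map_smul, Pi.add_apply, Pi.smul_apply, smul_eq_mul]
      ring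
    have h2 := (tendsto_form_add_smul hpq hk hkM (hT u) (hT w)).mono_left
      (nhdsWithin_le_nhds (s := Set.Ioi 0))
    refine ge_of_tendsto h2 ?_
    filter_upwards [self_mem_nhdsWithin] with t ht using h1 t ht
  refine ⟨u, fun w => le_antisymm ?_ (ineq w)⟩
  have := ineq (-w)
  simp only [map_neg, Pi.neg_apply, mul_neg, integral_neg] at this
  linarith

/-- `L^p` as a space of functions. -/
def lpSubmodule (p : ℝ) (μ : Measure Z) : Submodule ℝ (Z → ℝ) where
  carrier := {f | InLp p μ f}
  add_mem' := fun hf hg => MemLp.add hf hg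
  zero_mem' := MemLp.zero
  smul_mem' := fun c _ hf => MemLp.const_smul hf c

/-- Bounded linear functionals on `L^q` are represented by functions of `L^p`. -/
theorem exists_representation (hpq : p.HolderConjugate q)
    (Λ : lpSubmodule q μ →ₗ[ℝ] ℝ) {C : ℝ} (hΛ : ∀ ψ, |Λ ψ| ≤ C * nrm q μ ψ.1) :
    ∃ w, InLp p μ w ∧ ∀ ψ, ∫ x, w x * ψ.1 x ∂μ = Λ ψ := by
  -- With exponents exchanged and `T` the inclusion, the Euler-Lagrange equation of `(1/q) ∫ |ψ|^q -
  -- Λ ψ` says that `dpow q g` represents `Λ`.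
  obtain ⟨g, hg⟩ := exists_weak_solution (μ := μ) hpq.symm (lpSubmodule q μ).subtype
    (fun v => v.2) (fun v g hg _ => ⟨⟨g, hg⟩, EventuallyEq.refl _ _⟩) (k := fun _ => 1) zero_lt_one
    aestronglyMeasurable_const (M := 1) (ae_of_all _ fun _ => ⟨le_rfl, le_rfl⟩) Λ hΛ
  exact ⟨fun x => dpow q (g.1 x), inLp_dpow hpq.symm g.2, fun ψ => by simpa using hg ψ⟩

/-- Bounded families in `L^p` have weak limits along ultrafilters. -/
theorem exists_weak_limit (hpq : p.HolderConjugate q) {ι : Type*} (U : Ultrafilter ι)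
    {w : ι → Z → ℝ} {B : ℝ} (hw : ∀ᶠ i in (U : Filter ι), InLp p μ (w i) ∧ nrm p μ (w i) ≤ B) :
    ∃ w₀, InLp p μ w₀ ∧ ∀ ψ, InLp q μ ψ →
      Tendsto (fun i => ∫ x, w i x * ψ x ∂μ) U (𝓝 (∫ x, w₀ x * ψ x ∂μ)) := by
  -- For each test function the pairings eventually stay in a compact interval, so the ultrafilter
  -- selects a limit. Uniqueness of limits makes it linear in `ψ`; neither separability nor a
  -- diagonal sequence is involved.
  have hlim : ∀ ψ : lpSubmodule q μ, ∃ L : ℝ, |L| ≤ B * nrm q μ ψ.1 ∧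
      Tendsto (fun i => ∫ x, w i x * ψ.1 x ∂μ) U (𝓝 L) := fun ψ => by
    have hb : ∀ᶠ i in (U : Filter ι), ∫ x, w i x * ψ.1 x ∂μ ∈
        Set.Icc (-(B * nrm q μ ψ.1)) (B * nrm q μ ψ.1) := by
      filter_upwards [hw] with i hi
      exact abs_le.1 ((abs_integral_mul_le hpq hi.1 ψ.2).trans
        (mul_le_mul_of_nonneg_right hi.2 nrm_nonneg))
    obtain ⟨L, hL, h⟩ := isCompact_Icc.ultrafilter_le_nhds
      (U.map fun i => ∫ x, w i x * ψ.1 x ∂μ) (le_principal_iff.2 hb)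
    exact ⟨L, abs_le.2 hL, h⟩
  choose L hLb hL using hlim
  let Λ : lpSubmodule q μ →ₗ[ℝ] ℝ :=
    { toFun := L
      map_add' := fun a b => by
        refine tendsto_nhds_unique_of_eventuallyEq (hL (a + b)) ((hL a).add (hL b)) ?_
        filter_upwards [hw] with i hi
        rw [← integral_add (integrable_mul_of_inLp hpq hi.1 a.2)
          (integrable_mul_of_inLp hpq hi.1 b.2)]
        refine integral_congr_ae (ae_of_all _ fun x => ?_)
        exact mul_add _ _ _
      map_smul' := fun c a => by
        refine tendsto_nhds_unique (hL (c • a)) (((hL a).const_mul c).congr fun i => ?_)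
        rw [← integral_const_mul]
        refine integral_congr_ae (ae_of_all _ fun x => ?_)
        exact mul_left_comm _ _ _ }
  obtain ⟨w₀, hw₀, h⟩ := exists_representation hpq Λ hLb
  refine ⟨w₀, hw₀, fun ψ hψ => ?_⟩
  rw [h ⟨ψ, hψ⟩]
  exact hL ⟨ψ, hψ⟩

/-- A weakly convergent bounded family tested against a strongly convergent one. -/
lemma tendsto_integral_weak_mul_strong (hpq : p.HolderConjugate q) {ι : Type*} {l : Filter ι}
    {w ψ : ι → Z → ℝ} {w₀ ψ₀ : Z → ℝ} {B : ℝ}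
    (hw : ∀ᶠ i in l, InLp p μ (w i) ∧ nrm p μ (w i) ≤ B)
    (hlim : ∀ φ, InLp q μ φ → Tendsto (fun i => ∫ x, w i x * φ x ∂μ) l (𝓝 (∫ x, w₀ x * φ x ∂μ)))
    (hψ : ∀ᶠ i in l, InLp q μ (ψ i)) (hψ₀ : InLp q μ ψ₀)
    (h : Tendsto (fun i => nrm q μ (ψ i - ψ₀)) l (𝓝 0)) :
    Tendsto (fun i => ∫ x, w i x * ψ i x ∂μ) l (𝓝 (∫ x, w₀ x * ψ₀ x ∂μ)) := by
  have h1 : Tendsto (fun i => ∫ x, w i x * (ψ i - ψ₀) x ∂μ) l (𝓝 0) := by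
    rw [tendsto_zero_iff_abs_tendsto_zero]
    have h2 := h.const_mul B
    rw [mul_zero] at h2
    refine squeeze_zero' (Eventually.of_forall fun _ => abs_nonneg _) ?_ h2
    filter_upwards [hw, hψ] with i hi hi'
    exact (abs_integral_mul_le hpq hi.1 (hi'.sub hψ₀)).trans
      (mul_le_mul_of_nonneg_right hi.2 nrm_nonneg)
  have h2 := h1.add (hlim ψ₀ hψ₀)
  rw [zero_add] at h2
  refine h2.congr' ?_
  filter_upwards [hw, hψ] with i hi hi'
  rw [← integral_add (integrable_mul_of_inLp hpq hi.1 (hi'.sub hψ₀))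
    (integrable_mul_of_inLp hpq hi.1 hψ₀)]
  refine integral_congr_ae (ae_of_all _ fun x => ?_)
  simp only [Pi.sub_apply]
  ring

end Existence

/-! ### Polar coordinates adapted to the fractional kernel -/

section Polar

/-- Directions together with a rescaled radius. -/
abbrev Y (n : ℕ) : Type := sphere (0 : E n) 1 × ℝ

/-- Surface measure times Lebesgue measure on the half line. -/
def yMeas (n : ℕ) : Measure (Y n) :=
  (volume : Measure (E n)).toSphere.prod (volume.restrict (Set.Ioi 0))

/-- The reference measure on `ℝⁿ × S^{n-1} × (0,∞)`. -/
def zMeas (n : ℕ) : Measure (E n × Y n) := (volume : Measure (E n)).prod (yMeas n)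

instance (n : ℕ) : SigmaFinite (yMeas n) := by unfold yMeas; infer_instance

/-- The radius `t^(1/α)`. -/
def rad {n : ℕ} (α : ℝ) (y : Y n) : ℝ := y.2 ^ α⁻¹

/-- The point `t^(1/α) ω`. -/
def hvec {n : ℕ} (α : ℝ) (y : Y n) : E n := rad α y • (y.1 : E n)

/-- The difference quotient of `u` in the direction `ω` with step `t^(1/α)`. -/
def dq {n : ℕ} (α : ℝ) (u : E n → ℝ) (z : E n × Y n) : ℝ :=
  (u z.1 - u (z.1 - hvec α z.2)) / rad α z.2

variable {n : ℕ} {α : ℝ}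

@[fun_prop] lemma measurable_rad : Measurable (rad α : Y n → ℝ) := by
  unfold rad
  fun_prop

@[fun_prop] lemma measurable_hvec : Measurable (hvec α : Y n → E n) := by
  unfold hvec
  fun_prop

lemma rad_pos {y : Y n} (hy : 0 < y.2) : 0 < rad α y := Real.rpow_pos_of_pos hy _

lemma norm_hvec {y : Y n} (hy : 0 < y.2) : ‖hvec α y‖ = rad α y := by
  have h1 : ‖(y.1 : E n)‖ = 1 := mem_sphere_zero_iff_norm.1 y.1.2
  rw [hvec, norm_smul, h1, mul_one, Real.norm_of_nonneg (rad_pos hy).le]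

lemma ae_yMeas_pos : ∀ᵐ y ∂(yMeas n), 0 < y.2 := by
  unfold yMeas
  exact Measure.quasiMeasurePreserving_snd.ae (ae_restrict_mem measurableSet_Ioi)

lemma ae_zMeas_pos : ∀ᵐ z ∂(zMeas n), 0 < z.2.2 := by
  unfold zMeas
  exact Measure.quasiMeasurePreserving_snd.ae ae_yMeas_pos

/-- The substitution `t = r^α`. Its Jacobian carries the factor `α`, which accounts for the
vanishing factor `1 - s` in the energy. -/
lemma lintegral_rad (hα : 0 < α) (g : ℝ → ENNReal) :
    ∫⁻ t in Set.Ioi (0:ℝ), g (t ^ α⁻¹) =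
      ∫⁻ r in Set.Ioi (0:ℝ), ENNReal.ofReal (α * r ^ (α - 1)) * g r := by
  have himg : (fun r : ℝ => r ^ α) '' Set.Ioi 0 = Set.Ioi 0 := by
    ext t
    constructor
    · rintro ⟨r, hr, rfl⟩
      exact Real.rpow_pos_of_pos hr _
    · intro ht
      exact ⟨t ^ α⁻¹, Real.rpow_pos_of_pos ht _, Real.rpow_inv_rpow (le_of_lt ht) hα.ne'⟩
  have hinj : Set.InjOn (fun r : ℝ => r ^ α) (Set.Ioi 0) := by
    intro a ha b hb hab
    exact (Real.rpow_left_inj (le_of_lt ha) (le_of_lt hb) hα.ne').1 hab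
  have h := lintegral_image_eq_lintegral_abs_deriv_mul measurableSet_Ioi
    (fun x hx => (Real.hasDerivAt_rpow_const (p := α)
      (Or.inl (ne_of_gt hx))).hasDerivWithinAt) hinj (fun t => g (t ^ α⁻¹))
  rw [himg] at h
  rw [h]
  refine setLIntegral_congr_fun measurableSet_Ioi fun r hr => ?_
  have hr0 : (0:ℝ) < r := hr
  rw [Real.rpow_rpow_inv hr0.le hα.ne', abs_of_nonneg (by positivity)]

set_option linter.unusedSectionVars false

variable [NeZero n]

instance : Nontrivial (E n) := by
  have : Nonempty (Fin n) := ⟨0⟩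
  infer_instance

lemma lintegral_polar {G : E n → ENNReal} (hG : Measurable G) :
    ∫⁻ h, G h = ∫⁻ θ : sphere (0 : E n) 1, (∫⁻ r in Set.Ioi (0:ℝ),
      ENNReal.ofReal (r ^ (n - 1)) * G (r • (θ : E n))) ∂(volume : Measure (E n)).toSphere := by
  have hd : Module.finrank ℝ (E n) = n := by simp
  have mp := (volume : Measure (E n)).measurePreserving_homeomorphUnitSphereProd
  rw [hd] at mp
  have h1 : ∫⁻ h, G h = ∫⁻ x : ({0}ᶜ : Set (E n)), G x ∂((volume : Measure (E n)).comap (↑)) := by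
    rw [lintegral_subtype_comap (measurableSet_singleton _).compl, restrict_compl_singleton]
  have h2 := mp.lintegral_comp_emb (Homeomorph.measurableEmbedding _)
    (fun w : sphere (0 : E n) 1 × Set.Ioi (0:ℝ) => G ((w.2 : ℝ) • (w.1 : E n)))
  have h3 : ∀ x : ({0}ᶜ : Set (E n)), ((homeomorphUnitSphereProd (E n) x).2 : ℝ) •
      ((homeomorphUnitSphereProd (E n) x).1 : E n) = x := fun x => by
    have h0 : ‖(x : E n)‖ ≠ 0 := norm_ne_zero_iff.2 x.2
    simp [smul_smul, h0]
  simp only [h3] at h2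
  rw [h1, h2, lintegral_prod _ (by fun_prop)]
  refine lintegral_congr fun θ => ?_
  rw [Measure.volumeIoiPow, lintegral_withDensity_eq_lintegral_mul _ (by fun_prop) (by fun_prop)]
  exact lintegral_subtype_comap measurableSet_Ioi
    (fun r : ℝ => ENNReal.ofReal (r ^ (n - 1)) * G (r • (θ : E n)))

/-- Since `r^(α-1) = r^(α-n) r^(n-1)`, one factor is the density and the other is the polar
Jacobian. This is what moves all dependence on `s` from the measure into the integrand. -/
lemma map_hvec (hα : 0 < α) : (yMeas n).map (hvec α) =
    (volume : Measure (E n)).withDensity (fun h => ENNReal.ofReal (α * ‖h‖ ^ (α - n))) := by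
  refine Measure.ext_of_lintegral _ fun g hg => ?_
  rw [lintegral_map hg measurable_hvec,
    lintegral_withDensity_eq_lintegral_mul _ (by fun_prop) hg, lintegral_polar (by fun_prop),
    yMeas, lintegral_prod _ (by fun_prop)]
  refine lintegral_congr fun θ => ?_
  have h := lintegral_rad hα (fun r => g (r • (θ : E n)))
  simp only [hvec, rad]
  rw [h]
  refine setLIntegral_congr_fun measurableSet_Ioi fun r hr => ?_
  have hr0 : (0:ℝ) < r := hr
  have hθ : ‖(θ : E n)‖ = 1 := mem_sphere_zero_iff_norm.1 θ.2
  simp only [Pi.mul_apply]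
  rw [← mul_assoc, ← ENNReal.ofReal_mul (by positivity), norm_smul, hθ, mul_one,
    Real.norm_of_nonneg hr0.le, ← Real.rpow_natCast, Nat.cast_sub (NeZero.one_le), Nat.cast_one,
    mul_left_comm, ← Real.rpow_add hr0]
  congr 4
  ring

/-- The change of variables `(x, y) ↦ (x, h)`. -/
def shiftMap (n : ℕ) (α : ℝ) : E n × Y n → E n × E n := Prod.map id (hvec α)

@[fun_prop] lemma measurable_shiftMap : Measurable (shiftMap n α) :=
  measurable_id.prodMap measurable_hvec

lemma map_shiftMap (hα : 0 < α) : (zMeas n).map (shiftMap n α) =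
    (volume : Measure (E n × E n)).withDensity
      (fun z => ENNReal.ofReal (α * ‖z.2‖ ^ (α - n))) := by
  have h1 : Measurable fun h : E n => ENNReal.ofReal (α * ‖h‖ ^ (α - n)) := by fun_prop
  rw [zMeas, shiftMap, ← Measure.map_prod_map _ _ measurable_id measurable_hvec, Measure.map_id,
    map_hvec hα, prod_withDensity_right h1]
  rfl

/-- The image measure has a density, hence is absolutely continuous. This transports almost
everywhere statements in `(x, h)`, such as the bounds on `m`, to the new variables for every `α`. -/
lemma quasiMeasurePreserving_shiftMap (hα : 0 < α) :
    Measure.QuasiMeasurePreserving (shiftMap n α) (zMeas n) volume :=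
  ⟨measurable_shiftMap, by
    rw [map_shiftMap hα]
    exact withDensity_absolutelyContinuous _ _⟩

lemma quasiMeasurePreserving_shift (hα : 0 < α) :
    Measure.QuasiMeasurePreserving (fun z : E n × Y n => z.1 - hvec α z.2) (zMeas n) volume :=
  (quasiMeasurePreserving_sub volume volume).comp (quasiMeasurePreserving_shiftMap hα)

lemma quasiMeasurePreserving_fst_zMeas :
    Measure.QuasiMeasurePreserving (fun z : E n × Y n => z.1) (zMeas n) volume :=
  Measure.quasiMeasurePreserving_fst

lemma aestronglyMeasurable_dq (hα : 0 < α) {u : E n → ℝ} (hu : AEStronglyMeasurable u volume) :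
    AEStronglyMeasurable (dq α u) (zMeas n) := by
  have h1 := hu.comp_quasiMeasurePreserving quasiMeasurePreserving_fst_zMeas
  have h2 := hu.comp_quasiMeasurePreserving (quasiMeasurePreserving_shift hα)
  have h3 : AEStronglyMeasurable (fun z : E n × Y n => rad α z.2) (zMeas n) := by
    exact (measurable_rad.comp measurable_snd).aestronglyMeasurable
  exact (h1.sub h2).div₀ h3

lemma dq_add (u v : E n → ℝ) : dq α (u + v) = dq α u + dq α v := by
  funext z
  simp only [dq, Pi.add_apply]
  ring

lemma dq_smul (c : ℝ) (u : E n → ℝ) : dq α (c • u) = c • dq α u := by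
  funext z
  simp only [dq, Pi.smul_apply, smul_eq_mul]
  ring

lemma dq_sub (u v : E n → ℝ) : dq α (u - v) = dq α u - dq α v := by
  funext z
  simp only [dq, Pi.sub_apply]
  ring

lemma aestronglyMeasurable_sub_shift {u : E n → ℝ} (hu : AEStronglyMeasurable u volume) :
    AEStronglyMeasurable (fun z : E n × E n => u z.1 - u (z.1 - z.2)) volume :=
  (hu.comp_quasiMeasurePreserving Measure.quasiMeasurePreserving_fst).sub
    (hu.comp_quasiMeasurePreserving (quasiMeasurePreserving_sub volume volume))

lemma ae_snd_ne_zero : ∀ᵐ z : E n × E n, z.2 ≠ 0 :=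
  Measure.quasiMeasurePreserving_snd.ae (Measure.ae_ne volume 0)

/-- For `α = p(1-s)` the exponents satisfy `(α - n) - p = -(n + sp)`. -/
lemma kernel_identity {s p : ℝ} {h : E n} (hh : h ≠ 0) :
    p * (1 - s) * ‖h‖ ^ (p * (1 - s) - n) * (‖h‖ ^ p)⁻¹
      = p * ((1 - s) * (‖h‖ ^ ((n : ℝ) + s * p))⁻¹) := by
  have h0 : 0 < ‖h‖ := norm_pos_iff.2 hh
  rw [← Real.rpow_neg h0.le, ← Real.rpow_neg h0.le, mul_assoc (p * (1 - s)), ← Real.rpow_add h0]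
  rw [show p * (1 - s) - n + -p = -((n:ℝ) + s * p) by ring]
  ring

lemma lintegral_dq {s p : ℝ} (hp : 1 < p) (hs : s < 1) {u : E n → ℝ}
    (hu : AEStronglyMeasurable u volume) :
    ∫⁻ z, ENNReal.ofReal (‖dq (p * (1 - s)) u z‖ ^ p) ∂(zMeas n)
      = ENNReal.ofReal (p * (1 - s)) * gagliardo s p u := by
  have hα : 0 < p * (1 - s) := mul_pos (by linarith) (by linarith)
  have hD := aestronglyMeasurable_sub_shift hu
  have hF : AEMeasurable (fun z : E n × E n =>
      ENNReal.ofReal (|u z.1 - u (z.1 - z.2)| ^ p / ‖z.2‖ ^ p)) volume := by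
    refine (AEMeasurable.div ?_ ?_).ennreal_ofReal
    · exact (hD.aemeasurable.abs).pow_const p
    · exact Measurable.aemeasurable (by fun_prop)
  have hw : Measurable fun z : E n × E n =>
      ENNReal.ofReal (p * (1 - s) * ‖z.2‖ ^ (p * (1 - s) - n)) := by fun_prop
  have h1 : ∫⁻ z, ENNReal.ofReal (‖dq (p * (1 - s)) u z‖ ^ p) ∂(zMeas n)
      = ∫⁻ z, ENNReal.ofReal (|u z.1 - u (z.1 - z.2)| ^ p / ‖z.2‖ ^ p)
        ∂((zMeas n).map (shiftMap n (p * (1 - s)))) := by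
    rw [lintegral_map' _ measurable_shiftMap.aemeasurable]
    · refine lintegral_congr_ae ?_
      filter_upwards [ae_zMeas_pos] with z hz
      have hr := rad_pos (α := p * (1 - s)) hz
      simp only [shiftMap, Prod.map, id, norm_hvec hz, dq]
      rw [Real.norm_eq_abs, abs_div, abs_of_pos hr, Real.div_rpow (abs_nonneg _) hr.le]
    · rw [map_shiftMap hα]
      exact hF.mono_ac (withDensity_absolutelyContinuous _ _)
  rw [h1, map_shiftMap hα, lintegral_withDensity_eq_lintegral_mul₀ hw.aemeasurable hF, gagliardo,
    ← lintegral_const_mul' _ _ ENNReal.ofReal_ne_top]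
  refine lintegral_congr_ae ?_
  filter_upwards [ae_snd_ne_zero] with z hz
  have h0 : 0 < ‖z.2‖ := norm_pos_iff.2 hz
  simp only [Pi.mul_apply]
  rw [← ENNReal.ofReal_mul (by positivity), ← ENNReal.ofReal_mul hα.le]
  congr 1
  have := kernel_identity (s := s) (p := p) hz
  rw [div_eq_mul_inv, div_eq_mul_inv]
  calc _ = |u z.1 - u (z.1 - z.2)| ^ p *
        (p * (1 - s) * ‖z.2‖ ^ (p * (1 - s) - n) * (‖z.2‖ ^ p)⁻¹) := by ring
    _ = _ := by
      rw [this]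
      ring

lemma gagliardo_lt_top_iff {s p : ℝ} (hp : 1 < p) (hs : s < 1) {u : E n → ℝ}
    (hu : AEStronglyMeasurable u volume) :
    gagliardo s p u < ⊤ ↔ InLp p (zMeas n) (dq (p * (1 - s)) u) := by
  have hα : 0 < p * (1 - s) := mul_pos (by linarith) (by linarith)
  have hm := aestronglyMeasurable_dq hα hu
  have h := lintegral_dq hp hs hu
  rw [InLp, ← integrable_norm_rpow_iff hm (ofReal_ne_zero hp) ENNReal.ofReal_ne_top,
    ENNReal.toReal_ofReal (by linarith), lt_top_iff_ne_top]
  have hne : ENNReal.ofReal (p * (1 - s)) ≠ 0 := by simpa using hα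
  have h2 : gagliardo s p u ≠ ⊤ ↔ ENNReal.ofReal (p * (1 - s)) * gagliardo s p u ≠ ⊤ := by
    constructor
    · exact fun h => ENNReal.mul_ne_top ENNReal.ofReal_ne_top h
    · intro h h'
      rw [h', ENNReal.mul_top hne] at h
      exact h rfl
  rw [h2, ← h, ← hasFiniteIntegral_iff_ofReal (ae_of_all _ fun z => by positivity)
    |>.trans lt_top_iff_ne_top]
  refine ⟨fun h => ⟨?_, h⟩, fun h => h.2⟩
  exact (hm.norm.aemeasurable.pow_const p).aestronglyMeasurable

/-- The coefficient in the new variables. -/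
def coef {n : ℕ} (m : E n → E n → ℝ) (α : ℝ) (z : E n × Y n) : ℝ := m z.1 (hvec α z.2)

lemma measurable_coef {m : E n → E n → ℝ} (hm : Measurable (Function.uncurry m)) :
    Measurable (coef m α) :=
  hm.comp measurable_shiftMap

/-- The image density carries `α = p(1-s)` where the form has only `1 - s`. The resulting factor `p`
is the one in front of `f` in the local equation. -/
lemma nonlocalForm_eq {s p : ℝ} (hp : 1 < p) (hs : s < 1) {m : E n → E n → ℝ}
    (hm : Measurable (Function.uncurry m)) {u v : E n → ℝ}
    (hu : AEStronglyMeasurable u volume) (hv : AEStronglyMeasurable v volume) :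
    p * nonlocalForm s p m u v = ∫ z, coef m (p * (1 - s)) z *
      (dpow p (dq (p * (1 - s)) u z) * dq (p * (1 - s)) v z) ∂(zMeas n) := by
  have hα : 0 < p * (1 - s) := mul_pos (by linarith) (by linarith)
  have hF : AEStronglyMeasurable (fun z : E n × E n => m z.1 z.2 *
      (dpow p (u z.1 - u (z.1 - z.2)) * (v z.1 - v (z.1 - z.2)) / ‖z.2‖ ^ p)) volume := by
    refine hm.aestronglyMeasurable.mul (AEStronglyMeasurable.div₀ (AEStronglyMeasurable.mul
      ?_ (aestronglyMeasurable_sub_shift hv)) ?_)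
    · exact (continuous_dpow hp).comp_aestronglyMeasurable (aestronglyMeasurable_sub_shift hu)
    · exact Measurable.aestronglyMeasurable (by fun_prop)
  have hw : Measurable fun z : E n × E n =>
      Real.toNNReal (p * (1 - s) * ‖z.2‖ ^ (p * (1 - s) - n)) := by fun_prop
  have h1 : ∫ z, coef m (p * (1 - s)) z *
      (dpow p (dq (p * (1 - s)) u z) * dq (p * (1 - s)) v z) ∂(zMeas n)
      = ∫ z, m z.1 z.2 * (dpow p (u z.1 - u (z.1 - z.2)) * (v z.1 - v (z.1 - z.2)) / ‖z.2‖ ^ p)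
        ∂((zMeas n).map (shiftMap n (p * (1 - s)))) := by
    rw [integral_map measurable_shiftMap.aemeasurable]
    · refine integral_congr_ae ?_
      filter_upwards [ae_zMeas_pos] with z hz
      have hr := rad_pos (α := p * (1 - s)) hz
      simp only [shiftMap, Prod.map, id, norm_hvec hz, dq, coef]
      rw [div_eq_inv_mul (u z.1 - _), dpow_mul (inv_pos.2 hr), Real.inv_rpow hr.le,
        Real.rpow_sub_one hr.ne']
      field_simp
    · rw [map_shiftMap hα]
      exact hF.mono_ac (withDensity_absolutelyContinuous _ _)
  rw [h1, map_shiftMap hα]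
  have h2 := integral_withDensity_eq_integral_smul (μ := (volume : Measure (E n × E n))) hw
    (fun z => m z.1 z.2 *
      (dpow p (u z.1 - u (z.1 - z.2)) * (v z.1 - v (z.1 - z.2)) / ‖z.2‖ ^ p))
  refine Eq.trans ?_ h2.symm
  rw [nonlocalForm, ← integral_const_mul, ← integral_const_mul]
  refine integral_congr_ae ?_
  filter_upwards [ae_snd_ne_zero] with z hz
  have h0 : 0 < ‖z.2‖ := norm_pos_iff.2 hz
  rw [NNReal.smul_def, Real.coe_toNNReal _ (by positivity), smul_eq_mul]
  have := kernel_identity (s := s) (p := p) hz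
  simp only [dpow, div_eq_mul_inv]
  linear_combination (-(m z.1 z.2 * (|u z.1 - u (z.1 - z.2)| ^ (p - 2) *
    (u z.1 - u (z.1 - z.2)) * (v z.1 - v (z.1 - z.2))))) * this

end Polar

/-! ### The Poincaré inequality and the nonlocal problem -/

section Nonlocal

set_option linter.unusedSectionVars false

variable {n : ℕ} {α p q : ℝ}

/-! ### Translation differences of functions supported in a ball. -/

section Translation

variable {F : Type*} [NormedAddCommGroup F]

lemma measurePreserving_sub (h : E n) : MeasurePreserving (fun x : E n => x - h) volume volume :=
  measurePreserving_sub_right volume h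

lemma inLp_translate {u : E n → F} (hu : InLp p volume u) (h : E n) :
    InLp p volume (fun x => u (x - h)) :=
  hu.comp_measurePreserving (measurePreserving_sub h)

lemma nrm_translate {u : E n → F} (hu : AEStronglyMeasurable u volume) (h : E n) :
    nrm p volume (fun x => u (x - h)) = nrm p volume u := by
  have := eLpNorm_comp_measurePreserving (p := ENNReal.ofReal p) hu (measurePreserving_sub h)
  rw [nrm, nrm, ← this]
  rfl

/-- Telescoping over `k` equal steps; each step contributes the same norm by translation invariance.
-/
lemma nrm_sub_translate_nsmul_le (hp : 1 < p) {u : E n → F} (hu : InLp p volume u) (h : E n)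
    (k : ℕ) : nrm p volume (u - fun x => u (x - (k : ℝ) • h))
      ≤ k * nrm p volume (u - fun x => u (x - h)) := by
  induction k with
  | zero => simp [nrm]
  | succ k ih =>
    have h1 : (u - fun x => u (x - ((k + 1 : ℕ) : ℝ) • h)) =
        (u - fun x => u (x - (k : ℝ) • h)) +
          fun x => (u - fun x => u (x - h)) (x - (k : ℝ) • h) := by
      funext x
      have : x - ((k + 1 : ℕ) : ℝ) • h = x - (k : ℝ) • h - h := by
        push_cast
        rw [add_smul, one_smul]
        abel
      simp only [Pi.sub_apply, Pi.add_apply, this]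
      abel
    have i1 : InLp p volume (u - fun x => u (x - (k : ℝ) • h)) := hu.sub (inLp_translate hu _)
    have i2 : InLp p volume (u - fun x => u (x - h)) := hu.sub (inLp_translate hu _)
    rw [h1]
    refine (nrm_add_le hp i1 (inLp_translate i2 _)).trans ?_
    rw [nrm_translate i2.1]
    push_cast
    linarith

/-- A shift by at least the diameter of the ball moves its support off itself, so on `Ω` the
difference equals `u`. -/
lemma nrm_le_sub_translate {u : E n → F} (hu : InLp p volume u) {R : ℝ} {Ω : Set (E n)}
    (hΩ : Ω ⊆ ball 0 R) (h0 : ∀ᵐ x : E n, x ∉ Ω → u x = 0) {h : E n} (hh : 2 * R ≤ ‖h‖) :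
    nrm p volume u ≤ nrm p volume (u - fun x => u (x - h)) := by
  have h1 := (measurePreserving_sub h).quasiMeasurePreserving.ae h0
  have := nrm_le_mul (μ := volume) (p := p) (f := u) (hu.sub (inLp_translate hu h)) zero_le_one (by
    filter_upwards [h0, h1] with x hx hx1
    by_cases hxΩ : x ∈ Ω
    · have h2 : x - h ∉ Ω := fun h3 => by
        have a1 := mem_ball_zero_iff.1 (hΩ hxΩ)
        have a2 := mem_ball_zero_iff.1 (hΩ h3)
        have a3 : ‖h‖ ≤ ‖x‖ + ‖x - h‖ := by
          calc ‖h‖ = ‖x - (x - h)‖ := by rw [sub_sub_cancel]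
            _ ≤ _ := norm_sub_le _ _
        linarith
      simp [hx1 h2]
    · simp [hx hxΩ])
  simpa using this

/-- A lower bound for translation differences of functions supported in a ball. -/
lemma norm_mul_nrm_le (hp : 1 < p) {u : E n → F} (hu : InLp p volume u) {R : ℝ} (hR : 0 ≤ R)
    {Ω : Set (E n)} (hΩ : Ω ⊆ ball 0 R) (h0 : ∀ᵐ x : E n, x ∉ Ω → u x = 0) {h : E n}
    (hh : h ≠ 0) (h1 : ‖h‖ ≤ 1) :
    ‖h‖ * nrm p volume u ≤ (2 * R + 1) * nrm p volume (u - fun x => u (x - h)) := by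
  have hpos : 0 < ‖h‖ := norm_pos_iff.2 hh
  -- The least number of steps `h` that covers the distance `2R`. As `‖h‖ ≤ 1`, rounding up costs at
  -- most one: `k ‖h‖ ≤ 2R + 1`.
  set k := ⌈2 * R / ‖h‖⌉₊ with hk
  have hk1 : 2 * R / ‖h‖ ≤ k := Nat.le_ceil _
  have hk2 : (k : ℝ) < 2 * R / ‖h‖ + 1 := Nat.ceil_lt_add_one (by positivity)
  have h2 : 2 * R ≤ ‖(k : ℝ) • h‖ := by
    rw [norm_smul, Real.norm_of_nonneg (Nat.cast_nonneg k)]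
    rwa [div_le_iff₀ hpos] at hk1
  have h3 := (nrm_le_sub_translate hu hΩ h0 h2).trans (nrm_sub_translate_nsmul_le hp hu h k)
  have h4 : ‖h‖ * k ≤ 2 * R + 1 := by
    have : ‖h‖ * k ≤ ‖h‖ * (2 * R / ‖h‖ + 1) := by gcongr
    rw [mul_add, mul_div_cancel₀ _ hpos.ne'] at this
    linarith
  calc ‖h‖ * nrm p volume u ≤ ‖h‖ * (k * nrm p volume (u - fun x => u (x - h))) := by gcongr
    _ = ‖h‖ * k * nrm p volume (u - fun x => u (x - h)) := by ring
    _ ≤ _ := mul_le_mul_of_nonneg_right h4 nrm_nonneg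

end Translation

/-- The part of `Y` where the radius is less than one. -/
def unitY (n : ℕ) : Set (Y n) := Set.univ ×ˢ Set.Ioo (0:ℝ) 1

lemma measurableSet_unitY : MeasurableSet (unitY n) := MeasurableSet.univ.prod measurableSet_Ioo

lemma yMeas_unitY : yMeas n (unitY n) = (volume : Measure (E n)).toSphere Set.univ := by
  rw [yMeas, unitY, Measure.prod_prod, Measure.restrict_apply measurableSet_Ioo,
    Set.inter_eq_left.2 (fun x hx => hx.1), Real.volume_Ioo]
  simp

lemma yMeas_unitY_ne_top : yMeas n (unitY n) ≠ ⊤ := by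
  rw [yMeas_unitY]
  exact measure_ne_top _ _

lemma rad_le_one (hα : 0 < α) {y : Y n} (hy : y ∈ unitY n) : rad α y ≤ 1 :=
  Real.rpow_le_one hy.2.1.le hy.2.2.le (by positivity)

variable [NeZero n]

lemma yMeas_unitY_pos : 0 < (yMeas n).real (unitY n) := by
  rw [Measure.real, ENNReal.toReal_pos_iff]
  refine ⟨?_, yMeas_unitY_ne_top.lt_top⟩
  rw [yMeas_unitY]
  exact Measure.measure_univ_pos.2 (Measure.toSphere_ne_zero _)

/-- The Poincaré inequality, uniform in the fractional order. -/
theorem exists_poincare (hp : 1 < p) {Ω : Set (E n)} (hΩ : Bornology.IsBounded Ω) :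
    ∃ C : ℝ, 0 ≤ C ∧ ∀ α : ℝ, 0 < α → ∀ u : E n → ℝ, InLp p volume u →
      (∀ᵐ x : E n, x ∉ Ω → u x = 0) → InLp p (zMeas n) (dq α u) →
      nrm p volume u ≤ C * nrm p (zMeas n) (dq α u) := by
  have hp0 : 0 < p := by linarith
  obtain ⟨R, hR0, hR⟩ : ∃ R : ℝ, 0 ≤ R ∧ Ω ⊆ ball 0 R := by
    obtain ⟨R, hR⟩ := hΩ.subset_ball 0
    exact ⟨max R 0, le_max_right _ _, hR.trans (ball_subset_ball (le_max_left _ _))⟩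
  set κ := (yMeas n).real (unitY n) with hκ
  have hκ0 : 0 < κ := yMeas_unitY_pos
  refine ⟨(2 * R + 1) * (1 / κ) ^ (1 / p), by positivity, fun α hα u hu h0 hd => ?_⟩
  set A := nrm p volume u with hA
  have hA0 : 0 ≤ A := nrm_nonneg
  have hi := InLp.integrable_rpow hp hd
  -- Only `t < 1` is used. There the radius is at most one whatever `α` is, and each slice of the
  -- quotient has norm at least `A / (2R + 1)`; hence the constant does not depend on `α`.
  have key : κ * (A / (2 * R + 1)) ^ p ≤ nrm p (zMeas n) (dq α u) ^ p := by
    rw [nrm_rpow hp hd]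
    rw [zMeas] at hi ⊢
    rw [integral_prod_symm _ hi]
    have h1 : κ * (A / (2 * R + 1)) ^ p
        = ∫ y, (unitY n).indicator (fun _ => (A / (2 * R + 1)) ^ p) y ∂(yMeas n) := by
      rw [integral_indicator measurableSet_unitY, setIntegral_const, smul_eq_mul]
    rw [h1]
    have hint : Integrable ((unitY n).indicator (fun _ => (A / (2 * R + 1)) ^ p)) (yMeas n) :=
      (integrable_indicator_iff measurableSet_unitY).2
        (integrableOn_const (hs := yMeas_unitY_ne_top))
    refine integral_mono_ae hint hi.integral_prod_right (ae_of_all _ fun y => ?_)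
    by_cases hy : y ∈ unitY n
    · rw [Set.indicator_of_mem hy]
      have hr := rad_pos (α := α) hy.2.1
      have hn := norm_hvec (α := α) hy.2.1
      have hne : hvec α y ≠ 0 := norm_pos_iff.1 (by rw [hn]; exact hr)
      have h2 := norm_mul_nrm_le hp hu hR0 hR h0 hne (by rw [hn]; exact rad_le_one hα hy)
      have iD : InLp p volume (u - fun x => u (x - hvec α y)) := hu.sub (inLp_translate hu _)
      have h3 : ∫ x, ‖dq α u (x, y)‖ ^ p
          = (nrm p volume (u - fun x => u (x - hvec α y)) / rad α y) ^ p := by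
        rw [Real.div_rpow nrm_nonneg hr.le, nrm_rpow hp iD, ← integral_div]
        refine integral_congr_ae (ae_of_all _ fun x => ?_)
        simp only [dq, Pi.sub_apply, Real.norm_eq_abs]
        rw [abs_div, abs_of_pos hr, Real.div_rpow (abs_nonneg _) hr.le]
      refine le_of_le_of_eq ?_ h3.symm
      refine Real.rpow_le_rpow (by positivity) ?_ hp0.le
      rw [div_le_div_iff₀ (by positivity) hr]
      rw [hn] at h2
      linarith
    · rw [Set.indicator_of_notMem hy]
      exact integral_nonneg fun x => by positivity
  have h2 := Real.rpow_le_rpow (by positivity) key (by positivity : 0 ≤ 1 / p)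
  rw [← Real.rpow_mul nrm_nonneg, mul_one_div_cancel hp0.ne', Real.rpow_one,
    Real.mul_rpow hκ0.le (by positivity), ← Real.rpow_mul (by positivity),
    mul_one_div_cancel hp0.ne', Real.rpow_one] at h2
  have h3 : 0 < κ ^ (1 / p) := by positivity
  rw [Real.div_rpow zero_le_one hκ0.le, Real.one_rpow]
  rw [mul_one_div, div_mul_eq_mul_div, le_div_iff₀ h3]
  rw [mul_div_assoc', div_le_iff₀ (by positivity)] at h2
  linarith

/-- `W^{s,p}_0(Ω)` in terms of difference quotients. -/
lemma mem_fracSobolev₀_iff {s : ℝ} (hp : 1 < p) (hs : s < 1) {Ω : Set (E n)} {u : E n → ℝ} :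
    u ∈ fracSobolev₀ s p Ω ↔ InLp p volume u ∧ InLp p (zMeas n) (dq (p * (1 - s)) u) ∧
      ∀ᵐ x : E n, x ∉ Ω → u x = 0 := by
  constructor
  · rintro ⟨h1, h2, h3⟩
    exact ⟨h1, (gagliardo_lt_top_iff hp hs h1.1).1 h2, h3⟩
  · rintro ⟨h1, h2, h3⟩
    exact ⟨h1, (gagliardo_lt_top_iff hp hs h1.1).2 h2, h3⟩

/-- Functions of `L^p` with `p`-integrable difference quotients that vanish outside `Ω`. -/
def dqSubmodule (α p : ℝ) (Ω : Set (E n)) : Submodule ℝ (E n → ℝ) where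
  carrier := {u | InLp p volume u ∧ InLp p (zMeas n) (dq α u) ∧ ∀ᵐ x : E n, x ∉ Ω → u x = 0}
  add_mem' := by
    rintro u v ⟨h1, h2, h3⟩ ⟨h4, h5, h6⟩
    refine ⟨h1.add h4, by rw [dq_add]; exact h2.add h5, ?_⟩
    filter_upwards [h3, h6] with x hx hx' hxΩ
    simp [hx hxΩ, hx' hxΩ]
  zero_mem' := by
    refine ⟨MemLp.zero, ?_, by simp⟩
    have : dq α (0 : E n → ℝ) = 0 := by
      funext z
      simp [dq]
    rw [this]
    exact MemLp.zero
  smul_mem' := by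
    rintro c u ⟨h1, h2, h3⟩
    refine ⟨h1.const_smul c, by rw [dq_smul]; exact h2.const_smul c, ?_⟩
    filter_upwards [h3] with x hx hxΩ
    simp [hx hxΩ]

/-- The difference quotient as a linear map. -/
def dqLinear (α p : ℝ) (Ω : Set (E n)) : dqSubmodule α p Ω →ₗ[ℝ] (E n × Y n → ℝ) where
  toFun u := dq α u.1
  map_add' u v := dq_add u.1 v.1
  map_smul' c u := dq_smul c u.1

lemma exists_subseq_tendsto_ae {Z : Type*} [MeasurableSpace Z] {μ : Measure Z} (hp : 1 < p)
    {f : ℕ → Z → ℝ} {g : Z → ℝ} (hf : ∀ j, InLp p μ (f j)) (hg : InLp p μ g)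
    (h : Tendsto (fun j => nrm p μ (f j - g)) atTop (𝓝 0)) :
    ∃ ns : ℕ → ℕ, StrictMono ns ∧ ∀ᵐ x ∂μ, Tendsto (fun i => f (ns i) x) atTop (𝓝 (g x)) := by
  have h1 := (tendsto_eLpNorm_iff_nrm (p := p) (f := fun j => f j - g)
    (Eventually.of_forall fun j => (hf j).sub hg)).2 h
  exact (tendstoInMeasure_of_tendsto_eLpNorm (ofReal_ne_zero hp) (fun j => (hf j).1) hg.1
    h1).exists_seq_tendsto_ae

/-- The Poincaré inequality makes the functions themselves Cauchy once their quotients converge.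
Subsequences converging almost everywhere then identify the limit of the quotients and preserve
vanishing outside `Ω`. -/
lemma dqLinear_closed (hp : 1 < p) (hα : 0 < α) {Ω : Set (E n)} (hΩ : Bornology.IsBounded Ω)
    (v : ℕ → dqSubmodule α p Ω) (g : E n × Y n → ℝ) (hg : InLp p (zMeas n) g)
    (h : Tendsto (fun j => nrm p (zMeas n) (dqLinear α p Ω (v j) - g)) atTop (𝓝 0)) :
    ∃ u, dqLinear α p Ω u =ᵐ[zMeas n] g := by
  obtain ⟨C, hC0, hC⟩ := exists_poincare hp hΩ
  have hcauchy : ∀ ε > 0, ∃ N, ∀ i ≥ N, ∀ j ≥ N,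
      nrm p volume ((v i).1 - (v j).1) < ε := by
    intro ε hε
    obtain ⟨N, hN⟩ := eventually_atTop.1
      (h.eventually (gt_mem_nhds (by positivity : (0:ℝ) < ε / (2 * (C + 1)))))
    refine ⟨N, fun i hi j hj => ?_⟩
    have hm := (v i - v j).2
    have h1 := hC α hα _ hm.1 hm.2.2 hm.2.1
    have h2 : dq α (v i - v j).1 =
        (dqLinear α p Ω (v i) - g) - (dqLinear α p Ω (v j) - g) := by
      rw [sub_sub_sub_cancel_right]
      exact dq_sub _ _
    rw [h2] at h1
    have h3 := nrm_sub_le hp ((v i).2.2.1.sub hg) ((v j).2.2.1.sub hg)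
    have h4 : nrm p (zMeas n) ((dqLinear α p Ω (v i) - g) - (dqLinear α p Ω (v j) - g))
        ≤ ε / (C + 1) := by
      refine h3.trans ?_
      have := hN i hi
      have := hN j hj
      have e : ε / (C + 1) = ε / (2 * (C + 1)) + ε / (2 * (C + 1)) := by field_simp; ring
      rw [e]
      exact add_le_add (hN i hi).le (hN j hj).le
    calc _ ≤ C * (ε / (C + 1)) := h1.trans (by gcongr)
      _ < ε := by
        rw [mul_div_assoc', div_lt_iff₀ (by positivity)]
        nlinarith
  obtain ⟨u, hu, hul⟩ := exists_limit_of_cauchy hp (fun j => (v j).2.1) hcauchy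
  obtain ⟨ns, hns, hae⟩ := exists_subseq_tendsto_ae hp (fun j => (v j).2.1) hu hul
  obtain ⟨ms, hms, hae'⟩ := exists_subseq_tendsto_ae hp (f := fun j => dq α (v (ns j)).1)
    (fun j => (v (ns j)).2.2.1) hg (h.comp hns.tendsto_atTop)
  have hdq : dq α u =ᵐ[zMeas n] g := by
    filter_upwards [hae', quasiMeasurePreserving_fst_zMeas.ae hae,
      (quasiMeasurePreserving_shift hα).ae hae] with z h1 h2 h3
    refine tendsto_nhds_unique ?_ h1
    exact ((h2.sub h3).div_const _).comp hms.tendsto_atTop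
  have h0 : ∀ᵐ x : E n, x ∉ Ω → u x = 0 := by
    have : ∀ᵐ x : E n, ∀ j, x ∉ Ω → (v j).1 x = 0 := ae_all_iff.2 fun j => (v j).2.2.2
    filter_upwards [hae, this] with x h1 h2 hx
    refine tendsto_nhds_unique h1 ?_
    simp [h2 _ hx]
  exact ⟨⟨u, hu, (memLp_congr_ae hdq).2 hg, h0⟩, hdq⟩

lemma inLp_indicator {f : E n → ℝ} {Ω : Set (E n)} (hΩ : MeasurableSet Ω)
    (hf : InLp q (volume.restrict Ω) f) : InLp q volume (Ω.indicator f) :=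
  (memLp_indicator_iff_restrict hΩ).2 hf

lemma setIntegral_mul_eq {f v : E n → ℝ} {Ω : Set (E n)} (hΩ : MeasurableSet Ω) :
    ∫ x in Ω, f x * v x = ∫ x, Ω.indicator f x * v x := by
  rw [← integral_indicator hΩ]
  refine integral_congr_ae (ae_of_all _ fun x => ?_)
  by_cases hx : x ∈ Ω <;> simp [hx]

lemma coef_bounds (hα : 0 < α) {m : E n → E n → ℝ} {mlo mhi : ℝ}
    (hH1 : ∀ᵐ z : E n × E n, mlo ≤ m z.1 z.2 ∧ m z.1 z.2 ≤ mhi) :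
    ∀ᵐ z ∂(zMeas n), mlo ≤ coef m α z ∧ coef m α z ≤ mhi :=
  (quasiMeasurePreserving_shiftMap hα).ae hH1

lemma coef_abs_le (hα : 0 < α) {m : E n → E n → ℝ} {mlo mhi : ℝ} (hmlo : 0 < mlo)
    (hH1 : ∀ᵐ z : E n × E n, mlo ≤ m z.1 z.2 ∧ m z.1 z.2 ≤ mhi) :
    ∀ᵐ z ∂(zMeas n), |coef m α z| ≤ mhi := by
  filter_upwards [coef_bounds hα hH1] with z hz
  rw [abs_of_nonneg (hmlo.le.trans hz.1)]
  exact hz.2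

lemma integrable_form {Z : Type*} [MeasurableSpace Z] {μ : Measure Z} (hpq : p.HolderConjugate q)
    {k f g : Z → ℝ} {M : ℝ} (hk : AEStronglyMeasurable k μ) (hkM : ∀ᵐ x ∂μ, |k x| ≤ M)
    (hf : InLp p μ f) (hg : InLp p μ g) :
    Integrable (fun x => k x * (dpow p (f x) * g x)) μ := by
  refine (integrable_mul_of_inLp hpq.symm ((inLp_dpow hpq hf).bdd_mul_left hk hkM) hg).congr
    (ae_of_all _ fun x => ?_)
  ring

lemma integral_form_sub {Z : Type*} [MeasurableSpace Z] {μ : Measure Z}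
    (hpq : p.HolderConjugate q)
    {k f g : Z → ℝ} {M : ℝ} (hk : AEStronglyMeasurable k μ) (hkM : ∀ᵐ x ∂μ, |k x| ≤ M)
    (hf : InLp p μ f) (hg : InLp p μ g) :
    ∫ x, k x * ((dpow p (f x) - dpow p (g x)) * (f x - g x)) ∂μ
      = ∫ x, k x * (dpow p (f x) * (f x - g x)) ∂μ
        - ∫ x, k x * (dpow p (g x) * (f x - g x)) ∂μ := by
  have i1 : Integrable (fun x => k x * (dpow p (f x) * (f x - g x))) μ :=
    integrable_form hpq hk hkM hf (hf.sub hg)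
  have i2 : Integrable (fun x => k x * (dpow p (g x) * (f x - g x))) μ :=
    integrable_form hpq hk hkM hg (hf.sub hg)
  rw [← integral_sub i1 i2]
  refine integral_congr_ae (ae_of_all _ fun x => ?_)
  ring

/-- The static case of strong monotonicity, obtained from the limit version with constant sequences.
It serves both uniqueness proofs. -/
lemma nrm_sub_eq_zero_of_form {Z : Type*} [MeasurableSpace Z] {μ : Measure Z}
    (hpq : p.HolderConjugate q)
    {k f g : Z → ℝ} {c M : ℝ} (hc : 0 < c) (hk : AEStronglyMeasurable k μ)
    (hkb : ∀ᵐ x ∂μ, c ≤ k x ∧ k x ≤ M) (hf : InLp p μ f) (hg : InLp p μ g)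
    (h : ∫ x, k x * ((dpow p (f x) - dpow p (g x)) * (f x - g x)) ∂μ = 0) :
    nrm p μ (f - g) = 0 := by
  have := tendsto_nrm_of_monotone_form hpq (l := (atTop : Filter ℕ)) (μ := μ)
    (F := fun _ => f) (G := fun _ => g) (k := fun _ => k) (B := max (nrm p μ f) (nrm p μ g)) hc
    (Eventually.of_forall fun _ => ⟨hk, hkb⟩)
    (Eventually.of_forall fun _ => ⟨hf, le_max_left _ _⟩)
    (Eventually.of_forall fun _ => ⟨hg, le_max_right _ _⟩) (by simp only [h]; exact tendsto_const_nhds)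
  exact tendsto_nhds_unique tendsto_const_nhds this

/-- The weak formulation in the new variables. -/
lemma isNonlocalSolution_iff {s : ℝ} (hp : 1 < p) (hs : s < 1) {Ω : Set (E n)}
    {m : E n → E n → ℝ} (hm : Measurable (Function.uncurry m)) {f u : E n → ℝ} :
    IsNonlocalSolution s p Ω m f u ↔ u ∈ dqSubmodule (p * (1 - s)) p Ω ∧
      ∀ v ∈ dqSubmodule (p * (1 - s)) p Ω, ∫ z, coef m (p * (1 - s)) z *
        (dpow p (dq (p * (1 - s)) u z) * dq (p * (1 - s)) v z) ∂(zMeas n)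
          = p * ∫ x in Ω, f x * v x := by
  have hmem : ∀ w : E n → ℝ, w ∈ fracSobolev₀ s p Ω ↔ w ∈ dqSubmodule (p * (1 - s)) p Ω :=
    fun w => mem_fracSobolev₀_iff hp hs
  rw [IsNonlocalSolution, hmem]
  refine and_congr_right fun hu => forall_congr' fun v => ?_
  rw [hmem]
  refine forall_congr' fun hv => ?_
  rw [← nonlocalForm_eq hp hs hm hu.1.1 hv.1.1]
  constructor
  · intro h
    rw [h]
  · intro h
    exact mul_left_cancel₀ (by linarith) h

/-- Existence for the nonlocal problem. -/
theorem exists_nonlocalSolution {s : ℝ} (hpq : p.HolderConjugate q) (hs : s < 1) {Ω : Set (E n)}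
    (hΩo : IsOpen Ω) (hΩ : Bornology.IsBounded Ω) {m : E n → E n → ℝ}
    (hm : Measurable (Function.uncurry m)) {mlo mhi : ℝ} (hmlo : 0 < mlo)
    (hH1 : ∀ᵐ z : E n × E n, mlo ≤ m z.1 z.2 ∧ m z.1 z.2 ≤ mhi) {f : E n → ℝ}
    (hf : InLp q (volume.restrict Ω) f) : ∃ u, IsNonlocalSolution s p Ω m f u := by
  have hp := hpq.lt
  have hα : 0 < p * (1 - s) := mul_pos (by linarith) (by linarith)
  obtain ⟨C, hC0, hC⟩ := exists_poincare hp hΩ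
  have hfΩ := inLp_indicator hΩo.measurableSet hf
  let ℓ : dqSubmodule (p * (1 - s)) p Ω →ₗ[ℝ] ℝ :=
    { toFun := fun v => p * ∫ x, Ω.indicator f x * v.1 x
      map_add' := fun u v => by
        rw [← mul_add, ← integral_add (integrable_mul_of_inLp hpq.symm hfΩ u.2.1)
          (integrable_mul_of_inLp hpq.symm hfΩ v.2.1)]
        congr 1
        refine integral_congr_ae (ae_of_all _ fun x => ?_)
        exact mul_add _ _ _
      map_smul' := fun c u => by
        rw [RingHom.id_apply, smul_eq_mul, mul_left_comm, ← integral_const_mul c]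
        congr 1
        refine integral_congr_ae (ae_of_all _ fun x => ?_)
        exact mul_left_comm _ _ _ }
  have hℓ : ∀ v, |ℓ v| ≤ (p * (nrm q volume (Ω.indicator f) * C)) *
      nrm p (zMeas n) (dqLinear (p * (1 - s)) p Ω v) := fun v => by
    have h1 := abs_integral_mul_le hpq.symm hfΩ v.2.1
    have h2 := hC _ hα v.1 v.2.1 v.2.2.2 v.2.2.1
    change |p * ∫ x, Ω.indicator f x * v.1 x| ≤ _
    rw [abs_mul, abs_of_pos (by linarith : 0 < p), mul_assoc, mul_assoc]
    refine mul_le_mul_of_nonneg_left (h1.trans ?_) (by linarith)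
    exact mul_le_mul_of_nonneg_left h2 nrm_nonneg
  obtain ⟨u, hu⟩ := exists_weak_solution hpq (dqLinear (p * (1 - s)) p Ω) (fun v => v.2.2.1)
    (dqLinear_closed hp hα hΩ) hmlo (measurable_coef hm).aestronglyMeasurable
    (coef_bounds hα hH1) ℓ hℓ
  refine ⟨u.1, (isNonlocalSolution_iff hp hs hm).2 ⟨u.2, fun v hv => ?_⟩⟩
  rw [setIntegral_mul_eq hΩo.measurableSet]
  exact hu ⟨v, hv⟩

/-- Uniqueness for the nonlocal problem. -/
theorem nonlocalSolution_unique {s : ℝ} (hpq : p.HolderConjugate q) (hs : s < 1) {Ω : Set (E n)}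
    (hΩ : Bornology.IsBounded Ω) {m : E n → E n → ℝ}
    (hm : Measurable (Function.uncurry m)) {mlo mhi : ℝ} (hmlo : 0 < mlo)
    (hH1 : ∀ᵐ z : E n × E n, mlo ≤ m z.1 z.2 ∧ m z.1 z.2 ≤ mhi) {f u w : E n → ℝ}
    (hu : IsNonlocalSolution s p Ω m f u) (hw : IsNonlocalSolution s p Ω m f w) :
    w =ᵐ[volume] u := by
  have hp := hpq.lt
  have hα : 0 < p * (1 - s) := mul_pos (by linarith) (by linarith)
  obtain ⟨C, hC0, hC⟩ := exists_poincare hp hΩ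
  obtain ⟨hu1, hu2⟩ := (isNonlocalSolution_iff hp hs hm).1 hu
  obtain ⟨hw1, hw2⟩ := (isNonlocalSolution_iff hp hs hm).1 hw
  have hd := Submodule.sub_mem _ hw1 hu1
  have hk := (measurable_coef (α := p * (1 - s)) hm).aestronglyMeasurable (μ := zMeas n)
  have h1 : nrm p (zMeas n) (dq (p * (1 - s)) w - dq (p * (1 - s)) u) = 0 := by
    refine nrm_sub_eq_zero_of_form hpq hmlo hk (coef_bounds hα hH1) hw1.2.1 hu1.2.1 ?_
    rw [integral_form_sub hpq hk (coef_abs_le hα hmlo hH1) hw1.2.1 hu1.2.1]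
    have e1 := hw2 _ hd
    have e2 := hu2 _ hd
    rw [dq_sub] at e1 e2
    simp only [Pi.sub_apply] at e1 e2
    rw [e1, e2, sub_self]
  have h2 := hC _ hα _ hd.1 hd.2.2 hd.2.1
  rw [dq_sub, h1, mul_zero] at h2
  have h3 := (nrm_eq_zero_iff hp hd.1).1 (le_antisymm h2 nrm_nonneg)
  filter_upwards [h3] with x hx
  exact sub_eq_zero.1 hx

end Nonlocal

/-! ### Averages of `L^p` functions and continuity of translations -/

section Averages

set_option linter.unusedSectionVars false

variable {X T : Type*} [MeasurableSpace X] [MeasurableSpace T] {μ : Measure X} {ν : Measure T}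
  [SFinite μ] {p q : ℝ} {F : Type*} [NormedAddCommGroup F] [NormedSpace ℝ F]

/-- Averaging an `L^p` function over a parameter in a finite measure space. -/
lemma inLp_average [IsFiniteMeasure ν] (hpq : p.HolderConjugate q) {H : X × T → F}
    (hH : InLp p (μ.prod ν) H) : InLp p μ (fun x => ∫ t, H (x, t) ∂ν) ∧
      nrm p μ (fun x => ∫ t, H (x, t) ∂ν) ≤ nrm q ν (fun _ => (1:ℝ)) * nrm p (μ.prod ν) H := by
  have hp := hpq.lt
  have hp0 : 0 < p := by linarith
  have hm : AEStronglyMeasurable (fun x => ∫ t, H (x, t) ∂ν) μ := hH.1.integral_prod_right'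
  have hi := InLp.integrable_rpow hp hH
  set c := nrm q ν (fun _ => (1:ℝ)) with hc
  have hc0 : 0 ≤ c := nrm_nonneg
  have hone : InLp q ν (fun _ => (1:ℝ)) := memLp_const _
  -- Hölder's inequality in `t` against the constant one.
  have hpt : ∀ᵐ x ∂μ, ‖∫ t, H (x, t) ∂ν‖ ^ p ≤ c ^ p * ∫ t, ‖H (x, t)‖ ^ p ∂ν := by
    filter_upwards [hi.prod_right_ae, hH.1.prodMk_left] with x hx hxm
    have h1 : InLp p ν (fun t => ‖H (x, t)‖) := inLp_of_integrable_rpow hp hxm.norm (by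
      simpa using hx)
    have h2 := (le_abs_self _).trans (abs_integral_mul_le hpq h1 hone)
    simp only [mul_one] at h2
    have h3 := (norm_integral_le_integral_norm (μ := ν) (fun t => H (x, t))).trans h2
    have h4 := Real.rpow_le_rpow (norm_nonneg _) h3 hp0.le
    rw [Real.mul_rpow nrm_nonneg hc0, nrm_rpow hp h1] at h4
    simp only [norm_norm] at h4
    linarith
  have hint := hi.integral_prod_left.const_mul (c ^ p)
  have hint' : Integrable (fun x => ‖∫ t, H (x, t) ∂ν‖ ^ p) μ := by
    refine hint.mono' (hm.norm.aemeasurable.pow_const p).aestronglyMeasurable ?_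
    filter_upwards [hpt] with x hx
    rwa [Real.norm_of_nonneg (by positivity)]
  have hL := inLp_of_integrable_rpow hp hm hint'
  refine ⟨hL, ?_⟩
  rw [← Real.rpow_le_rpow_iff nrm_nonneg (mul_nonneg hc0 nrm_nonneg) hp0,
    Real.mul_rpow hc0 nrm_nonneg, nrm_rpow hp hL, nrm_rpow hp hH, integral_prod _ hi,
    ← integral_const_mul]
  exact integral_mono_ae hint' hint hpt

lemma inLp_prod_of_slices [IsFiniteMeasure ν] (hp : 1 < p) {H : X × T → F}
    (hH : AEStronglyMeasurable H (μ.prod ν)) {B : ℝ}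
    (hB : ∀ᵐ t ∂ν, InLp p μ (fun x => H (x, t)) ∧ nrm p μ (fun x => H (x, t)) ≤ B) :
    InLp p (μ.prod ν) H ∧ nrm p (μ.prod ν) H ^ p ≤ ν.real Set.univ * B ^ p := by
  have hp0 : 0 < p := by linarith
  have hm : AEStronglyMeasurable (fun z => ‖H z‖ ^ p) (μ.prod ν) :=
    (hH.norm.aemeasurable.pow_const p).aestronglyMeasurable
  have hbd : ∀ᵐ t ∂ν, ∫ x, ‖H (x, t)‖ ^ p ∂μ ≤ B ^ p := by
    filter_upwards [hB] with t ht
    rw [← nrm_rpow hp ht.1]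
    exact Real.rpow_le_rpow nrm_nonneg ht.2 hp0.le
  have hi : Integrable (fun z => ‖H z‖ ^ p) (μ.prod ν) := by
    rw [integrable_prod_iff' hm]
    refine ⟨by filter_upwards [hB] with t ht using InLp.integrable_rpow hp ht.1, ?_⟩
    refine (integrable_const (B ^ p)).mono' ?_ ?_
    · exact hm.norm.prod_swap.integral_prod_right'
    · filter_upwards [hbd] with t ht
      rw [Real.norm_of_nonneg (integral_nonneg fun x => norm_nonneg _)]
      refine le_trans (le_of_eq ?_) ht
      refine integral_congr_ae (ae_of_all _ fun x => ?_)
      exact Real.norm_of_nonneg (by positivity)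
  have hL := inLp_of_integrable_rpow hp hH hi
  refine ⟨hL, ?_⟩
  rw [nrm_rpow hp hL, integral_prod_symm _ hi]
  refine (integral_mono_ae hi.integral_prod_right (integrable_const (B ^ p)) hbd).trans ?_
  rw [integral_const, smul_eq_mul]

/-- Jensen's inequality for averages over a probability space. -/
lemma inLp_average_of_slices [IsProbabilityMeasure ν] (hpq : p.HolderConjugate q) {H : X × T → F}
    (hH : AEStronglyMeasurable H (μ.prod ν)) {B : ℝ} (hB0 : 0 ≤ B)
    (hB : ∀ᵐ t ∂ν, InLp p μ (fun x => H (x, t)) ∧ nrm p μ (fun x => H (x, t)) ≤ B) :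
    InLp p μ (fun x => ∫ t, H (x, t) ∂ν) ∧ nrm p μ (fun x => ∫ t, H (x, t) ∂ν) ≤ B := by
  have hp := hpq.lt
  obtain ⟨h1, h2⟩ := inLp_prod_of_slices hp hH hB
  obtain ⟨h3, h4⟩ := inLp_average hpq h1
  refine ⟨h3, h4.trans ?_⟩
  have h5 : nrm q ν (fun _ => (1:ℝ)) = 1 := by
    rw [nrm_eq hpq.symm.lt (memLp_const _)]
    simp
  rw [h5, one_mul]
  rw [probReal_univ, one_mul] at h2
  exact (Real.rpow_le_rpow_iff nrm_nonneg hB0 (by linarith)).1 h2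

end Averages

/-! ### Sobolev functions along segments: differences as averages of the weak gradient. -/

section Sobolev

set_option linter.unusedSectionVars false

variable {n : ℕ} {α p q : ℝ} {F : Type*} [NormedAddCommGroup F]

/-- Translations are continuous in `L^p`. -/
lemma tendsto_nrm_translate_sub (hp : 1 < p) {g : E n → F} (hg : InLp p volume g) :
    Tendsto (fun h : E n => nrm p volume ((fun x => g (x - h)) - g)) (𝓝 0) (𝓝 0) := by
  have : Fact (1 ≤ ENNReal.ofReal p) := ⟨one_le_ofReal hp⟩
  have : Fact (ENNReal.ofReal p ≠ ⊤) := ⟨ENNReal.ofReal_ne_top⟩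
  have hc : Continuous fun h : E n => DomAddAct.mk (-h) +ᵥ hg.toLp g := by
    have h1 : Continuous fun h : E n => DomAddAct.mk (-h) :=
      DomAddAct.continuous_mk.comp continuous_neg
    exact h1.vadd continuous_const
  have h2 := tendsto_iff_dist_tendsto_zero.1 (hc.tendsto 0)
  refine h2.congr fun h => ?_
  rw [neg_zero, DomAddAct.mk_zero, zero_vadd, DomAddAct.mk_vadd_toLp, Lp.dist_def,
    eLpNorm_congr_ae ((MemLp.coeFn_toLp _).sub (MemLp.coeFn_toLp _)), nrm]
  have : (fun x => g (-h +ᵥ x)) = fun x => g (x - h) := by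
    funext x
    rw [vadd_eq_add, neg_add_eq_sub]
  rw [this]

/-- The shear `(x, t) ↦ (x - t h, t)` preserves the product measure. -/
lemma measurePreserving_shear (ν : Measure ℝ) [SFinite ν] (h : E n) :
    MeasurePreserving (fun z : E n × ℝ => (z.1 - z.2 • h, z.2))
      ((volume : Measure (E n)).prod ν) ((volume : Measure (E n)).prod ν) := by
  have h1 : MeasurePreserving (fun z : ℝ × E n => (z.1, z.2 - z.1 • h))
      (ν.prod (volume : Measure (E n))) (ν.prod (volume : Measure (E n))) := by
    refine (MeasurePreserving.id ν).skew_product (g := fun t x => x - t • h) (by fun_prop) ?_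
    exact ae_of_all _ fun t => (measurePreserving_sub (t • h)).map_eq
  exact Measure.measurePreserving_swap.comp (h1.comp Measure.measurePreserving_swap)

/-- The unit interval with Lebesgue measure. -/
def unitMeas : Measure ℝ := volume.restrict (Set.Ioo 0 1)

instance : IsProbabilityMeasure unitMeas := ⟨by simp [unitMeas]⟩

lemma ae_unitMeas : ∀ᵐ t ∂unitMeas, t ∈ Set.Ioo (0:ℝ) 1 := ae_restrict_mem measurableSet_Ioo

lemma hasDerivAt_comp_add_smul {ψ : E n → ℝ} (hψ : ContDiff ℝ ∞ ψ) (x h : E n) (t : ℝ) :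
    HasDerivAt (fun t : ℝ => ψ (x + t • h)) (fderiv ℝ ψ (x + t • h) h) t := by
  have h1 : HasDerivAt (fun t : ℝ => x + t • h) h t := by
    simpa using ((hasDerivAt_id t).smul_const h).const_add x
  exact ((hψ.differentiable (by simp) _).hasFDerivAt).comp_hasDerivAt t h1

lemma fderiv_comp_add {ψ : E n → ℝ} (a : E n) (x : E n) :
    fderiv ℝ (fun x => ψ (x + a)) x = fderiv ℝ ψ (x + a) := fderiv_comp_add_right a

lemma exists_bound_of_hasCompactSupport {X G : Type*} [TopologicalSpace X]
    [NormedAddCommGroup G] {ψ : X → G}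
    (hψ : Continuous ψ) (hc : HasCompactSupport ψ) : ∃ C : ℝ, 0 ≤ C ∧ ∀ x, ‖ψ x‖ ≤ C := by
  obtain ⟨C, hC⟩ := hψ.bounded_above_of_compact_support hc
  exact ⟨max C 0, le_max_right _ _, fun x => (hC x).trans (le_max_left _ _)⟩

/-- Integrability of `u(x) k(x + t h)` for compactly supported `k`. -/
lemma integrable_mul_comp_add {u k : E n → ℝ} (hu : LocallyIntegrable u volume)
    (hk : Continuous k) (hkc : HasCompactSupport k) (h : E n) :
    Integrable (fun z : E n × ℝ => u z.1 * k (z.1 + z.2 • h))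
      ((volume : Measure (E n)).prod unitMeas) := by
  obtain ⟨C, hC0, hC⟩ := exists_bound_of_hasCompactSupport hk hkc
  obtain ⟨R, hR⟩ := hkc.isCompact.isBounded.subset_closedBall 0
  have hK : IsCompact (closedBall (0 : E n) (R + ‖h‖)) := isCompact_closedBall _ _
  have h1 : Integrable (fun x => C * (closedBall (0 : E n) (R + ‖h‖)).indicator (fun x => ‖u x‖) x)
      volume :=
    ((integrable_indicator_iff measurableSet_closedBall).2
      (hu.integrableOn_isCompact hK).norm).const_mul C
  refine (h1.comp_fst unitMeas).mono' ?_ ?_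
  · refine (hu.aestronglyMeasurable.comp_quasiMeasurePreserving
      Measure.quasiMeasurePreserving_fst).mul ?_
    have : Continuous fun z : E n × ℝ => k (z.1 + z.2 • h) := by fun_prop
    exact this.aestronglyMeasurable
  · have ht : ∀ᵐ z ∂((volume : Measure (E n)).prod unitMeas), z.2 ∈ Set.Ioo (0:ℝ) 1 :=
      Measure.quasiMeasurePreserving_snd.ae ae_unitMeas
    filter_upwards [ht] with z hz
    by_cases hx : z.1 ∈ closedBall (0 : E n) (R + ‖h‖)
    · rw [Set.indicator_of_mem hx, norm_mul, mul_comm]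
      gcongr
      exact hC _
    · have hz0 : k (z.1 + z.2 • h) = 0 := by
        by_contra hne
        apply hx
        have h2 := hR (subset_tsupport _ (Function.mem_support.2 hne))
        rw [mem_closedBall_zero_iff] at h2 ⊢
        have h3 : ‖z.1‖ ≤ ‖z.1 + z.2 • h‖ + ‖z.2 • h‖ := by
          calc ‖z.1‖ = ‖z.1 + z.2 • h - z.2 • h‖ := by rw [add_sub_cancel_right]
            _ ≤ _ := norm_sub_le _ _
        have h4 : ‖z.2 • h‖ ≤ ‖h‖ := by
          rw [norm_smul, Real.norm_of_nonneg hz.1.le]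
          exact mul_le_of_le_one_left (norm_nonneg _) hz.2.le
        linarith
      simp [hz0, Set.indicator_of_notMem hx]

lemma integrable_mul_of_hasCompactSupport {u k : E n → ℝ}
    (hu : LocallyIntegrable u volume) (hk : Continuous k) (hkc : HasCompactSupport k) :
    Integrable (fun x => u x * k x) volume := by
  simpa [smul_eq_mul, mul_comm] using hu.integrable_smul_left_of_hasCompactSupport hk hkc

lemma inLp_inner {g : E n → E n} (hg : InLp p volume g) (e : E n) :
    InLp p volume (fun x => inner ℝ (g x) e) :=
  hg.of_le_mul (c := ‖e‖) (hg.1.inner aestronglyMeasurable_const) (ae_of_all _ fun x => by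
    rw [mul_comm]
    exact norm_inner_le_norm _ _)

lemma nrm_inner_le {g : E n → E n} (hg : InLp p volume g) (e : E n) :
    nrm p volume (fun x => inner ℝ (g x) e) ≤ ‖e‖ * nrm p volume g :=
  nrm_le_mul hg (norm_nonneg _) (ae_of_all _ fun x => by
    rw [mul_comm]
    exact norm_inner_le_norm _ _)

lemma inLp_shear {k : E n → ℝ} (hk : InLp p volume k) (h : E n) :
    InLp p ((volume : Measure (E n)).prod unitMeas) (fun z : E n × ℝ => k (z.1 - z.2 • h)) := by
  have h1 : InLp p ((volume : Measure (E n)).prod unitMeas) (fun z : E n × ℝ => k z.1) :=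
    hk.comp_fst unitMeas
  exact h1.comp_measurePreserving (measurePreserving_shear unitMeas h)

lemma inLp_integral_shear (hpq : p.HolderConjugate q) {k : E n → ℝ} (hk : InLp p volume k)
    (h : E n) : InLp p volume (fun x => ∫ t, k (x - t • h) ∂unitMeas) :=
  (inLp_average hpq (inLp_shear hk h)).1

/-- A Sobolev function is almost everywhere the integral of its gradient along segments in a fixed
direction. -/
lemma sub_translate_eq_integral (hpq : p.HolderConjugate q) {u : E n → ℝ} {g : E n → E n}
    (hu : IsSobolevWith p u g) (h : E n) :
    ∀ᵐ x : E n, u x - u (x - h) = ∫ t, inner ℝ (g (x - t • h)) h ∂unitMeas := by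
  have hp := hpq.lt
  have h1p := one_le_ofReal hp
  obtain ⟨huL, hgL, hw⟩ := hu
  have hgh := inLp_inner hgL h
  have hshear := measurePreserving_shear unitMeas h
  have hav := inLp_integral_shear hpq hgh h
  have hdiff : InLp p volume (fun x => (u x - u (x - h)) -
      ∫ t, inner ℝ (g (x - t • h)) h ∂unitMeas) :=
    (huL.sub (inLp_translate huL h)).sub hav
  have hloc := hdiff.locallyIntegrable h1p
  have hul := huL.locallyIntegrable h1p
  have hghl := hgh.locallyIntegrable h1p
  -- The difference is moved onto the test function, `ψ(x+h) - ψ(x)` is written as the integral of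
  -- its derivative along the segment, and the weak gradient is used for each `t` between two
  -- applications of Fubini.
  have key := ae_eq_zero_of_integral_contDiff_smul_eq_zero hloc (fun ψ hψ hψc => by
    have hψ' : Continuous (fun x => fderiv ℝ ψ x h) :=
      (hψ.continuous_fderiv (by simp)).clm_apply continuous_const
    have hψ'c : HasCompactSupport (fun x => fderiv ℝ ψ x h) := hψc.fderiv_apply (𝕜 := ℝ) h
    have i1 : Integrable (fun x => u x * ψ x) := integrable_mul_of_hasCompactSupport hul hψ.continuous hψc
    have i2 : Integrable (fun x => u x * ψ (x + h)) :=
      integrable_mul_of_hasCompactSupport hul (hψ.continuous.comp (continuous_add_const h))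
        (hψc.comp_homeomorph (Homeomorph.addRight h))
    have i2' : Integrable (fun x => u (x - h) * ψ x) := by
      have := ((measurePreserving_sub h).integrable_comp_of_integrable i2)
      refine this.congr (ae_of_all _ fun x => ?_)
      simp
    have i3 := integrable_mul_of_hasCompactSupport (hav.locallyIntegrable h1p) hψ.continuous hψc
    have e1 : ∫ x, u (x - h) * ψ x = ∫ x, u x * ψ (x + h) := by
      rw [← integral_sub_right_eq_self (fun x => u x * ψ (x + h)) h]
      simp
    have e2 : ∀ x, ψ (x + h) - ψ x = ∫ t, fderiv ℝ ψ (x + t • h) h ∂unitMeas := fun x => by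
      have hc : Continuous fun t : ℝ => fderiv ℝ ψ (x + t • h) h :=
        hψ'.comp (by fun_prop : Continuous fun t : ℝ => x + t • h)
      have := intervalIntegral.integral_eq_sub_of_hasDerivAt (a := 0) (b := 1)
        (fun t _ => hasDerivAt_comp_add_smul hψ x h t) (hc.intervalIntegrable _ _)
      rw [intervalIntegral.integral_of_le zero_le_one, integral_Ioc_eq_integral_Ioo] at this
      rw [unitMeas]
      simpa using this.symm
    have j1 := integrable_mul_comp_add hul hψ' hψ'c h
    have j2 := integrable_mul_comp_add hghl hψ.continuous hψc h
    have j3 : Integrable (fun z : E n × ℝ => inner ℝ (g (z.1 - z.2 • h)) h * ψ z.1)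
        ((volume : Measure (E n)).prod unitMeas) := by
      refine (hshear.integrable_comp_of_integrable j2).congr (ae_of_all _ fun z => ?_)
      simp
    have e3 : ∀ t : ℝ, ∫ x, u x * fderiv ℝ ψ (x + t • h) h
        = - ∫ x, inner ℝ (g (x - t • h)) h * ψ x := fun t => by
      have h1 := hw (fun x => ψ (x + t • h)) (hψ.comp (contDiff_id.add contDiff_const))
        (hψc.comp_homeomorph (Homeomorph.addRight (t • h))) h
      simp only [fderiv_comp_add] at h1
      rw [h1, ← integral_sub_right_eq_self (fun x => inner ℝ (g x) h * ψ (x + t • h)) (t • h)]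
      simp
    have e4 : ∫ x, u x * (ψ (x + h) - ψ x)
        = - ∫ x, (∫ t, inner ℝ (g (x - t • h)) h ∂unitMeas) * ψ x := by
      calc ∫ x, u x * (ψ (x + h) - ψ x)
          = ∫ x, ∫ t, u x * fderiv ℝ ψ (x + t • h) h ∂unitMeas := by
            refine integral_congr_ae (ae_of_all _ fun x => ?_)
            simp only
            rw [e2, integral_const_mul]
        _ = ∫ t, (∫ x, u x * fderiv ℝ ψ (x + t • h) h) ∂unitMeas := integral_integral_swap j1
        _ = ∫ t, (- ∫ x, inner ℝ (g (x - t • h)) h * ψ x) ∂unitMeas := by simp only [e3]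
        _ = - ∫ t, (∫ x, inner ℝ (g (x - t • h)) h * ψ x) ∂unitMeas := integral_neg _
        _ = - ∫ x, ∫ t, inner ℝ (g (x - t • h)) h * ψ x ∂unitMeas := by
            exact congrArg Neg.neg (integral_integral_swap (f := fun x t =>
              inner ℝ (g (x - t • h)) h * ψ x) j3).symm
        _ = _ := by simp only [integral_mul_const]
    calc ∫ x, ψ x • ((u x - u (x - h)) - ∫ t, inner ℝ (g (x - t • h)) h ∂unitMeas)
        = ∫ x, ((u x * ψ x - u (x - h) * ψ x)
          - (∫ t, inner ℝ (g (x - t • h)) h ∂unitMeas) * ψ x) := by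
          refine integral_congr_ae (ae_of_all _ fun x => ?_)
          simp only [smul_eq_mul]
          ring
      _ = (∫ x, u x * ψ x) - (∫ x, u x * ψ (x + h))
          - ∫ x, (∫ t, inner ℝ (g (x - t • h)) h ∂unitMeas) * ψ x := by
          have i12 : Integrable (fun x => u x * ψ x - u (x - h) * ψ x) := i1.sub i2'
          rw [integral_sub i12 i3, integral_sub i1 i2', e1]
      _ = 0 := by
          have : ∫ x, u x * (ψ (x + h) - ψ x) = (∫ x, u x * ψ (x + h)) - ∫ x, u x * ψ x := by
            rw [← integral_sub i2 i1]
            refine integral_congr_ae (ae_of_all _ fun x => ?_)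
            ring
          linarith)
  filter_upwards [key] with x hx
  exact sub_eq_zero.1 hx

/-- Translation differences of a Sobolev function compared with a directional derivative. -/
lemma nrm_sub_translate_sub_inner_le (hpq : p.HolderConjugate q) {u : E n → ℝ} {g : E n → E n}
    (hu : IsSobolevWith p u g) (h : E n) {A : ℝ} (hA0 : 0 ≤ A)
    (hA : ∀ t ∈ Set.Ioo (0:ℝ) 1, nrm p volume ((fun x => g (x - t • h)) - g) ≤ A) :
    nrm p volume ((u - fun x => u (x - h)) - fun x => inner ℝ (g x) h) ≤ ‖h‖ * A := by
  have hp := hpq.lt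
  have hgL := hu.2.1
  have hgh := inLp_inner hgL h
  have hshear := measurePreserving_shear unitMeas h
  have hm1 : AEStronglyMeasurable (fun z : E n × ℝ => inner ℝ (g z.1) h)
      ((volume : Measure (E n)).prod unitMeas) :=
    hgh.1.comp_quasiMeasurePreserving Measure.quasiMeasurePreserving_fst
  have hmeas := (hm1.comp_measurePreserving hshear).sub hm1
  -- Jensen's inequality for the average over `t` of `(g(x - t h) - g(x))·h`, which is the quantity
  -- to be bounded.
  have hav := inLp_average_of_slices (B := ‖h‖ * A) hpq hmeas (by positivity) (by
    filter_upwards [ae_unitMeas] with t ht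
    have hd : InLp p volume ((fun x => g (x - t • h)) - g) := (inLp_translate hgL _).sub hgL
    have h1 : (fun x => ((fun z : E n × ℝ => inner ℝ (g z.1) h) ∘ (fun z : E n × ℝ =>
        (z.1 - z.2 • h, z.2)) - fun z : E n × ℝ => inner ℝ (g z.1) h) (x, t))
        = fun x => inner ℝ (((fun x => g (x - t • h)) - g) x) h := by
      funext x
      simp [inner_sub_left]
    rw [h1]
    exact ⟨inLp_inner hd h, (nrm_inner_le hd h).trans
      (mul_le_mul_of_nonneg_left (hA t ht) (norm_nonneg _))⟩)
  refine le_of_eq_of_le (nrm_congr_ae ?_) hav.2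
  have hint := inLp_shear hgh h
  have hint2 := (InLp.integrable_rpow hp hint).prod_right_ae
  filter_upwards [sub_translate_eq_integral hpq hu h, hint2, hint.1.prodMk_left] with x hx hi him
  have hLx : InLp p unitMeas (fun t => inner ℝ (g (x - t • h)) h) :=
    inLp_of_integrable_rpow hp him hi
  have hi' : Integrable (fun t => inner ℝ (g (x - t • h)) h) unitMeas :=
    hLx.integrable (one_le_ofReal hp)
  simp only [Pi.sub_apply, Function.comp_apply]
  rw [hx, integral_sub hi' (integrable_const _)]
  simp

end Sobolev

/-! ### Convergence of difference quotients -/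

section Quotients

set_option linter.unusedSectionVars false

variable {n : ℕ} {α p q : ℝ}

/-- The limit of the difference quotients of a function with gradient `g`. -/
def dqLim {n : ℕ} (g : E n → E n) (z : E n × Y n) : ℝ :=
  (unitY n).indicator (fun y => inner ℝ (g z.1) (y.1 : E n)) z.2

/-- The restriction of `yMeas` to radii less than one. -/
def yMeas₁ (n : ℕ) : Measure (Y n) := (yMeas n).restrict (unitY n)

instance : IsFiniteMeasure (yMeas₁ n) :=
  ⟨by rw [yMeas₁, Measure.restrict_apply_univ]; exact yMeas_unitY_ne_top.lt_top⟩

lemma zMeas_restrict : (zMeas n).restrict (Set.univ ×ˢ unitY n)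
    = (volume : Measure (E n)).prod (yMeas₁ n) := by
  rw [zMeas, ← Measure.prod_restrict, Measure.restrict_univ, yMeas₁]

lemma dqLim_eq_indicator (g : E n → E n) : dqLim g =
    (Set.univ ×ˢ unitY n).indicator (fun z : E n × Y n => inner ℝ (g z.1) (z.2.1 : E n)) := by
  funext z
  by_cases hz : z.2 ∈ unitY n
  · rw [dqLim, Set.indicator_of_mem hz,
      Set.indicator_of_mem (show z ∈ Set.univ ×ˢ unitY n from ⟨Set.mem_univ _, hz⟩)]
  · rw [dqLim, Set.indicator_of_notMem hz, Set.indicator_of_notMem (fun h => hz h.2)]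

lemma norm_sphere (θ : sphere (0 : E n) 1) : ‖(θ : E n)‖ = 1 := mem_sphere_zero_iff_norm.1 θ.2

lemma measurableSet_univ_unitY :
    MeasurableSet (Set.univ ×ˢ unitY n : Set (E n × Y n)) :=
  MeasurableSet.univ.prod measurableSet_unitY

lemma measurable_dir : Measurable (fun z : E n × Y n => (z.2.1 : E n)) :=
  measurable_subtype_coe.comp (measurable_fst.comp measurable_snd)

lemma inLp_inner_dir {g : E n → E n} (hg : InLp p volume g) :
    InLp p ((volume : Measure (E n)).prod (yMeas₁ n))
      (fun z => inner ℝ (g z.1) (z.2.1 : E n)) := by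
  have h1 : InLp p ((volume : Measure (E n)).prod (yMeas₁ n)) (fun z => g z.1) :=
    hg.comp_fst (yMeas₁ n)
  refine h1.of_le_mul (c := 1) (h1.1.inner measurable_dir.aestronglyMeasurable)
    (ae_of_all _ fun z => ?_)
  have := norm_inner_le_norm (𝕜 := ℝ) (g z.1) (z.2.1 : E n)
  rw [norm_sphere] at this
  linarith

lemma inLp_dqLim {g : E n → E n} (hg : InLp p volume g) : InLp p (zMeas n) (dqLim g) := by
  rw [dqLim_eq_indicator]
  refine (memLp_indicator_iff_restrict measurableSet_univ_unitY).2 ?_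
  rw [zMeas_restrict]
  exact inLp_inner_dir hg

lemma dqLim_add (g₁ g₂ : E n → E n) : dqLim (g₁ + g₂) = dqLim g₁ + dqLim g₂ := by
  funext z
  by_cases hz : z.2 ∈ unitY n <;> simp [dqLim, hz, inner_add_left]

lemma dqLim_sub (g₁ g₂ : E n → E n) : dqLim (g₁ - g₂) = dqLim g₁ - dqLim g₂ := by
  funext z
  by_cases hz : z.2 ∈ unitY n <;> simp [dqLim, hz, inner_sub_left]

lemma dqLim_smul (c : ℝ) (g : E n → E n) : dqLim (c • g) = c • dqLim g := by
  funext z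
  by_cases hz : z.2 ∈ unitY n <;> simp [dqLim, hz, inner_smul_left]

/-- An integrable profile on `Y`. -/
def profile {n : ℕ} (β : ℝ) (y : Y n) : ℝ := if y.2 < 1 then 1 else y.2 ^ (-β)

lemma integrable_profile {β : ℝ} (hβ : 1 < β) : Integrable (profile β) (yMeas n) := by
  have h1 : IntegrableOn (fun t : ℝ => if t < 1 then (1:ℝ) else t ^ (-β)) (Set.Ioi 0) := by
    have hu : Set.Ioi (0:ℝ) = Set.Ioo 0 1 ∪ Set.Ici 1 := by
      ext t
      simp only [Set.mem_Ioi, Set.mem_union, Set.mem_Ioo, Set.mem_Ici]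
      constructor
      · intro h
        rcases lt_or_ge t 1 with h1 | h1
        · exact Or.inl ⟨h, h1⟩
        · exact Or.inr h1
      · rintro (h | h)
        · exact h.1
        · linarith
    rw [hu, integrableOn_union]
    constructor
    · refine (integrableOn_const (C := (1:ℝ)) (s := Set.Ioo (0:ℝ) 1) (by simp)).congr_fun ?_
        measurableSet_Ioo
      intro t ht
      simp [ht.2]
    · rw [integrableOn_Ici_iff_integrableOn_Ioi]
      refine (integrableOn_Ioi_rpow_of_lt (by linarith : -β < -1) zero_lt_one).congr_fun ?_
        measurableSet_Ioi
      intro t ht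
      have : ¬ t < 1 := not_lt.2 (le_of_lt ht)
      simp [this]
  exact Integrable.comp_snd (ν := volume.restrict (Set.Ioi (0:ℝ))) h1 _

lemma dq_slice (u : E n → ℝ) (y : Y n) : (fun x => dq α u (x, y))
    = (rad α y)⁻¹ • (u - fun x => u (x - hvec α y)) := by
  funext x
  simp only [dq, Pi.smul_apply, Pi.sub_apply, smul_eq_mul]
  rw [div_eq_inv_mul]

lemma inLp_dq_slice {u : E n → ℝ} (hu : InLp p volume u) (y : Y n) :
    InLp p volume (fun x => dq α u (x, y)) := by
  rw [dq_slice]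
  exact (hu.sub (inLp_translate hu _)).const_smul _

lemma dqLim_slice_of_mem (g : E n → E n) {y : Y n} (hy : y ∈ unitY n) :
    (fun x => dqLim g (x, y)) = fun x => inner ℝ (g x) (y.1 : E n) := by
  funext x
  rw [dqLim, Set.indicator_of_mem hy]

lemma dqLim_slice_of_notMem (g : E n → E n) {y : Y n} (hy : y ∉ unitY n) :
    (fun x => dqLim g (x, y)) = 0 := by
  funext x
  rw [dqLim, Set.indicator_of_notMem hy, Pi.zero_apply]

lemma slice_sub_of_mem (u : E n → ℝ) (g : E n → E n) {y : Y n} (hy : y ∈ unitY n) :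
    (fun x => (dq α u - dqLim g) (x, y)) = (rad α y)⁻¹ •
      ((u - fun x => u (x - hvec α y)) - fun x => inner ℝ (g x) (hvec α y)) := by
  have h1 := congrFun (dq_slice (α := α) u y)
  have h2 := congrFun (dqLim_slice_of_mem g hy)
  have hr := (rad_pos (α := α) hy.2.1).ne'
  funext x
  simp only [Pi.sub_apply, Pi.smul_apply, smul_eq_mul] at h1 h2 ⊢
  rw [h1, h2, hvec, inner_smul_right, mul_sub, mul_sub, ← mul_assoc _ (rad α y),
    inv_mul_cancel₀ hr, one_mul, ← mul_sub]

lemma nrm_slice_of_mem_le (hpq : p.HolderConjugate q) {u : E n → ℝ} {g : E n → E n}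
    (hu : IsSobolevWith p u g) {y : Y n} (hy : y ∈ unitY n) {A : ℝ} (hA0 : 0 ≤ A)
    (hA : ∀ t ∈ Set.Ioo (0:ℝ) 1, nrm p volume ((fun x => g (x - t • hvec α y)) - g) ≤ A) :
    nrm p volume (fun x => (dq α u - dqLim g) (x, y)) ≤ A := by
  have hr := rad_pos (α := α) hy.2.1
  rw [slice_sub_of_mem u g hy, nrm_const_smul, abs_of_pos (inv_pos.2 hr)]
  have h1 := nrm_sub_translate_sub_inner_le hpq hu (hvec α y) hA0 hA
  rw [norm_hvec hy.2.1] at h1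
  rwa [inv_mul_le_iff₀ hr]

lemma nrm_slice_of_notMem_le (hp : 1 < p) {u : E n → ℝ} {g : E n → E n}
    (hu : InLp p volume u) {y : Y n} (hy0 : 0 < y.2) (hy : y ∉ unitY n) :
    nrm p volume (fun x => (dq α u - dqLim g) (x, y)) ≤ (rad α y)⁻¹ * (2 * nrm p volume u) := by
  have hr := rad_pos (α := α) hy0
  have h1 : (fun x => (dq α u - dqLim g) (x, y)) = (fun x => dq α u (x, y)) := by
    have h2 := congrFun (dqLim_slice_of_notMem g hy)
    funext x
    simp only [Pi.sub_apply, Pi.zero_apply] at h2 ⊢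
    rw [h2, sub_zero]
  rw [h1, dq_slice, nrm_const_smul, abs_of_pos (inv_pos.2 hr)]
  have h2 := nrm_sub_le hp hu (inLp_translate hu (hvec α y))
  rw [nrm_translate hu.1] at h2
  refine mul_le_mul_of_nonneg_left (by linarith) (by positivity)

lemma notMem_unitY {y : Y n} (hy0 : 0 < y.2) (hy : y ∉ unitY n) : 1 ≤ y.2 := by
  by_contra! h
  exact hy ⟨Set.mem_univ _, hy0, h⟩

variable [NeZero n]

/-- For `t < 1` the quotient minus its limit is controlled by translation differences of the
gradient, at most `2 ‖g‖`; for `t ≥ 1` it is at most `2 ‖u‖ / rad`, and `rad^(-p) = t^(-p/α) ≤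
t^(-β)`. The exponent `β = p/α` gives integrability for each `α < p`, while `β = 2` gives a majorant
common to all `α < p/2`. -/
lemma slices_bound (hpq : p.HolderConjugate q) {u : E n → ℝ} {g : E n → E n}
    (hu : IsSobolevWith p u g) {β : ℝ} (hβ : β ≤ p / α) {y : Y n} (hy0 : 0 < y.2) :
    InLp p volume (fun x => (dq α u - dqLim g) (x, y)) ∧
    ∫ x, ‖(dq α u - dqLim g) (x, y)‖ ^ p
      ≤ ((2 * nrm p volume g) ^ p + (2 * nrm p volume u) ^ p) * profile β y := by
  have hp := hpq.lt
  have hp0 : 0 < p := by linarith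
  have hgn : 0 ≤ nrm p volume g := nrm_nonneg
  have hun : 0 ≤ nrm p volume u := nrm_nonneg
  have hg2 : 0 ≤ (2 * nrm p volume g) ^ p := by positivity
  have hu2 : 0 ≤ (2 * nrm p volume u) ^ p := by positivity
  have hin : InLp p volume (fun x => (dq α u - dqLim g) (x, y)) := by
    refine (inLp_dq_slice hu.1 y).sub ?_
    by_cases hy : y ∈ unitY n
    · rw [dqLim_slice_of_mem g hy]
      exact inLp_inner hu.2.1 _
    · rw [dqLim_slice_of_notMem g hy]
      exact MemLp.zero
  refine ⟨hin, ?_⟩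
  rw [← nrm_rpow hp hin]
  by_cases hy : y ∈ unitY n
  · have h1 := nrm_slice_of_mem_le (α := α) hpq hu hy (A := 2 * nrm p volume g) (by positivity)
      (fun t _ => by
        refine (nrm_sub_le hp (inLp_translate hu.2.1 _) hu.2.1).trans ?_
        rw [nrm_translate hu.2.1.1]
        linarith)
    have h2 := Real.rpow_le_rpow nrm_nonneg h1 hp0.le
    rw [profile, if_pos hy.2.2, mul_one]
    linarith
  · have hy1 := notMem_unitY hy0 hy
    have h1 := nrm_slice_of_notMem_le (α := α) (g := g) hp hu.1 hy0 hy
    have h2 := Real.rpow_le_rpow nrm_nonneg h1 hp0.le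
    have hr := rad_pos (α := α) hy0
    rw [Real.mul_rpow (by positivity) (by positivity)] at h2
    have h3 : (rad α y)⁻¹ ^ p ≤ profile β y := by
      rw [profile, if_neg (not_lt.2 hy1), Real.inv_rpow hr.le, rad, ← Real.rpow_mul hy0.le,
        ← Real.rpow_neg hy0.le]
      refine Real.rpow_le_rpow_of_exponent_le hy1 ?_
      rw [inv_mul_eq_div]
      linarith
    have h4 : 0 ≤ profile β y := le_trans (by positivity) h3
    nlinarith [mul_le_mul_of_nonneg_right h3 hu2, mul_nonneg hg2 h4]

lemma aestronglyMeasurable_quot (hα : 0 < α) {u : E n → ℝ} {g : E n → E n}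
    (hu : IsSobolevWith p u g) :
    AEStronglyMeasurable (dq α u - dqLim g) ((volume : Measure (E n)).prod (yMeas n)) :=
  (aestronglyMeasurable_dq hα hu.1.1).sub (inLp_dqLim hu.2.1).1

lemma aestronglyMeasurable_slices (hα : 0 < α) {u : E n → ℝ} {g : E n → E n}
    (hu : IsSobolevWith p u g) :
    AEStronglyMeasurable (fun y => ∫ x, ‖(dq α u - dqLim g) (x, y)‖ ^ p) (yMeas n) := by
  have h1 : AEStronglyMeasurable (fun z => ‖(dq α u - dqLim g) z‖ ^ p)
      ((volume : Measure (E n)).prod (yMeas n)) :=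
    ((aestronglyMeasurable_quot hα hu).norm.aemeasurable.pow_const p).aestronglyMeasurable
  exact h1.prod_swap.integral_prod_right'

lemma inLp_dq_sub_dqLim (hpq : p.HolderConjugate q) {u : E n → ℝ} {g : E n → E n}
    (hu : IsSobolevWith p u g) (hα : 0 < α) (hαp : α < p) :
    InLp p (zMeas n) (dq α u - dqLim g) := by
  have hp := hpq.lt
  have hm := aestronglyMeasurable_quot hα hu
  have hm' : AEStronglyMeasurable (fun z => ‖(dq α u - dqLim g) z‖ ^ p)
      ((volume : Measure (E n)).prod (yMeas n)) :=
    (hm.norm.aemeasurable.pow_const p).aestronglyMeasurable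
  refine inLp_of_integrable_rpow hp hm ?_
  refine (integrable_prod_iff' hm').2 ⟨?_, ?_⟩
  · filter_upwards [ae_yMeas_pos] with y hy
    exact InLp.integrable_rpow hp (slices_bound hpq hu le_rfl hy).1
  · refine ((integrable_profile (β := p / α) (by rwa [one_lt_div hα])).const_mul
      ((2 * nrm p volume g) ^ p + (2 * nrm p volume u) ^ p)).mono'
      hm'.norm.prod_swap.integral_prod_right' ?_
    filter_upwards [ae_yMeas_pos] with y hy
    rw [Real.norm_of_nonneg (integral_nonneg fun x => norm_nonneg _)]
    refine le_trans (le_of_eq ?_) (slices_bound hpq hu le_rfl hy).2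
    refine integral_congr_ae (ae_of_all _ fun x => ?_)
    exact Real.norm_of_nonneg (by positivity)

/-- First order Sobolev functions have `p`-integrable difference quotients. -/
lemma inLp_dq (hpq : p.HolderConjugate q) {u : E n → ℝ} {g : E n → E n}
    (hu : IsSobolevWith p u g) (hα : 0 < α) (hαp : α < p) : InLp p (zMeas n) (dq α u) := by
  have := (inLp_dq_sub_dqLim hpq hu hα hαp).add (inLp_dqLim hu.2.1)
  rwa [sub_add_cancel] at this

lemma tendsto_rad_zero {y : Y n} (hy : y ∈ unitY n) :
    Tendsto (fun α => rad α y) (𝓝[>] 0) (𝓝 0) :=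
  (tendsto_rpow_atTop_of_base_lt_one y.2 (by linarith [hy.2.1]) hy.2.2).comp
    tendsto_inv_nhdsGT_zero

lemma tendsto_rad_inv_zero {y : Y n} (hy : 1 < y.2) :
    Tendsto (fun α => (rad α y)⁻¹) (𝓝[>] 0) (𝓝 0) :=
  tendsto_inv_atTop_zero.comp
    ((tendsto_rpow_atTop_of_base_gt_one y.2 hy).comp tendsto_inv_nhdsGT_zero)

/-- At `t = 1` the radius is one for every `α`, so the quotient does not converge to its intended
limit there; this null set is discarded. -/
lemma ae_yMeas_ne_one : ∀ᵐ y ∂(yMeas n), y.2 ≠ 1 := by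
  unfold yMeas
  exact Measure.quasiMeasurePreserving_snd.ae (ae_restrict_of_ae (Measure.ae_ne volume 1))

/-- Difference quotients of Sobolev functions converge in `L^p` as the fractional order tends to
one. -/
theorem tendsto_dq (hpq : p.HolderConjugate q) {u : E n → ℝ} {g : E n → E n}
    (hu : IsSobolevWith p u g) :
    Tendsto (fun α => nrm p (zMeas n) (dq α u - dqLim g)) (𝓝[>] 0) (𝓝 0) := by
  have hp := hpq.lt
  have hp0 : 0 < p := by linarith
  have hsmall : ∀ᶠ α : ℝ in 𝓝[>] 0, 0 < α ∧ α < p / 2 := by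
    filter_upwards [Ioo_mem_nhdsGT (by positivity : (0:ℝ) < p / 2)] with α hα using hα
  have hev : ∀ᶠ α : ℝ in 𝓝[>] 0, InLp p (zMeas n) (dq α u - dqLim g) := by
    filter_upwards [hsmall] with α hα
    exact inLp_dq_sub_dqLim hpq hu hα.1 (by linarith [hα.2])
  refine tendsto_nrm_of_rpow hp hev ?_
  have hlim : Tendsto (fun α => ∫ y, (∫ x, ‖(dq α u - dqLim g) (x, y)‖ ^ p) ∂(yMeas n)) (𝓝[>] 0)
      (𝓝 (∫ _, (0:ℝ) ∂(yMeas n))) := by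
    refine tendsto_integral_filter_of_dominated_convergence
      (fun y => ((2 * nrm p volume g) ^ p + (2 * nrm p volume u) ^ p) * profile 2 y) ?_ ?_
      ((integrable_profile one_lt_two).const_mul _) ?_
    · filter_upwards [hsmall] with α hα
      exact aestronglyMeasurable_slices hα.1 hu
    · filter_upwards [hsmall] with α hα
      filter_upwards [ae_yMeas_pos] with y hy
      rw [Real.norm_of_nonneg (integral_nonneg fun x => by positivity)]
      refine (slices_bound hpq hu ?_ hy).2
      rw [le_div_iff₀ hα.1]
      linarith [hα.2]
    · filter_upwards [ae_yMeas_pos, ae_yMeas_ne_one] with y hy hy1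
      have hnrm : Tendsto (fun α => nrm p volume (fun x => (dq α u - dqLim g) (x, y)))
          (𝓝[>] 0) (𝓝 0) := by
        -- For `t < 1` the step shrinks to zero and continuity of translations of `g` applies; for
        -- `t > 1` the step grows without bound and the quotient is crushed by its denominator.
        by_cases hyu : y ∈ unitY n
        · rw [Metric.tendsto_nhds]
          intro ε hε
          have h1 := (tendsto_nrm_translate_sub hp hu.2.1).eventually
            (gt_mem_nhds (half_pos hε))
          obtain ⟨δ, hδ, hball⟩ := Metric.eventually_nhds_iff.1 h1
          filter_upwards [(tendsto_rad_zero hyu).eventually (gt_mem_nhds hδ)] with α hα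
          rw [Real.dist_eq, sub_zero, abs_of_nonneg nrm_nonneg]
          refine lt_of_le_of_lt (nrm_slice_of_mem_le hpq hu hyu (half_pos hε).le fun t ht => ?_)
            (half_lt_self hε)
          refine (hball ?_).le
          rw [dist_zero_right, norm_smul, Real.norm_of_nonneg ht.1.le, norm_hvec hy]
          have := rad_pos (α := α) hy
          nlinarith [ht.1, ht.2]
        · have hy2 : 1 < y.2 := lt_of_le_of_ne (notMem_unitY hy hyu) (Ne.symm hy1)
          have h1 := (tendsto_rad_inv_zero hy2).mul_const (2 * nrm p volume u)
          rw [zero_mul] at h1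
          exact squeeze_zero (fun _ => nrm_nonneg)
            (fun α => nrm_slice_of_notMem_le hp hu.1 hy hyu) h1
      refine tendsto_integral_rpow hp ?_ hnrm
      filter_upwards [hsmall] with α hα
      exact (slices_bound hpq hu le_rfl hy).1
  rw [integral_zero] at hlim
  refine hlim.congr' ?_
  filter_upwards [hev] with α hα
  have hi := InLp.integrable_rpow hp hα
  exact (integral_prod_symm _ hi).symm

end Quotients

/-! ### Weak limits of difference quotients -/

section WeakLimits

set_option linter.unusedSectionVars false

/-- Rectangles are a generating π-system, so the signed measure with density `K` is zero. -/
lemma ae_eq_zero_of_setIntegral_prod {X T : Type*} [MeasurableSpace X] [MeasurableSpace T]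
    {μ : Measure (X × T)} {K : X × T → ℝ} (hK : Integrable K μ)
    (h : ∀ A : Set X, MeasurableSet A → ∀ B : Set T, MeasurableSet B →
      ∫ z in A ×ˢ B, K z ∂μ = 0) : K =ᵐ[μ] 0 := by
  refine hK.ae_eq_of_withDensityᵥ_eq (integrable_zero _ _ _) ?_
  rw [withDensityᵥ_zero]
  refine VectorMeasure.ext_of_generateFrom _ ?_ generateFrom_prod.symm isPiSystem_prod ?_
  · rintro _ ⟨A, hA, B, hB, rfl⟩
    rw [withDensityᵥ_apply hK (MeasurableSet.prod hA hB), h A hA B hB]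
    rfl
  · rw [withDensityᵥ_apply hK MeasurableSet.univ, ← Set.univ_prod_univ,
      h _ MeasurableSet.univ _ MeasurableSet.univ]
    rfl

variable {n : ℕ} [NeZero n] {α p q : ℝ}

/-- The difference quotients of a test function in the opposite direction. -/
def testQuot {n : ℕ} (α : ℝ) (ψ : E n → ℝ) (z : E n × Y n) : ℝ :=
  (ψ z.1 - ψ (z.1 + hvec α z.2)) / rad α z.2

lemma ae_yMeas₁ : ∀ᵐ y ∂(yMeas₁ n), y ∈ unitY n := ae_restrict_mem measurableSet_unitY

lemma ae_prod_yMeas₁ : ∀ᵐ z ∂((volume : Measure (E n)).prod (yMeas₁ n)), z.2 ∈ unitY n :=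
  Measure.quasiMeasurePreserving_snd.ae ae_yMeas₁

lemma measurable_testQuot {ψ : E n → ℝ} (hψ : Continuous ψ) : Measurable (testQuot α ψ) := by
  unfold testQuot
  have h1 : Measurable fun z : E n × Y n => ψ (z.1 + hvec α z.2) :=
    hψ.measurable.comp (measurable_fst.add (measurable_hvec.comp measurable_snd))
  exact ((hψ.measurable.comp measurable_fst).sub h1).div (measurable_rad.comp measurable_snd)

/-- The constant is a Lipschitz constant of `ψ`, and the support radius grows by one because steps
in `unitY` have length at most one. Uniformity in `α` makes dominated convergence available. -/
lemma exists_testQuot_bound {ψ : E n → ℝ} (hψ : ContDiff ℝ ∞ ψ) (hc : HasCompactSupport ψ) :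
    ∃ C R : ℝ, 0 ≤ C ∧ ∀ α : ℝ, 0 < α → ∀ z : E n × Y n, z.2 ∈ unitY n →
      |testQuot α ψ z| ≤ (closedBall (0 : E n) R).indicator (fun _ => C) z.1 := by
  obtain ⟨C, hC⟩ := hψ.lipschitzWith_of_hasCompactSupport hc (by simp)
  obtain ⟨R, hR⟩ := hc.isBounded.subset_closedBall (0 : E n)
  refine ⟨C, R + 1, C.2, fun α hα z hz => ?_⟩
  have hr := rad_pos (α := α) hz.2.1
  have hr1 := rad_le_one hα hz
  have hn := norm_hvec (α := α) hz.2.1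
  by_cases hx : z.1 ∈ closedBall (0 : E n) (R + 1)
  · rw [Set.indicator_of_mem hx, testQuot, abs_div, abs_of_pos hr, div_le_iff₀ hr]
    have := hC.dist_le_mul z.1 (z.1 + hvec α z.2)
    rwa [Real.dist_eq, dist_self_add_right, hn] at this
  · rw [Set.indicator_of_notMem hx]
    rw [mem_closedBall_zero_iff, not_le] at hx
    have h1 : ψ z.1 = 0 := by
      by_contra h
      have := mem_closedBall_zero_iff.1 (hR (subset_tsupport _ h))
      linarith
    have h2 : ψ (z.1 + hvec α z.2) = 0 := by
      by_contra h
      have h3 := mem_closedBall_zero_iff.1 (hR (subset_tsupport _ h))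
      have h4 := norm_sub_le (z.1 + hvec α z.2) (hvec α z.2)
      rw [add_sub_cancel_right] at h4
      linarith
    rw [testQuot, h1, h2]
    simp

lemma tendsto_testQuot {ψ : E n → ℝ} (hψ : ContDiff ℝ ∞ ψ) {z : E n × Y n}
    (hz : z.2 ∈ unitY n) :
    Tendsto (fun α => testQuot α ψ z) (𝓝[>] 0) (𝓝 (-fderiv ℝ ψ z.1 (z.2.1 : E n))) := by
  have h1 := hasDerivAt_comp_add_smul hψ z.1 (z.2.1 : E n) 0
  rw [zero_smul, add_zero, hasDerivAt_iff_tendsto_slope_zero] at h1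
  have h2 : Tendsto (fun α => rad α z.2) (𝓝[>] 0) (𝓝[≠] 0) :=
    tendsto_nhdsWithin_iff.2 ⟨tendsto_rad_zero hz,
      Eventually.of_forall fun α => (rad_pos hz.2.1).ne'⟩
  refine (h1.comp h2).neg.congr fun α => ?_
  simp only [Function.comp_apply, zero_add, zero_smul, add_zero, testQuot, hvec, smul_eq_mul]
  ring

lemma inLp_of_ball_bound {T : Type*} [MeasurableSpace T] {ν : Measure T}
    [IsFiniteMeasure ν] {H : E n × T → ℝ}
    (hm : AEStronglyMeasurable H ((volume : Measure (E n)).prod ν)) {C R : ℝ}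
    (hb : ∀ᵐ z ∂((volume : Measure (E n)).prod ν),
      |H z| ≤ (closedBall (0 : E n) R).indicator (fun _ => C) z.1) :
    InLp q ((volume : Measure (E n)).prod ν) H := by
  have h1 : InLp q (volume : Measure (E n)) ((closedBall (0 : E n) R).indicator (fun _ => C)) :=
    memLp_indicator_const _ measurableSet_closedBall _ (Or.inr measure_closedBall_lt_top.ne)
  have h2 : InLp q ((volume : Measure (E n)).prod ν)
      (fun z => (closedBall (0 : E n) R).indicator (fun _ => C) z.1) := h1.comp_fst ν
  refine h2.mono hm ?_
  filter_upwards [hb] with z hz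
  exact hz.trans (le_abs_self _)

/-- Difference quotients of test functions converge strongly. -/
lemma tendsto_nrm_testQuot (hq : 1 < q) {ψ : E n → ℝ} (hψ : ContDiff ℝ ∞ ψ)
    (hc : HasCompactSupport ψ) {ζ : Y n → ℝ} (hζ : Measurable ζ) {B : ℝ}
    (hB : ∀ y, |ζ y| ≤ B) :
    (∀ α, 0 < α → InLp q ((volume : Measure (E n)).prod (yMeas₁ n))
      (fun z => testQuot α ψ z * ζ z.2)) ∧
    InLp q ((volume : Measure (E n)).prod (yMeas₁ n))
      (fun z => -fderiv ℝ ψ z.1 (z.2.1 : E n) * ζ z.2) ∧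
    Tendsto (fun α => nrm q ((volume : Measure (E n)).prod (yMeas₁ n))
      ((fun z => testQuot α ψ z * ζ z.2) - fun z => -fderiv ℝ ψ z.1 (z.2.1 : E n) * ζ z.2))
      (𝓝[>] 0) (𝓝 0) := by
  have hq0 : 0 < q := by linarith
  obtain ⟨C, R, hC0, hC⟩ := exists_testQuot_bound hψ hc
  have hζ' : Measurable fun z : E n × Y n => ζ z.2 := hζ.comp measurable_snd
  have hlim : ∀ z : E n × Y n, z.2 ∈ unitY n → |fderiv ℝ ψ z.1 (z.2.1 : E n)| ≤
      (closedBall (0 : E n) R).indicator (fun _ => C) z.1 := by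
    intro z hz
    have h := (tendsto_testQuot hψ hz).abs
    rw [abs_neg] at h
    refine le_of_tendsto h ?_
    filter_upwards [self_mem_nhdsWithin] with α hα
    exact hC α hα z hz
  have hfd : Measurable fun z : E n × Y n => fderiv ℝ ψ z.1 (z.2.1 : E n) := by
    have h1 : Continuous fun w : E n × E n => fderiv ℝ ψ w.1 w.2 :=
      hψ.continuous_fderiv_apply (by simp)
    exact h1.measurable.comp (measurable_fst.prodMk measurable_dir)
  have key : ∀ (k : E n × Y n → ℝ), Measurable k →
      (∀ z : E n × Y n, z.2 ∈ unitY n → |k z| ≤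
        (closedBall (0 : E n) R).indicator (fun _ => C) z.1) →
      InLp q ((volume : Measure (E n)).prod (yMeas₁ n)) (fun z => k z * ζ z.2) := by
    intro k hk hkb
    refine inLp_of_ball_bound (hk.mul hζ').aestronglyMeasurable (C := C * B) (R := R) ?_
    filter_upwards [ae_prod_yMeas₁] with z hz
    rw [abs_mul]
    have h1 := hkb z hz
    by_cases hx : z.1 ∈ closedBall (0 : E n) R
    · rw [Set.indicator_of_mem hx] at h1 ⊢
      exact mul_le_mul h1 (hB _) (abs_nonneg _) hC0
    · rw [Set.indicator_of_notMem hx] at h1 ⊢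
      nlinarith [abs_nonneg (k z), abs_nonneg (ζ z.2)]
  have hI1 : ∀ α, 0 < α → InLp q ((volume : Measure (E n)).prod (yMeas₁ n))
      (fun z => testQuot α ψ z * ζ z.2) := fun α hα =>
    key _ (measurable_testQuot hψ.continuous) (hC α hα)
  have hI2 : InLp q ((volume : Measure (E n)).prod (yMeas₁ n))
      (fun z => -fderiv ℝ ψ z.1 (z.2.1 : E n) * ζ z.2) :=
    key (fun z => -fderiv ℝ ψ z.1 (z.2.1 : E n)) hfd.neg fun z hz => by
      rw [abs_neg]
      exact hlim z hz
  refine ⟨hI1, hI2, ?_⟩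
  have hev : ∀ᶠ α : ℝ in 𝓝[>] 0, InLp q ((volume : Measure (E n)).prod (yMeas₁ n))
      ((fun z => testQuot α ψ z * ζ z.2) - fun z => -fderiv ℝ ψ z.1 (z.2.1 : E n) * ζ z.2) := by
    filter_upwards [self_mem_nhdsWithin] with α hα
    exact (hI1 α hα).sub hI2
  refine tendsto_nrm_of_rpow hq hev ?_
  have hdom : Integrable (fun z : E n × Y n =>
      (closedBall (0 : E n) R).indicator (fun _ => (2 * C * B) ^ q) z.1)
      ((volume : Measure (E n)).prod (yMeas₁ n)) := by
    have h1 : Integrable ((closedBall (0 : E n) R).indicator (fun _ => (2 * C * B) ^ q))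
        (volume : Measure (E n)) :=
      (integrable_indicator_iff measurableSet_closedBall).2
        (integrableOn_const measure_closedBall_lt_top.ne)
    exact h1.comp_fst (yMeas₁ n)
  have h0 : (0:ℝ) = ∫ _ : E n × Y n, (0:ℝ) ∂((volume : Measure (E n)).prod (yMeas₁ n)) := by simp
  rw [show 𝓝 (0:ℝ) = 𝓝 (∫ _ : E n × Y n, (0:ℝ) ∂((volume : Measure (E n)).prod (yMeas₁ n))) by
    rw [← h0]]
  refine tendsto_integral_filter_of_dominated_convergence _ ?_ ?_ hdom ?_
  · filter_upwards [hev] with α hα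
    exact (hα.1.norm.aemeasurable.pow_const q).aestronglyMeasurable
  · filter_upwards [self_mem_nhdsWithin] with α hα
    filter_upwards [ae_prod_yMeas₁] with z hz
    rw [Real.norm_of_nonneg (by positivity)]
    have h1 := hC α hα z hz
    have h2 := hlim z hz
    have h3 : ‖((fun z : E n × Y n => testQuot α ψ z * ζ z.2) -
        fun z : E n × Y n => -fderiv ℝ ψ z.1 (z.2.1 : E n) * ζ z.2) z‖
        = |testQuot α ψ z + fderiv ℝ ψ z.1 (z.2.1 : E n)| * |ζ z.2| := by
      rw [Pi.sub_apply, ← sub_mul, sub_neg_eq_add, Real.norm_eq_abs, abs_mul]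
    have h4 := abs_add_le (testQuot α ψ z) (fderiv ℝ ψ z.1 (z.2.1 : E n))
    rw [h3]
    by_cases hx : z.1 ∈ closedBall (0 : E n) R
    · rw [Set.indicator_of_mem hx] at h1 h2 ⊢
      refine Real.rpow_le_rpow (by positivity) ?_ hq0.le
      exact mul_le_mul (by linarith) (hB _) (abs_nonneg _) (by positivity)
    · rw [Set.indicator_of_notMem hx] at h1 h2 ⊢
      have h5 : |testQuot α ψ z + fderiv ℝ ψ z.1 (z.2.1 : E n)| = 0 :=
        le_antisymm (by linarith) (abs_nonneg _)
      rw [h5, zero_mul, Real.zero_rpow hq0.ne']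
  · filter_upwards [ae_prod_yMeas₁] with z hz
    have h1 := ((((tendsto_testQuot hψ hz).mul_const (ζ z.2)).sub_const
      (-fderiv ℝ ψ z.1 (z.2.1 : E n) * ζ z.2)).norm).rpow_const (p := q) (Or.inr hq0.le)
    rw [sub_self, norm_zero, Real.zero_rpow hq0.ne'] at h1
    exact h1

lemma InLp.restrict_unit {w : E n × Y n → ℝ} (hw : InLp p (zMeas n) w) :
    InLp p ((volume : Measure (E n)).prod (yMeas₁ n)) w := by
  rw [← zMeas_restrict]
  exact hw.restrict _

lemma inLp_mul_of_hasCompactSupport {ψ : E n → ℝ} (hψ : Continuous ψ)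
    (hc : HasCompactSupport ψ) {ζ : Y n → ℝ} (hζ : Measurable ζ) {B : ℝ} (hB : ∀ y, |ζ y| ≤ B) :
    InLp q ((volume : Measure (E n)).prod (yMeas₁ n)) (fun z => ψ z.1 * ζ z.2) := by
  have h1 : InLp q (volume : Measure (E n)) ψ := hψ.memLp_of_hasCompactSupport hc
  have h2 : InLp q ((volume : Measure (E n)).prod (yMeas₁ n)) (fun z => ψ z.1) :=
    h1.comp_fst (yMeas₁ n)
  have h3 := InLp.bdd_mul_left (k := fun z : E n × Y n => ζ z.2) (B := B)
    (hζ.comp measurable_snd).aestronglyMeasurable (ae_of_all _ fun z => hB z.2) h2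
  exact h3.ae_eq (ae_of_all _ fun z => mul_comm _ _)

/-- Discrete integration by parts. -/
lemma integral_dq_mul_test (hpq : p.HolderConjugate q) (hα : 0 < α) {w : E n → ℝ}
    (hw : InLp p volume w) (hdw : InLp p (zMeas n) (dq α w)) {ψ : E n → ℝ}
    (hψ : ContDiff ℝ ∞ ψ)
    (hc : HasCompactSupport ψ) {ζ : Y n → ℝ} (hζ : Measurable ζ) {B : ℝ}
    (hB : ∀ y, |ζ y| ≤ B) :
    ∫ z, dq α w z * (ψ z.1 * ζ z.2) ∂((volume : Measure (E n)).prod (yMeas₁ n))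
      = ∫ z, w z.1 * (testQuot α ψ z * ζ z.2) ∂((volume : Measure (E n)).prod (yMeas₁ n)) := by
  have hq := hpq.symm.lt
  have hw1 : InLp p ((volume : Measure (E n)).prod (yMeas₁ n)) (fun z => w z.1) :=
    hw.comp_fst (yMeas₁ n)
  have i1 := integrable_mul_of_inLp hpq (InLp.restrict_unit hdw)
    (inLp_mul_of_hasCompactSupport hψ.continuous hc hζ hB)
  have i2 := integrable_mul_of_inLp hpq hw1 ((tendsto_nrm_testQuot hq hψ hc hζ hB).1 α hα)
  rw [integral_prod_symm _ i1, integral_prod_symm _ i2]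
  refine integral_congr_ae (ae_of_all _ fun y => ?_)
  have hψq : InLp q (volume : Measure (E n)) ψ := hψ.continuous.memLp_of_hasCompactSupport hc
  have hwt := inLp_translate hw (hvec α y)
  have j1 := integrable_mul_of_inLp hpq hw hψq
  have j2 := integrable_mul_of_inLp hpq hwt hψq
  have hψt : InLp q (volume : Measure (E n)) (fun x => ψ (x + hvec α y)) := by
    have := inLp_translate hψq (-hvec α y)
    simpa only [sub_neg_eq_add] using this
  have j3 := integrable_mul_of_inLp hpq hw hψt
  -- For a fixed step, moving the difference onto `ψ` is translation invariance; this is why the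
  -- test quotient looks forward while `dq` looks backward.
  have htr : ∫ x, w (x - hvec α y) * ψ x = ∫ x, w x * ψ (x + hvec α y) := by
    rw [← integral_sub_right_eq_self (fun x => w x * ψ (x + hvec α y)) (hvec α y)]
    simp only [sub_add_cancel]
  calc ∫ x, dq α w (x, y) * (ψ x * ζ y)
      = ∫ x, (ζ y / rad α y) * (w x * ψ x - w (x - hvec α y) * ψ x) := by
        refine integral_congr_ae (ae_of_all _ fun x => ?_)
        simp only [dq]
        ring
    _ = ∫ x, (ζ y / rad α y) * (w x * ψ x - w x * ψ (x + hvec α y)) := by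
        rw [integral_const_mul, integral_const_mul, integral_sub j1 j2, integral_sub j1 j3, htr]
    _ = _ := by
        refine integral_congr_ae (ae_of_all _ fun x => ?_)
        simp only [testQuot]
        ring

end WeakLimits

/-! ### Identification of weak limits -/

section Identification

set_option linter.unusedSectionVars false

variable {n : ℕ} [NeZero n] {α p q : ℝ}

lemma measurable_dirY : Measurable (fun y : Y n => (y.1 : E n)) :=
  measurable_subtype_coe.comp measurable_fst

/-- Integration against `yMeas₁` of functions of the direction. -/
lemma integral_yMeas₁_fst {F : Type*} [NormedAddCommGroup F] [NormedSpace ℝ F]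
    (k : sphere (0 : E n) 1 → F) :
    ∫ y, k y.1 ∂(yMeas₁ n) = ∫ θ, k θ ∂(volume : Measure (E n)).toSphere := by
  have h1 : yMeas₁ n = (volume : Measure (E n)).toSphere.prod unitMeas := by
    rw [yMeas₁, yMeas, unitY, ← Measure.prod_restrict, Measure.restrict_univ,
      Measure.restrict_restrict measurableSet_Ioo, unitMeas]
    congr 2
    exact Set.inter_eq_left.2 fun t ht => ht.1
  rw [h1, integral_fun_fst]
  simp

lemma integrable_weight_dir {ζ : Y n → ℝ} (hζ : Measurable ζ) {B : ℝ} (hB : ∀ y, |ζ y| ≤ B) :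
    Integrable (fun y => ζ y • (y.1 : E n)) (yMeas₁ n) := by
  refine Integrable.of_bound (hζ.smul measurable_dirY).aestronglyMeasurable B
    (ae_of_all _ fun y => ?_)
  rw [norm_smul, norm_sphere, mul_one]
  exact hB y

lemma abs_inner_dir_le (e : E n) (y : Y n) : |inner ℝ (y.1 : E n) e| ≤ ‖e‖ := by
  have := abs_real_inner_le_norm (y.1 : E n) e
  rwa [norm_sphere, one_mul] at this

lemma measurable_inner_dir (e : E n) : Measurable (fun y : Y n => inner ℝ (y.1 : E n) e) :=
  measurable_dirY.inner measurable_const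

/-- The second moment of the sphere. -/
def moment (n : ℕ) [NeZero n] : E n →ₗ[ℝ] E n where
  toFun e := ∫ y, (inner ℝ (y.1 : E n) e : ℝ) • (y.1 : E n) ∂(yMeas₁ n)
  map_add' e₁ e₂ := by
    rw [← integral_add (integrable_weight_dir (measurable_inner_dir e₁) (abs_inner_dir_le e₁))
      (integrable_weight_dir (measurable_inner_dir e₂) (abs_inner_dir_le e₂))]
    refine integral_congr_ae (ae_of_all _ fun y => ?_)
    simp only [inner_add_right, add_smul]
  map_smul' c e := by
    rw [RingHom.id_apply, ← integral_smul]
    refine integral_congr_ae (ae_of_all _ fun y => ?_)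
    simp only [inner_smul_right, smul_smul]

/-- Pairing the second moment of `e` with `e` gives the integral of `⟨ω, e⟩²`. If it vanishes,
continuity forces `⟨ω, e⟩ = 0` on the whole sphere, in particular at `e / ‖e‖`. -/
lemma moment_injective : Function.Injective (moment n) := by
  refine (injective_iff_map_eq_zero _).2 fun e he => ?_
  have h1 : ∫ y, (inner ℝ (y.1 : E n) e : ℝ) * inner ℝ (y.1 : E n) e ∂(yMeas₁ n) = 0 := by
    have h2 := integral_inner (𝕜 := ℝ)
      (integrable_weight_dir (measurable_inner_dir e) (abs_inner_dir_le e)) e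
    have h3 : ∫ y, (inner ℝ (y.1 : E n) e : ℝ) • (y.1 : E n) ∂(yMeas₁ n) = 0 := he
    rw [h3, inner_zero_right] at h2
    rw [← h2]
    refine integral_congr_ae (ae_of_all _ fun y => ?_)
    simp only [inner_smul_right, real_inner_comm e]
  rw [integral_yMeas₁_fst (fun θ : sphere (0 : E n) 1 => (inner ℝ (θ : E n) e : ℝ) * inner ℝ (θ : E n) e)] at h1
  have hcont : Continuous fun θ : sphere (0 : E n) 1 =>
      (inner ℝ (θ : E n) e : ℝ) * inner ℝ (θ : E n) e := by fun_prop
  have h4 := (integral_eq_zero_iff_of_nonneg (fun θ => mul_self_nonneg _)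
    (hcont.integrable_of_hasCompactSupport (HasCompactSupport.of_compactSpace _))).1 h1
  have h5 := Continuous.ae_eq_iff_eq _ hcont continuous_const |>.1 h4
  by_contra hne
  have hn : 0 < ‖e‖ := norm_pos_iff.2 hne
  have h6 := congrFun h5 ⟨‖e‖⁻¹ • e, by
    rw [mem_sphere_zero_iff_norm, norm_smul, norm_inv, norm_norm, inv_mul_cancel₀ hn.ne']⟩
  simp only [inner_smul_left, real_inner_self_eq_norm_sq] at h6
  have h7 := mul_self_eq_zero.1 h6
  simp [hne] at h7

/-- An injective endomorphism in finite dimension is onto. Such weights extract the derivative in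
direction `e` from directional data by averaging over directions. -/
lemma exists_weight (e : E n) : ∃ (ζ : Y n → ℝ) (B : ℝ), Measurable ζ ∧ (∀ y, |ζ y| ≤ B) ∧
    ∫ y, ζ y • (y.1 : E n) ∂(yMeas₁ n) = e := by
  obtain ⟨e', he'⟩ := LinearMap.surjective_of_injective (moment_injective (n := n)) e
  exact ⟨_, _, measurable_inner_dir e', abs_inner_dir_le e', he'⟩

lemma inLp_weighted_average (hpq : p.HolderConjugate q) {G : E n × Y n → ℝ}
    (hG : InLp p ((volume : Measure (E n)).prod (yMeas₁ n)) G) {ζ : Y n → ℝ}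
    (hζ : Measurable ζ) {B : ℝ} (hB : ∀ y, |ζ y| ≤ B) :
    InLp p volume (fun x => ∫ y, ζ y * G (x, y) ∂(yMeas₁ n)) :=
  (inLp_average hpq (InLp.bdd_mul_left (k := fun z : E n × Y n => ζ z.2) (B := B)
    (hζ.comp measurable_snd).aestronglyMeasurable (ae_of_all _ fun z => hB z.2) hG)).1

lemma inLp_fderiv_apply {ψ : E n → ℝ} (hψ : ContDiff ℝ ∞ ψ) (hc : HasCompactSupport ψ)
    (e : E n) : InLp q (volume : Measure (E n)) (fun x => fderiv ℝ ψ x e) :=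
  ((hψ.continuous_fderiv (by simp)).clm_apply continuous_const).memLp_of_hasCompactSupport
    (hc.fderiv_apply (𝕜 := ℝ) e)

/-- Averaging over directions with weight `ζ` leaves a derivative in the single direction `∫ ζ ω`.
With weights of prescribed moment this constructs the gradient; with indicator weights it identifies
`G`. -/
lemma integral_weighted_average (hpq : p.HolderConjugate q) {u : E n → ℝ}
    (hu : InLp p volume u) {G : E n × Y n → ℝ}
    (hG : InLp p ((volume : Measure (E n)).prod (yMeas₁ n)) G) {ζ : Y n → ℝ}
    (hζ : Measurable ζ) {B : ℝ} (hB : ∀ y, |ζ y| ≤ B) {ψ : E n → ℝ} (hψ : ContDiff ℝ ∞ ψ)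
    (hc : HasCompactSupport ψ)
    (h : ∫ z, G z * (ψ z.1 * ζ z.2) ∂((volume : Measure (E n)).prod (yMeas₁ n))
      = ∫ z, u z.1 * (-fderiv ℝ ψ z.1 (z.2.1 : E n) * ζ z.2)
        ∂((volume : Measure (E n)).prod (yMeas₁ n))) :
    ∫ x, (∫ y, ζ y * G (x, y) ∂(yMeas₁ n)) * ψ x
      = - ∫ x, u x * fderiv ℝ ψ x (∫ y, ζ y • (y.1 : E n) ∂(yMeas₁ n)) := by
  have hq := hpq.symm.lt
  have hu1 : InLp p ((volume : Measure (E n)).prod (yMeas₁ n)) (fun z => u z.1) :=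
    hu.comp_fst (yMeas₁ n)
  have i1 := integrable_mul_of_inLp hpq hG
    (inLp_mul_of_hasCompactSupport (q := q) hψ.continuous hc hζ hB)
  have i2 := integrable_mul_of_inLp hpq hu1 (tendsto_nrm_testQuot hq hψ hc hζ hB).2.1
  rw [integral_prod _ i1, integral_prod _ i2] at h
  rw [← integral_neg]
  convert h using 1
  · refine integral_congr_ae (ae_of_all _ fun x => ?_)
    simp only
    rw [← integral_mul_const]
    refine integral_congr_ae (ae_of_all _ fun y => ?_)
    simp only
    ring
  · refine integral_congr_ae (ae_of_all _ fun x => ?_)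
    simp only
    rw [← ContinuousLinearMap.integral_comp_comm _ (integrable_weight_dir hζ hB),
      ← integral_const_mul, ← integral_neg]
    refine integral_congr_ae (ae_of_all _ fun y => ?_)
    simp only [map_smul, smul_eq_mul]
    ring

lemma locallyIntegrable_of_inLp (hp : 1 < p) {u : E n → ℝ} (hu : InLp p volume u) :
    LocallyIntegrable u volume := MemLp.locallyIntegrable hu (one_le_ofReal hp)

/-- A pair satisfying the limit form of discrete integration by parts consists of a Sobolev
function and its directional derivatives. -/
theorem exists_gradient (hpq : p.HolderConjugate q) {u : E n → ℝ}
    (hu : InLp p volume u) {G : E n × Y n → ℝ}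
    (hG : InLp p ((volume : Measure (E n)).prod (yMeas₁ n)) G)
    (h : ∀ ψ : E n → ℝ, ContDiff ℝ ∞ ψ → HasCompactSupport ψ → ∀ ζ : Y n → ℝ, Measurable ζ →
      ∀ B : ℝ, (∀ y, |ζ y| ≤ B) →
      ∫ z, G z * (ψ z.1 * ζ z.2) ∂((volume : Measure (E n)).prod (yMeas₁ n))
      = ∫ z, u z.1 * (-fderiv ℝ ψ z.1 (z.2.1 : E n) * ζ z.2)
        ∂((volume : Measure (E n)).prod (yMeas₁ n))) :
    ∃ g, IsSobolevWith p u g ∧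
      G =ᵐ[(volume : Measure (E n)).prod (yMeas₁ n)] fun z => inner ℝ (g z.1) (z.2.1 : E n) := by
  have hp := hpq.lt
  let b := EuclideanSpace.basisFun (Fin n) ℝ
  choose ζ B hζ hB hζb using fun i => exists_weight (b i)
  have hH : ∀ i, InLp p volume (fun x => ∫ y, ζ i y * G (x, y) ∂(yMeas₁ n)) := fun i =>
    inLp_weighted_average hpq hG (hζ i) (hB i)
  -- The weights have the basis vectors as first moments, so the averages of `G` are the candidate
  -- partial derivatives.
  let g : E n → E n := fun x => ∑ i, (∫ y, ζ i y * G (x, y) ∂(yMeas₁ n)) • b i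
  have hgi : ∀ x e, inner ℝ (g x) e
      = ∑ i, (∫ y, ζ i y * G (x, y) ∂(yMeas₁ n)) * inner ℝ (b i) e := by
    intro x e
    simp only [g, sum_inner, inner_smul_left]
    rfl
  have hg : InLp p volume g := by
    refine memLp_finsetSum _ fun i _ => ?_
    refine (hH i).of_le_mul (c := ‖b i‖) ((hH i).1.smul_const _) (ae_of_all _ fun x => ?_)
    rw [norm_smul, mul_comm]
  have hweak : HasWeakGradient u g := by
    intro ψ hψ hc e
    have hψq : InLp q (volume : Measure (E n)) ψ := hψ.continuous.memLp_of_hasCompactSupport hc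
    have he : e = ∑ i, (inner ℝ (b i) e : ℝ) • b i := (b.sum_repr' e).symm
    have h1 : ∀ i, ∫ x, (∫ y, ζ i y * G (x, y) ∂(yMeas₁ n)) * ψ x
        = - ∫ x, u x * fderiv ℝ ψ x (b i) := by
      intro i
      rw [integral_weighted_average hpq hu hG (hζ i) (hB i) hψ hc (h ψ hψ hc _ (hζ i) _ (hB i)),
        hζb]
    calc ∫ x, u x * fderiv ℝ ψ x e
        = ∫ x, ∑ i, (inner ℝ (b i) e : ℝ) * (u x * fderiv ℝ ψ x (b i)) := by
          refine integral_congr_ae (ae_of_all _ fun x => ?_)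
          simp only
          conv_lhs => rw [he, map_sum, Finset.mul_sum]
          refine Finset.sum_congr rfl fun i _ => ?_
          rw [map_smul, smul_eq_mul]
          ring
      _ = ∑ i, (inner ℝ (b i) e : ℝ) * ∫ x, u x * fderiv ℝ ψ x (b i) := by
          rw [integral_finsetSum _ fun i _ =>
            (integrable_mul_of_inLp hpq hu (inLp_fderiv_apply hψ hc (b i))).const_mul _]
          simp only [integral_const_mul]
      _ = - ∑ i, (inner ℝ (b i) e : ℝ) * ∫ x, (∫ y, ζ i y * G (x, y) ∂(yMeas₁ n)) * ψ x := by
          rw [← Finset.sum_neg_distrib]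
          refine Finset.sum_congr rfl fun i _ => ?_
          rw [h1 i]
          ring
      _ = - ∫ x, inner ℝ (g x) e * ψ x := by
          congr 1
          simp only [← integral_const_mul]
          rw [← integral_finsetSum _ fun i _ =>
            (integrable_mul_of_inLp hpq (hH i) hψq).const_mul _]
          refine integral_congr_ae (ae_of_all _ fun x => ?_)
          simp only
          rw [hgi, Finset.sum_mul]
          refine Finset.sum_congr rfl fun i _ => ?_
          ring
  refine ⟨g, ⟨hu, hg, hweak⟩, ?_⟩
  have hGg := inLp_inner_dir hg
  have hK := hG.sub hGg
  -- The difference is only known to be in `L^p`, hence integrable on bounded sets; it is cut off to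
  -- balls before being tested on rectangles.
  have hball : ∀ R : ℕ, (Set.indicator (closedBall (0 : E n) R ×ˢ Set.univ)
      (G - fun z => inner ℝ (g z.1) (z.2.1 : E n)))
      =ᵐ[(volume : Measure (E n)).prod (yMeas₁ n)] 0 := by
    intro R
    have hS : MeasurableSet (closedBall (0 : E n) R ×ˢ (Set.univ : Set (Y n))) :=
      measurableSet_closedBall.prod MeasurableSet.univ
    have hSfin : ((volume : Measure (E n)).prod (yMeas₁ n))
        (closedBall (0 : E n) R ×ˢ (Set.univ : Set (Y n))) < ⊤ := by
      rw [Measure.prod_prod]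
      exact ENNReal.mul_lt_top measure_closedBall_lt_top (measure_lt_top _ _)
    have hKi : IntegrableOn (G - fun z => inner ℝ (g z.1) (z.2.1 : E n))
        (closedBall (0 : E n) R ×ˢ (Set.univ : Set (Y n)))
        ((volume : Measure (E n)).prod (yMeas₁ n)) := by
      have : IsFiniteMeasure (((volume : Measure (E n)).prod (yMeas₁ n)).restrict
        (closedBall (0 : E n) R ×ˢ (Set.univ : Set (Y n)))) := ⟨by
          rw [Measure.restrict_apply_univ]; exact hSfin⟩
      exact (hK.restrict _).integrable (one_le_ofReal hp)
    refine ae_eq_zero_of_setIntegral_prod ((integrable_indicator_iff hS).2 hKi) ?_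
    intro A hA D hD
    have hζD : Measurable (D.indicator fun _ => (1:ℝ)) := measurable_const.indicator hD
    have hBD : ∀ y, |D.indicator (fun _ => (1:ℝ)) y| ≤ 1 := by
      intro y
      by_cases hy : y ∈ D <;> simp [hy]
    have hHD := inLp_weighted_average hpq hG hζD hBD
    have hgD := inLp_inner hg (∫ y, D.indicator (fun _ => (1:ℝ)) y • (y.1 : E n) ∂(yMeas₁ n))
    -- With the indicator of `D` as weight, the average of `G` and `⟨g, ∫_D ω⟩` have the same
    -- pairing with every test function, so they agree almost everywhere.
    have hae := ae_eq_of_integral_contDiff_smul_eq (locallyIntegrable_of_inLp hp hHD)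
      (locallyIntegrable_of_inLp hp hgD) fun ψ hψ hc => by
        have h1 := integral_weighted_average hpq hu hG hζD hBD hψ hc (h ψ hψ hc _ hζD _ hBD)
        rw [hweak ψ hψ hc, neg_neg] at h1
        simpa only [smul_eq_mul, mul_comm (ψ _)] using h1
    rw [setIntegral_indicator hS, Set.prod_inter_prod, Set.inter_univ,
      setIntegral_prod _ (hKi.mono_set (Set.prod_mono Set.inter_subset_right (Set.subset_univ _)))]
    have hprod : ∀ᵐ x : E n, Integrable (fun y => G (x, y)) (yMeas₁ n) := by
      have h1 := (integrable_prod_iff (hG.1.norm.aemeasurable.pow_const p).aestronglyMeasurable).1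
        (InLp.integrable_rpow hp hG)
      filter_upwards [h1.1, hG.1.prodMk_left] with x hx hxm
      exact (inLp_of_integrable_rpow hp hxm hx).integrable (one_le_ofReal hp)
    refine integral_eq_zero_of_ae (ae_restrict_of_ae ?_)
    filter_upwards [hae, hprod] with x hx hxi
    have h2 : Integrable (fun y : Y n => inner ℝ (g x) (y.1 : E n)) (yMeas₁ n) := by
      have := (integrable_weight_dir (n := n) (ζ := fun _ => 1) measurable_const (B := 1)
        (by simp)).const_inner (𝕜 := ℝ) (g x)
      simpa only [one_smul] using this
    have h3 : ∫ y in D, inner ℝ (g x) (y.1 : E n) ∂(yMeas₁ n)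
        = ∫ y in D, G (x, y) ∂(yMeas₁ n) := by
      rw [← integral_indicator hD, ← integral_indicator hD]
      rw [← integral_inner (integrable_weight_dir hζD hBD)] at hx
      have e1 : ∀ y : Y n, D.indicator (fun y => (inner ℝ (g x) (y.1 : E n) : ℝ)) y
          = inner ℝ (g x) (D.indicator (fun _ => (1:ℝ)) y • (y.1 : E n)) := by
        intro y
        by_cases hy : y ∈ D <;> simp [hy]
      have e2 : ∀ y : Y n, D.indicator (fun y => G (x, y)) y
          = D.indicator (fun _ => (1:ℝ)) y * G (x, y) := by
        intro y
        by_cases hy : y ∈ D <;> simp [hy]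
      simp only [e1, e2]
      exact hx.symm
    simp only [Pi.sub_apply, Pi.zero_apply]
    rw [integral_sub hxi.integrableOn h2.integrableOn, h3, sub_self]
  filter_upwards [ae_all_iff.2 hball] with z hz
  obtain ⟨R, hR⟩ := exists_nat_ge ‖z.1‖
  have h1 := hz R
  rw [Set.indicator_of_mem (show z ∈ closedBall (0 : E n) R ×ˢ Set.univ from
    ⟨mem_closedBall_zero_iff.2 hR, Set.mem_univ _⟩)] at h1
  exact sub_eq_zero.1 h1

end Identification

/-! ### Weak limits of families of bounded energy -/

section EnergyLimits

set_option linter.unusedSectionVars false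

variable {n : ℕ} [NeZero n] {α p q : ℝ}

lemma integral_mul_indicator_unitY (f k : E n × Y n → ℝ) :
    ∫ z, f z * (Set.univ ×ˢ unitY n).indicator k z ∂(zMeas n)
      = ∫ z, f z * k z ∂((volume : Measure (E n)).prod (yMeas₁ n)) := by
  rw [← zMeas_restrict, ← integral_indicator measurableSet_univ_unitY]
  refine integral_congr_ae (ae_of_all _ fun z => ?_)
  exact (Set.indicator_mul_right (Set.univ ×ˢ unitY n) f k).symm

lemma inLp_indicator_unitY {k : E n × Y n → ℝ}
    (hk : InLp q ((volume : Measure (E n)).prod (yMeas₁ n)) k) :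
    InLp q (zMeas n) ((Set.univ ×ˢ unitY n).indicator k) := by
  refine (memLp_indicator_iff_restrict measurableSet_univ_unitY).2 ?_
  rwa [zMeas_restrict]

lemma nrm_comp_fst_le (hp : 1 < p) {w : E n → ℝ} (hw : InLp p volume w) {B : ℝ}
    (hB : nrm p volume w ≤ B) :
    nrm p ((volume : Measure (E n)).prod (yMeas₁ n)) (fun z => w z.1)
      ≤ ((yMeas₁ n).real Set.univ * B ^ p) ^ p⁻¹ := by
  have hp0 : 0 < p := by linarith
  have h1 := (inLp_prod_of_slices (ν := yMeas₁ n) hp (H := fun z : E n × Y n => w z.1)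
    (hw.comp_fst (yMeas₁ n)).1 (B := B) (ae_of_all _ fun _ => ⟨hw, hB⟩)).2
  have h2 := Real.rpow_le_rpow (Real.rpow_nonneg nrm_nonneg p) h1 (inv_nonneg.2 hp0.le)
  rwa [Real.rpow_rpow_inv nrm_nonneg hp0.ne'] at h2

/-- Testing with `|u|^(p-2) u` restricted to the complement of `Ω` gives zero along the family and
the integral of `|u|^p` over the complement in the limit. -/
lemma ae_zero_of_weak_limit (hpq : p.HolderConjugate q) {Ω : Set (E n)} (hΩ : MeasurableSet Ω)
    {ι : Type*} {l : Filter ι} [l.NeBot] {w : ι → E n → ℝ} {u : E n → ℝ}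
    (hw : ∀ᶠ i in l, ∀ᵐ x : E n, x ∉ Ω → w i x = 0) (hu : InLp p volume u)
    (hlim : ∀ φ, InLp q volume φ → Tendsto (fun i => ∫ x, w i x * φ x) l (𝓝 (∫ x, u x * φ x))) :
    ∀ᵐ x : E n, x ∉ Ω → u x = 0 := by
  have hF : InLp q volume (Ωᶜ.indicator fun x => dpow p (u x)) :=
    (inLp_dpow hpq hu).indicator hΩ.compl
  have h1 : Tendsto (fun i => ∫ x, w i x * Ωᶜ.indicator (fun x => dpow p (u x)) x) l (𝓝 0) := by
    refine tendsto_const_nhds.congr' ?_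
    filter_upwards [hw] with i hi
    symm
    refine integral_eq_zero_of_ae ?_
    filter_upwards [hi] with x hx
    by_cases hxΩ : x ∈ Ω
    · simp [hxΩ]
    · simp [hx hxΩ]
  have h2 := tendsto_nhds_unique (hlim _ hF) h1
  have h3 := (integral_eq_zero_iff_of_nonneg (fun x => ?_)
    (integrable_mul_of_inLp hpq hu hF)).1 h2
  · filter_upwards [h3] with x hx hxΩ
    simp only [Pi.zero_apply] at hx
    rw [Set.indicator_of_mem (show x ∈ Ωᶜ from hxΩ), mul_comm, dpow_mul_self hpq.lt] at hx
    exact abs_eq_zero.1 ((Real.rpow_eq_zero (abs_nonneg _) (by linarith [hpq.lt])).1 hx)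
  · by_cases hxΩ : x ∈ Ω
    · simp [hxΩ]
    · simp only [Pi.zero_apply]
      rw [Set.indicator_of_mem (show x ∈ Ωᶜ from hxΩ), mul_comm, dpow_mul_self hpq.lt]
      positivity

/-- Weak limits of functions with bounded difference quotients are Sobolev functions, and the
difference quotients converge weakly to the directional derivatives. -/
theorem exists_gradient_of_weak_limit (hpq : p.HolderConjugate q) {ι : Type*} {l : Filter ι}
    [l.NeBot] {αs : ι → ℝ} (hα : Tendsto αs l (𝓝[>] 0)) {w : ι → E n → ℝ} {B : ℝ}
    (hw : ∀ᶠ i in l, InLp p volume (w i) ∧ nrm p volume (w i) ≤ B)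
    (hdw : ∀ᶠ i in l, InLp p (zMeas n) (dq (αs i) (w i)))
    {u : E n → ℝ} {G : E n × Y n → ℝ} (hu : InLp p volume u) (hG : InLp p (zMeas n) G)
    (hlim : ∀ φ, InLp q volume φ → Tendsto (fun i => ∫ x, w i x * φ x) l (𝓝 (∫ x, u x * φ x)))
    (hlimG : ∀ F, InLp q (zMeas n) F → Tendsto (fun i => ∫ z, dq (αs i) (w i) z * F z ∂(zMeas n)) l
      (𝓝 (∫ z, G z * F z ∂(zMeas n)))) :
    ∃ g, IsSobolevWith p u g ∧ ∀ F : E n × Y n → ℝ, (∀ z, z.2 ∉ unitY n → F z = 0) →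
      ∫ z, G z * F z ∂(zMeas n) = ∫ z, dqLim g z * F z ∂(zMeas n) := by
  have hp := hpq.lt
  have hq := hpq.symm.lt
  -- Discrete integration by parts passes to the limit: on one side quotients converge weakly
  -- against a fixed test function, on the other `w i` converges weakly against strongly convergent
  -- test quotients.
  obtain ⟨g, hg, hGg⟩ := exists_gradient hpq hu (InLp.restrict_unit hG) (by
    intro ψ hψ hc ζ hζ B' hB'
    obtain ⟨hT1, hT2, hT3⟩ := tendsto_nrm_testQuot hq hψ hc hζ hB'
    have h1 := hlimG _ (inLp_indicator_unitY
      (inLp_mul_of_hasCompactSupport (q := q) hψ.continuous hc hζ hB'))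
    simp only [integral_mul_indicator_unitY] at h1
    have h2 : Tendsto (fun i => ∫ z, w i z.1 * (testQuot (αs i) ψ z * ζ z.2)
        ∂((volume : Measure (E n)).prod (yMeas₁ n))) l
        (𝓝 (∫ z, u z.1 * (-fderiv ℝ ψ z.1 (z.2.1 : E n) * ζ z.2)
        ∂((volume : Measure (E n)).prod (yMeas₁ n)))) := by
      refine tendsto_integral_weak_mul_strong hpq
        (w := fun i (z : E n × Y n) => w i z.1) (w₀ := fun z : E n × Y n => u z.1)
        (ψ := fun i (z : E n × Y n) => testQuot (αs i) ψ z * ζ z.2)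
        (B := ((yMeas₁ n).real Set.univ * B ^ p) ^ p⁻¹) ?_ ?_ ?_ hT2 (hT3.comp hα)
      · filter_upwards [hw] with i hi
        exact ⟨hi.1.comp_fst (yMeas₁ n), nrm_comp_fst_le hp hi.1 hi.2⟩
      · intro φ hφ
        have key : ∀ v : E n → ℝ, InLp p volume v →
            ∫ z, v z.1 * φ z ∂((volume : Measure (E n)).prod (yMeas₁ n))
              = ∫ x, v x * ∫ y, φ (x, y) ∂(yMeas₁ n) := by
          intro v hv
          have hv1 : InLp p ((volume : Measure (E n)).prod (yMeas₁ n)) (fun z => v z.1) :=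
            hv.comp_fst (yMeas₁ n)
          rw [integral_prod _ (integrable_mul_of_inLp hpq hv1 hφ)]
          refine integral_congr_ae (ae_of_all _ fun x => ?_)
          exact integral_const_mul (v x) fun y => φ (x, y)
        rw [key u hu]
        refine (hlim _ (inLp_average hpq.symm hφ).1).congr' ?_
        filter_upwards [hw] with i hi
        exact (key _ hi.1).symm
      · filter_upwards [hα.eventually self_mem_nhdsWithin] with i hi
        exact hT1 _ hi
    refine tendsto_nhds_unique h1 (h2.congr' ?_)
    filter_upwards [hw, hdw, hα.eventually self_mem_nhdsWithin] with i hi hdi hαi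
    exact (integral_dq_mul_test hpq hαi hi.1 hdi hψ hc hζ hB').symm)
  -- The weak limit `G` is identified only on `t < 1`, so the comparison is restricted to `F`
  -- vanishing elsewhere.
  refine ⟨g, hg, fun F hF => ?_⟩
  refine integral_congr_ae ?_
  rw [← zMeas_restrict, EventuallyEq, ae_restrict_iff' measurableSet_univ_unitY] at hGg
  filter_upwards [hGg] with z hz
  by_cases hz2 : z.2 ∈ unitY n
  · rw [hz ⟨Set.mem_univ _, hz2⟩, dqLim, Set.indicator_of_mem hz2]
  · rw [hF z hz2, mul_zero, mul_zero]

end EnergyLimits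

/-! ### The limiting coefficient and the local form -/

section Coefficients

set_option linter.unusedSectionVars false

variable {n : ℕ} [NeZero n] {α p q : ℝ}

lemma tendsto_coef_of_bound {m : E n → E n → ℝ} {a : E n → sphere (0 : E n) 1 → ℝ} {x : E n}
    (hx : ∃ C : ℝ, ∀ᶠ r : ℝ in 𝓝[>] 0,
      ∀ θ : sphere (0 : E n) 1, |m x (r • (θ : E n)) - a x θ| ≤ C * r) {y : Y n}
    (hy : y ∈ unitY n) : Tendsto (fun α => coef m α (x, y)) (𝓝[>] 0) (𝓝 (a x y.1)) := by
  obtain ⟨C, hC⟩ := hx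
  have hr : Tendsto (fun α => rad α y) (𝓝[>] 0) (𝓝[>] 0) :=
    tendsto_nhdsWithin_iff.2 ⟨tendsto_rad_zero hy, Eventually.of_forall fun α => rad_pos hy.2.1⟩
  rw [tendsto_iff_dist_tendsto_zero]
  have h0 : Tendsto (fun α => C * rad α y) (𝓝[>] 0) (𝓝 0) := by
    simpa using (tendsto_rad_zero hy).const_mul C
  refine squeeze_zero' (Eventually.of_forall fun _ => dist_nonneg) ?_ h0
  filter_upwards [hr.eventually hC] with α hα
  rw [Real.dist_eq]
  exact hα y.1

/-- The limit of the coefficients, extended by a constant to radii larger than one. -/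
def coefLim {n : ℕ} (c : ℝ) (a : E n → sphere (0 : E n) 1 → ℝ) (z : E n × Y n) : ℝ :=
  c + (unitY n).indicator (fun y => a z.1 y.1 - c) z.2

lemma coefLim_of_mem {c : ℝ} {a : E n → sphere (0 : E n) 1 → ℝ} {z : E n × Y n}
    (hz : z.2 ∈ unitY n) : coefLim c a z = a z.1 z.2.1 := by
  rw [coefLim, Set.indicator_of_mem hz, add_sub_cancel]

lemma coefLim_of_notMem {c : ℝ} {a : E n → sphere (0 : E n) 1 → ℝ} {z : E n × Y n}
    (hz : z.2 ∉ unitY n) : coefLim c a z = c := by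
  rw [coefLim, Set.indicator_of_notMem hz, add_zero]

variable {m : E n → E n → ℝ} {mlo mhi : ℝ} {a : E n → sphere (0 : E n) 1 → ℝ}

lemma ae_tendsto_coef (hH3 : ∀ᵐ x : E n, ∃ C : ℝ, ∀ᶠ r : ℝ in 𝓝[>] 0,
      ∀ θ : sphere (0 : E n) 1, |m x (r • (θ : E n)) - a x θ| ≤ C * r) :
    ∀ᵐ z ∂(zMeas n), z.2 ∈ unitY n →
      Tendsto (fun α => coef m α z) (𝓝[>] 0) (𝓝 (coefLim mlo a z)) := by
  filter_upwards [quasiMeasurePreserving_fst_zMeas.ae hH3] with z hz hz2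
  rw [coefLim_of_mem hz2]
  exact tendsto_coef_of_bound hz hz2

lemma tendsto_inv_nat_nhdsGT : Tendsto (fun k : ℕ => ((k : ℝ) + 1)⁻¹) atTop (𝓝[>] 0) := by
  refine tendsto_nhdsWithin_iff.2 ⟨?_, Eventually.of_forall fun k => ?_⟩
  · exact (tendsto_one_div_add_atTop_nhds_zero_nat (𝕜 := ℝ)).congr fun k => one_div _
  · exact Set.mem_Ioi.2 (by positivity)

/-- Measurability of `a` is not given; it is inherited from `m` as an almost everywhere limit along
`α = 1/(k+1)`. -/
lemma aestronglyMeasurable_coefLim (hm : Measurable (Function.uncurry m))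
    (hH3 : ∀ᵐ x : E n, ∃ C : ℝ, ∀ᶠ r : ℝ in 𝓝[>] 0,
      ∀ θ : sphere (0 : E n) 1, |m x (r • (θ : E n)) - a x θ| ≤ C * r) :
    AEStronglyMeasurable (coefLim mlo a) (zMeas n) := by
  refine aestronglyMeasurable_of_tendsto_ae atTop (f := fun (k : ℕ) (z : E n × Y n) =>
    mlo + (Set.univ ×ˢ unitY n).indicator (fun z => coef m ((k : ℝ) + 1)⁻¹ z - mlo) z)
    (fun k => (measurable_const.add (((measurable_coef hm).sub_const mlo).indicator
      measurableSet_univ_unitY)).aestronglyMeasurable) ?_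
  filter_upwards [ae_tendsto_coef (mlo := mlo) hH3] with z hz
  by_cases hz2 : z.2 ∈ unitY n
  · refine ((hz hz2).comp tendsto_inv_nat_nhdsGT).congr fun k => ?_
    rw [Set.indicator_of_mem (show z ∈ Set.univ ×ˢ unitY n from ⟨Set.mem_univ _, hz2⟩),
      add_sub_cancel]
    rfl
  · rw [coefLim_of_notMem hz2]
    refine tendsto_const_nhds.congr fun k => ?_
    rw [Set.indicator_of_notMem (fun h : z ∈ Set.univ ×ˢ unitY n => hz2 h.2), add_zero]

/-- The bounds on `m` pass to the limit on `t < 1`. Extending by `mlo` rather than by zero keeps the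
weight bounded below on all of `zMeas`, as strong monotonicity requires. -/
lemma coefLim_bounds (hH1 : ∀ᵐ z : E n × E n, mlo ≤ m z.1 z.2 ∧ m z.1 z.2 ≤ mhi)
    (hH3 : ∀ᵐ x : E n, ∃ C : ℝ, ∀ᶠ r : ℝ in 𝓝[>] 0,
      ∀ θ : sphere (0 : E n) 1, |m x (r • (θ : E n)) - a x θ| ≤ C * r) :
    ∀ᵐ z ∂(zMeas n), mlo ≤ coefLim mlo a z ∧ coefLim mlo a z ≤ mhi := by
  have h1 : ∀ k : ℕ, ∀ᵐ z ∂(zMeas n), mlo ≤ coef m ((k : ℝ) + 1)⁻¹ z ∧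
      coef m ((k : ℝ) + 1)⁻¹ z ≤ mhi := fun k => coef_bounds (by positivity) hH1
  filter_upwards [ae_tendsto_coef (mlo := mlo) hH3, ae_all_iff.2 h1] with z hz hz1
  by_cases hz2 : z.2 ∈ unitY n
  · have h2 := (hz hz2).comp tendsto_inv_nat_nhdsGT
    exact ⟨ge_of_tendsto' h2 fun k => (hz1 k).1, le_of_tendsto' h2 fun k => (hz1 k).2⟩
  · rw [coefLim_of_notMem hz2]
    exact ⟨le_rfl, (hz1 0).1.trans (hz1 0).2⟩

/-- Strong convergence of the fluxes of Sobolev functions. -/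
lemma tendsto_flux (hpq : p.HolderConjugate q) (hm : Measurable (Function.uncurry m))
    (hmlo : 0 < mlo) (hH1 : ∀ᵐ z : E n × E n, mlo ≤ m z.1 z.2 ∧ m z.1 z.2 ≤ mhi)
    (hH3 : ∀ᵐ x : E n, ∃ C : ℝ, ∀ᶠ r : ℝ in 𝓝[>] 0,
      ∀ θ : sphere (0 : E n) 1, |m x (r • (θ : E n)) - a x θ| ≤ C * r)
    {v : E n → ℝ} {g : E n → E n} (hv : IsSobolevWith p v g) :
    (∀ᶠ α in 𝓝[>] (0:ℝ), InLp q (zMeas n) (fun z => coef m α z * dpow p (dq α v z))) ∧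
    InLp q (zMeas n) (fun z => coefLim mlo a z * dpow p (dqLim g z)) ∧
    Tendsto (fun α => nrm q (zMeas n) ((fun z => coef m α z * dpow p (dq α v z)) -
      fun z => coefLim mlo a z * dpow p (dqLim g z))) (𝓝[>] 0) (𝓝 0) := by
  have hp := hpq.lt
  have hq := hpq.symm.lt
  have hq0 : 0 < q := by linarith
  have hbl := coefLim_bounds hH1 hH3
  have habsl : ∀ᵐ z ∂(zMeas n), |coefLim mlo a z| ≤ mhi := by
    filter_upwards [hbl] with z hz
    rw [abs_of_pos (hmlo.trans_le hz.1)]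
    exact hz.2
  have hml := aestronglyMeasurable_coefLim (mlo := mlo) hm hH3
  have hsmall : ∀ᶠ α : ℝ in 𝓝[>] 0, 0 < α ∧ α < p := Ioo_mem_nhdsGT (by linarith)
  have hdqv : ∀ᶠ α : ℝ in 𝓝[>] 0, InLp p (zMeas n) (dq α v) := by
    filter_upwards [hsmall] with α hα
    exact inLp_dq hpq hv hα.1 hα.2
  have hD : InLp q (zMeas n) (fun z => dpow p (dqLim g z)) := inLp_dpow hpq (inLp_dqLim hv.2.1)
  have hI1 : ∀ᶠ α : ℝ in 𝓝[>] 0, InLp q (zMeas n) (fun z => coef m α z * dpow p (dq α v z)) := by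
    filter_upwards [hsmall, hdqv] with α hα hdα
    exact InLp.bdd_mul_left (measurable_coef hm).aestronglyMeasurable
      (coef_abs_le hα.1 hmlo hH1) (inLp_dpow hpq hdα)
  have hI2 : InLp q (zMeas n) (fun z => coefLim mlo a z * dpow p (dqLim g z)) :=
    InLp.bdd_mul_left hml habsl hD
  refine ⟨hI1, hI2, ?_⟩
  have hmhi : 0 ≤ mhi := by
    obtain ⟨z, hz⟩ := hH1.exists
    linarith
  have hT1 := tendsto_dpow hpq hdqv (inLp_dqLim hv.2.1) (tendsto_dq hpq hv)
  have hJ : ∀ᶠ α : ℝ in 𝓝[>] 0, InLp q (zMeas n)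
      (fun z => (coef m α z - coefLim mlo a z) * dpow p (dqLim g z)) ∧
      ∀ᵐ z ∂(zMeas n), |coef m α z - coefLim mlo a z| ≤ 2 * mhi := by
    filter_upwards [hsmall] with α hα
    have hb : ∀ᵐ z ∂(zMeas n), |coef m α z - coefLim mlo a z| ≤ 2 * mhi := by
      filter_upwards [coef_abs_le hα.1 hmlo hH1, habsl] with z h1 h2
      exact (abs_sub _ _).trans (by linarith)
    exact ⟨InLp.bdd_mul_left ((measurable_coef hm).aestronglyMeasurable.sub hml) hb hD, hb⟩
  have hT2 : Tendsto (fun α => nrm q (zMeas n)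
      (fun z => (coef m α z - coefLim mlo a z) * dpow p (dqLim g z))) (𝓝[>] 0) (𝓝 0) := by
    refine tendsto_nrm_of_rpow hq (hJ.mono fun _ h => h.1) ?_
    rw [show 𝓝 (0:ℝ) = 𝓝 (∫ _ : E n × Y n, (0:ℝ) ∂(zMeas n)) by simp]
    refine tendsto_integral_filter_of_dominated_convergence
      (fun z => (2 * mhi) ^ q * ‖dpow p (dqLim g z)‖ ^ q) ?_ ?_
      ((InLp.integrable_rpow hq hD).const_mul _) ?_
    · filter_upwards [hJ] with α hα
      exact (hα.1.1.norm.aemeasurable.pow_const q).aestronglyMeasurable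
    · filter_upwards [hJ] with α hα
      filter_upwards [hα.2] with z hz
      rw [Real.norm_of_nonneg (by positivity), norm_mul, Real.mul_rpow (norm_nonneg _)
        (norm_nonneg _)]
      exact mul_le_mul_of_nonneg_right (Real.rpow_le_rpow (norm_nonneg _) hz hq0.le)
        (by positivity)
    · filter_upwards [ae_tendsto_coef (mlo := mlo) hH3] with z hz
      by_cases hz2 : z.2 ∈ unitY n
      · have h1 := ((((hz hz2).sub_const (coefLim mlo a z)).mul_const
          (dpow p (dqLim g z))).norm).rpow_const (p := q) (Or.inr hq0.le)
        rwa [sub_self, zero_mul, norm_zero, Real.zero_rpow hq0.ne'] at h1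
      -- Outside `unitY` the coefficients need not converge, but the limiting quotient vanishes
      -- there.
      · have h1 : dqLim g z = 0 := Set.indicator_of_notMem hz2 _
        simp only [h1, dpow_zero, mul_zero, norm_zero, Real.zero_rpow hq0.ne']
        exact tendsto_const_nhds
  have hsum := (hT1.const_mul mhi).add hT2
  rw [mul_zero, zero_add] at hsum
  refine squeeze_zero' (Eventually.of_forall fun _ => nrm_nonneg) ?_ hsum
  filter_upwards [hsmall, hdqv, hJ] with α hα hdα hJα
  have hdiff := (inLp_dpow hpq hdα).sub hD
  -- The error splits into convergence of quotients under a bounded weight and convergence of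
  -- weights against a fixed function.
  have e1 : ((fun z => coef m α z * dpow p (dq α v z)) -
      fun z => coefLim mlo a z * dpow p (dqLim g z))
      = (fun z => coef m α z * ((fun z => dpow p (dq α v z)) - fun z => dpow p (dqLim g z)) z) +
        fun z => (coef m α z - coefLim mlo a z) * dpow p (dqLim g z) := by
    funext z
    simp only [Pi.sub_apply, Pi.add_apply]
    ring
  rw [e1]
  have hb := coef_abs_le (α := α) hα.1 hmlo hH1
  have hI := InLp.bdd_mul_left (measurable_coef hm).aestronglyMeasurable hb hdiff
  exact (nrm_add_le hq hI hJα.1).trans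
    (add_le_add (nrm_bdd_mul_le hmhi hb hdiff) le_rfl)

/-- Differentiation of the surface tension under the integral sign. -/
lemma hasFDerivAt_density_integral (hp : 1 < p) {k : Y n → ℝ} {M : ℝ}
    (hk : AEStronglyMeasurable k (yMeas₁ n)) (hM : ∀ᵐ y ∂(yMeas₁ n), |k y| ≤ M) (ξ : E n) :
    HasFDerivAt (fun ξ : E n => ∫ y, k y * (|inner ℝ ξ (y.1 : E n)| ^ p / p) ∂(yMeas₁ n))
      (∫ y, (k y * dpow p (inner ℝ ξ (y.1 : E n))) • innerSL ℝ (y.1 : E n) ∂(yMeas₁ n)) ξ := by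
  have hp0 : 0 < p := by linarith
  have hmeas : ∀ (φ : ℝ → ℝ), Continuous φ → ∀ ξ : E n, AEStronglyMeasurable
      (fun y : Y n => k y * φ (inner ℝ ξ (y.1 : E n))) (yMeas₁ n) := fun φ hφ ξ =>
    hk.mul (hφ.measurable.comp (measurable_const.inner measurable_dirY)).aestronglyMeasurable
  have hin : ∀ (ξ : E n) (y : Y n), |inner ℝ ξ (y.1 : E n)| ≤ ‖ξ‖ := by
    intro ξ y
    rw [real_inner_comm]
    exact abs_inner_dir_le ξ y
  refine hasFDerivAt_integral_of_dominated_of_fderiv_le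
    (F := fun (ξ : E n) (y : Y n) => k y * (|inner ℝ ξ (y.1 : E n)| ^ p / p))
    (F' := fun (ξ : E n) (y : Y n) =>
      (k y * dpow p (inner ℝ ξ (y.1 : E n))) • innerSL ℝ (y.1 : E n))
    (bound := fun _ => M * (‖ξ‖ + 1) ^ (p - 1)) (s := ball ξ 1) (ball_mem_nhds _ one_pos) ?_ ?_ ?_
    ?_ (integrable_const _) ?_
  · exact Eventually.of_forall fun η =>
      hmeas (fun t => |t| ^ p / p) ((continuous_abs_rpow hp).div_const p) η
  · refine Integrable.of_bound (hmeas (fun t => |t| ^ p / p)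
      ((continuous_abs_rpow hp).div_const p) ξ) (M * (‖ξ‖ ^ p / p)) ?_
    filter_upwards [hM] with y hy
    rw [norm_mul, Real.norm_eq_abs, Real.norm_of_nonneg (by positivity)]
    refine mul_le_mul hy ?_ (by positivity) ((abs_nonneg _).trans hy)
    gcongr
    exact hin ξ y
  · refine (hmeas _ (continuous_dpow hp) ξ).smul ?_
    exact ((innerSL ℝ (E := E n)).continuous.measurable.comp measurable_dirY).aestronglyMeasurable
  · filter_upwards [hM] with y hy η hη
    rw [norm_smul, innerSL_apply_norm, norm_sphere, mul_one, norm_mul, Real.norm_eq_abs,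
      Real.norm_eq_abs, abs_dpow hp]
    refine mul_le_mul hy ?_ (by positivity) ((abs_nonneg _).trans hy)
    refine Real.rpow_le_rpow (abs_nonneg _) ((hin η y).trans ?_) (by linarith)
    have := norm_le_norm_add_norm_sub' η ξ
    rw [mem_ball, dist_eq_norm] at hη
    linarith
  · refine ae_of_all _ fun y η _ => ?_
    have h1 : HasFDerivAt (fun ξ : E n => (inner ℝ ξ (y.1 : E n) : ℝ)) (innerSL ℝ (y.1 : E n)) η := by
      have h0 : (fun ξ : E n => (inner ℝ ξ (y.1 : E n) : ℝ)) = innerSL ℝ (y.1 : E n) := by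
        funext ξ
        rw [innerSL_apply_apply, real_inner_comm]
      rw [h0]
      exact (innerSL ℝ (y.1 : E n)).hasFDerivAt
    have h2 := ((hasDerivAt_abs_rpow_div hp (inner ℝ η (y.1 : E n))).comp_hasFDerivAt η h1).const_mul
      (k y)
    rw [smul_smul] at h2
    exact h2

/-- The sphere integral is lifted to `yMeas₁`, whose extra variable ranges over an interval of
length one. The factor `1/p` in the density cancels the `p` from differentiating the power. -/
lemma inner_gradient_density (hp : 1 < p) {x : E n} {M : ℝ}
    (hk : AEStronglyMeasurable (fun y : Y n => a x y.1) (yMeas₁ n))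
    (hM : ∀ᵐ y ∂(yMeas₁ n), |a x y.1| ≤ M) (ξ η : E n) :
    inner ℝ (gradient (density p a x) ξ) η
      = ∫ y, a x y.1 * (dpow p (inner ℝ ξ (y.1 : E n)) * inner ℝ η (y.1 : E n)) ∂(yMeas₁ n) := by
  have h1 := hasFDerivAt_density_integral hp hk hM ξ
  have h2 : density p a x = fun ξ : E n =>
      ∫ y, a x y.1 * (|inner ℝ ξ (y.1 : E n)| ^ p / p) ∂(yMeas₁ n) := by
    funext ξ
    rw [density, integral_yMeas₁_fst (fun θ : sphere (0 : E n) 1 =>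
      a x θ * (|inner ℝ ξ (θ : E n)| ^ p / p)), ← integral_const_mul]
    refine integral_congr_ae (ae_of_all _ fun θ => ?_)
    simp only
    ring
  rw [← h2] at h1
  have h3 : inner ℝ (gradient (density p a x) ξ) η = fderiv ℝ (density p a x) ξ η := by
    rw [gradient, InnerProductSpace.toDual_symm_apply]
  rw [h3, h1.fderiv]
  have hint : Integrable (fun y : Y n =>
      (a x y.1 * dpow p (inner ℝ ξ (y.1 : E n))) • innerSL ℝ (y.1 : E n)) (yMeas₁ n) := by
    refine Integrable.of_bound (C := M * ‖ξ‖ ^ (p - 1)) ?_ ?_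
    · refine (hk.mul ((continuous_dpow hp).measurable.comp
        (measurable_const.inner measurable_dirY)).aestronglyMeasurable).smul ?_
      exact ((innerSL ℝ (E := E n)).continuous.measurable.comp measurable_dirY).aestronglyMeasurable
    · filter_upwards [hM] with y hy
      rw [norm_smul, innerSL_apply_norm, norm_sphere, mul_one, norm_mul, Real.norm_eq_abs,
        Real.norm_eq_abs, abs_dpow hp]
      refine mul_le_mul hy ?_ (by positivity) ((abs_nonneg _).trans hy)
      refine Real.rpow_le_rpow (abs_nonneg _) ?_ (by linarith)
      rw [real_inner_comm]
      exact abs_inner_dir_le ξ y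
  rw [ContinuousLinearMap.integral_apply hint]
  refine integral_congr_ae (ae_of_all _ fun y => ?_)
  simp only [smul_apply, innerSL_apply_apply, smul_eq_mul,
    real_inner_comm η, mul_assoc]

/-- The local form as an integral over `E n × Y n`. -/
lemma localForm_eq (hpq : p.HolderConjugate q) (hm : Measurable (Function.uncurry m))
    (hmlo : 0 < mlo) (hH1 : ∀ᵐ z : E n × E n, mlo ≤ m z.1 z.2 ∧ m z.1 z.2 ≤ mhi)
    (hH3 : ∀ᵐ x : E n, ∃ C : ℝ, ∀ᶠ r : ℝ in 𝓝[>] 0,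
      ∀ θ : sphere (0 : E n) 1, |m x (r • (θ : E n)) - a x θ| ≤ C * r)
    {g gv : E n → E n} (hg : InLp p volume g) (hgv : InLp p volume gv) :
    ∫ x, inner ℝ (gradient (density p a x) (g x)) (gv x)
      = ∫ z, coefLim mlo a z * (dpow p (dqLim g z) * dqLim gv z) ∂(zMeas n) := by
  have hp := hpq.lt
  have hml := aestronglyMeasurable_coefLim (mlo := mlo) hm hH3
  have habsl : ∀ᵐ z ∂(zMeas n), |coefLim mlo a z| ≤ mhi := by
    filter_upwards [coefLim_bounds hH1 hH3] with z hz
    rw [abs_of_pos (hmlo.trans_le hz.1)]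
    exact hz.2
  have hI := integrable_form hpq hml habsl (inLp_dqLim hg) (inLp_dqLim hgv)
  have hml1 : AEStronglyMeasurable (coefLim mlo a)
      ((volume : Measure (E n)).prod (yMeas₁ n)) := by
    rw [← zMeas_restrict]; exact hml.restrict
  have habs1 : ∀ᵐ z ∂((volume : Measure (E n)).prod (yMeas₁ n)), |coefLim mlo a z| ≤ mhi := by
    rw [← zMeas_restrict]; exact ae_restrict_of_ae habsl
  have e1 : ∫ z, coefLim mlo a z * (dpow p (dqLim g z) * dqLim gv z) ∂(zMeas n)
      = ∫ z, coefLim mlo a z * (dpow p (dqLim g z) * dqLim gv z)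
        ∂((volume : Measure (E n)).prod (yMeas₁ n)) := by
    rw [← zMeas_restrict, setIntegral_eq_integral_of_forall_compl_eq_zero]
    intro z hz
    have hz2 : z.2 ∉ unitY n := fun h => hz ⟨Set.mem_univ _, h⟩
    have h1 : dqLim gv z = 0 := Set.indicator_of_notMem hz2 _
    rw [h1, mul_zero, mul_zero]
  have hI1 : Integrable (fun z => coefLim mlo a z * (dpow p (dqLim g z) * dqLim gv z))
      ((volume : Measure (E n)).prod (yMeas₁ n)) := by
    rw [← zMeas_restrict]; exact hI.restrict
  rw [e1, integral_prod _ hI1]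
  refine integral_congr_ae ?_
  filter_upwards [hml1.prodMk_left, Measure.ae_ae_of_ae_prod habs1] with x hx1 hx2
  have hxa : (fun y : Y n => coefLim mlo a (x, y)) =ᵐ[yMeas₁ n] fun y => a x y.1 := by
    filter_upwards [ae_yMeas₁] with y hy
    exact coefLim_of_mem hy
  rw [inner_gradient_density hp (hx1.congr hxa) (M := mhi) (by
    filter_upwards [hx2, hxa] with y h1 h2
    rwa [← h2])]
  refine integral_congr_ae ?_
  filter_upwards [ae_yMeas₁] with y hy
  rw [coefLim_of_mem (z := (x, y)) hy, dqLim, dqLim, Set.indicator_of_mem hy,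
    Set.indicator_of_mem hy]

end Coefficients

/-! ### The local problem -/

section LocalProblem

set_option linter.unusedSectionVars false

variable {n : ℕ} [NeZero n] {α p q : ℝ}

lemma HasWeakGradient.comb (hpq : p.HolderConjugate q) {u v : E n → ℝ} {gu gv : E n → E n}
    (hu : IsSobolevWith p u gu) (hv : IsSobolevWith p v gv) (c d : ℝ) :
    HasWeakGradient (c • u + d • v) (c • gu + d • gv) := by
  intro φ hφ hc e
  have hfq : InLp q (volume : Measure (E n)) (fun x => fderiv ℝ φ x e) :=
    inLp_fderiv_apply hφ hc e
  have hφq : InLp q (volume : Measure (E n)) φ := hφ.continuous.memLp_of_hasCompactSupport hc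
  have i1 := integrable_mul_of_inLp hpq hu.1 hfq
  have i2 := integrable_mul_of_inLp hpq hv.1 hfq
  have j1 := integrable_mul_of_inLp hpq (inLp_inner hu.2.1 e) hφq
  have j2 := integrable_mul_of_inLp hpq (inLp_inner hv.2.1 e) hφq
  calc ∫ x, (c • u + d • v) x * fderiv ℝ φ x e
      = ∫ x, (c * (u x * fderiv ℝ φ x e) + d * (v x * fderiv ℝ φ x e)) := by
        refine integral_congr_ae (ae_of_all _ fun x => ?_)
        simp only [Pi.add_apply, Pi.smul_apply, smul_eq_mul]
        ring
    _ = -∫ x, (c * (inner ℝ (gu x) e * φ x) + d * (inner ℝ (gv x) e * φ x)) := by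
        rw [integral_add (i1.const_mul c) (i2.const_mul d),
          integral_add (j1.const_mul c) (j2.const_mul d)]
        simp only [integral_const_mul]
        rw [hu.2.2 φ hφ hc e, hv.2.2 φ hφ hc e]
        ring
    _ = -∫ x, inner ℝ ((c • gu + d • gv) x) e * φ x := by
        congr 1
        refine integral_congr_ae (ae_of_all _ fun x => ?_)
        simp only [Pi.add_apply, Pi.smul_apply, inner_add_left, inner_smul_left, conj_trivial]
        ring

lemma IsSobolevWith.comb (hpq : p.HolderConjugate q) {u v : E n → ℝ} {gu gv : E n → E n}
    (hu : IsSobolevWith p u gu) (hv : IsSobolevWith p v gv) (c d : ℝ) :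
    IsSobolevWith p (c • u + d • v) (c • gu + d • gv) :=
  ⟨(hu.1.const_smul c).add (hv.1.const_smul d), (hu.2.1.const_smul c).add (hv.2.1.const_smul d),
    HasWeakGradient.comb hpq hu hv c d⟩

lemma sobolev₀_comb (hpq : p.HolderConjugate q) {Ω : Set (E n)} {u v : E n → ℝ}
    (hu : u ∈ sobolev₀ p Ω) (hv : v ∈ sobolev₀ p Ω) (c d : ℝ) : c • u + d • v ∈ sobolev₀ p Ω := by
  obtain ⟨⟨gu, hgu⟩, hu0⟩ := hu
  obtain ⟨⟨gv, hgv⟩, hv0⟩ := hv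
  refine ⟨⟨_, hgu.comb hpq hgv c d⟩, ?_⟩
  filter_upwards [hu0, hv0] with x h1 h2 hx
  simp [h1 hx, h2 hx]

/-- The limit `α ↓ 0` in the fractional inequality, possible because its constant is uniform in `α`.
-/
lemma exists_poincare_dqLim (hpq : p.HolderConjugate q) {Ω : Set (E n)}
    (hΩ : Bornology.IsBounded Ω) : ∃ C : ℝ, 0 ≤ C ∧ ∀ (u : E n → ℝ) (g : E n → E n),
      IsSobolevWith p u g → (∀ᵐ x : E n, x ∉ Ω → u x = 0) →
      nrm p volume u ≤ C * nrm p (zMeas n) (dqLim g) := by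
  have hp := hpq.lt
  obtain ⟨C, hC0, hC⟩ := exists_poincare hp hΩ
  refine ⟨C, hC0, fun u g hu hu0 => ?_⟩
  have h1 := ((tendsto_dq hpq hu).const_add (nrm p (zMeas n) (dqLim g))).const_mul C
  rw [add_zero] at h1
  refine ge_of_tendsto h1 ?_
  filter_upwards [Ioo_mem_nhdsGT (show (0:ℝ) < p by linarith)] with α hα
  have h2 := inLp_dq hpq hu hα.1 hα.2
  refine (hC α hα.1 u hu.1 hu0 h2).trans (mul_le_mul_of_nonneg_left ?_ hC0)
  exact nrm_le_add_sub hp h2 (inLp_dqLim hu.2.1)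

/-- The standing assumptions. -/
structure Admissible {n : ℕ} (p q : ℝ) (Ω : Set (E n)) (m : E n → E n → ℝ) (mlo mhi : ℝ)
    (a : E n → sphere (0 : E n) 1 → ℝ) (f : E n → ℝ) : Prop where
  hpq : p.HolderConjugate q
  isOpen : IsOpen Ω
  isBounded : Bornology.IsBounded Ω
  meas : Measurable (Function.uncurry m)
  pos : 0 < mlo
  bounds : ∀ᵐ z : E n × E n, mlo ≤ m z.1 z.2 ∧ m z.1 z.2 ≤ mhi
  limit : ∀ᵐ x : E n, ∃ C : ℝ, ∀ᶠ r : ℝ in 𝓝[>] 0,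
    ∀ θ : sphere (0 : E n) 1, |m x (r • (θ : E n)) - a x θ| ≤ C * r
  source : InLp q (volume.restrict Ω) f

variable {Ω : Set (E n)} {m : E n → E n → ℝ} {mlo mhi : ℝ}
  {a : E n → sphere (0 : E n) 1 → ℝ} {f : E n → ℝ}

lemma Admissible.abs_coefLim_le (S : Admissible p q Ω m mlo mhi a f) :
    ∀ᵐ z ∂(zMeas n), |coefLim mlo a z| ≤ mhi := by
  filter_upwards [coefLim_bounds S.bounds S.limit] with z hz
  rw [abs_of_pos (S.pos.trans_le hz.1)]
  exact hz.2

lemma Admissible.isLocalSolution_iff (S : Admissible p q Ω m mlo mhi a f) {V : Set (E n → ℝ)}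
    {u : E n → ℝ} : IsLocalSolution p Ω V a (fun x => p * f x) u ↔
      u ∈ V ∧ ∃ g, IsSobolevWith p u g ∧ ∀ v ∈ V, ∀ gv, IsSobolevWith p v gv →
        ∫ z, coefLim mlo a z * (dpow p (dqLim g z) * dqLim gv z) ∂(zMeas n)
          = p * ∫ x in Ω, f x * v x := by
  refine and_congr_right fun _ => exists_congr fun g => and_congr_right fun hg =>
    forall₄_congr fun v _ gv hgv => ?_
  rw [localForm_eq S.hpq S.meas S.pos S.bounds S.limit hg.2.1 hgv.2.1, ← integral_const_mul]
  simp only [mul_assoc]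

/-- Linearity of the right-hand side. -/
lemma Admissible.integral_source_comb (S : Admissible p q Ω m mlo mhi a f) {u v : E n → ℝ}
    (hu : InLp p volume u) (hv : InLp p volume v) (c d : ℝ) :
    ∫ x in Ω, f x * (c • u + d • v) x = c * (∫ x in Ω, f x * u x) + d * ∫ x in Ω, f x * v x := by
  have i1 := integrable_mul_of_inLp S.hpq.symm S.source (hu.restrict Ω)
  have i2 := integrable_mul_of_inLp S.hpq.symm S.source (hv.restrict Ω)
  rw [← integral_const_mul, ← integral_const_mul,
    ← integral_add (i1.const_mul c) (i2.const_mul d)]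
  refine integral_congr_ae (ae_of_all _ fun x => ?_)
  simp only [Pi.add_apply, Pi.smul_apply, smul_eq_mul]
  ring

/-- Both equations are tested with `w - u`; monotonicity makes the limiting quotients equal, and the
Poincaré inequality makes the functions equal. Weak gradients need not be known to be unique, since
the equation holds for every weak gradient of the test function. -/
theorem Admissible.localSolution_unique (S : Admissible p q Ω m mlo mhi a f) {u w : E n → ℝ}
    (hu : IsLocalSolution p Ω (sobolev₀ p Ω) a (fun x => p * f x) u)
    (hw : IsLocalSolution p Ω (sobolev₀ p Ω) a (fun x => p * f x) w) : w =ᵐ[volume] u := by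
  have hp := S.hpq.lt
  obtain ⟨huV, gu, hgu, hu'⟩ := S.isLocalSolution_iff.1 hu
  obtain ⟨hwV, gw, hgw, hw'⟩ := S.isLocalSolution_iff.1 hw
  have hv := sobolev₀_comb S.hpq hwV huV 1 (-1)
  have hgv := hgw.comb S.hpq hgu 1 (-1)
  have e1 : dqLim ((1:ℝ) • gw + (-1:ℝ) • gu) = dqLim gw - dqLim gu := by
    rw [one_smul, neg_one_smul, ← sub_eq_add_neg, dqLim_sub]
  have h1 := hu' _ hv _ hgv
  have h2 := hw' _ hv _ hgv
  rw [e1] at h1 h2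
  have hml := aestronglyMeasurable_coefLim (mlo := mlo) S.meas S.limit
  have h3 := nrm_sub_eq_zero_of_form S.hpq S.pos hml (coefLim_bounds S.bounds S.limit)
    (inLp_dqLim hgw.2.1) (inLp_dqLim hgu.2.1) (by
      rw [integral_form_sub S.hpq hml S.abs_coefLim_le (inLp_dqLim hgw.2.1) (inLp_dqLim hgu.2.1)]
      simp only [Pi.sub_apply] at h1 h2
      rw [h1, h2, sub_self])
  obtain ⟨C, hC0, hC⟩ := exists_poincare_dqLim S.hpq S.isBounded
  have h4 := hC _ _ hgv hv.2
  rw [e1, h3, mul_zero] at h4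
  have h5 := (nrm_eq_zero_iff hp hgv.1).1 (le_antisymm h4 nrm_nonneg)
  filter_upwards [h5] with x hx
  simp only [Pi.add_apply, Pi.smul_apply, smul_eq_mul, Pi.zero_apply] at hx
  linarith

end LocalProblem

/-! ### Convergence of the nonlocal solutions -/

section Convergence

set_option linter.unusedSectionVars false

variable {n : ℕ} [NeZero n] {α p q : ℝ} {Ω : Set (E n)} {m : E n → E n → ℝ} {mlo mhi : ℝ}
  {a : E n → sphere (0 : E n) 1 → ℝ} {f : E n → ℝ}

/-- Solutions of the nonlocal problem, in terms of the parameter `α = p * (1 - s)`. -/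
def IsQuotSolution {n : ℕ} (α p : ℝ) (Ω : Set (E n)) (m : E n → E n → ℝ) (f u : E n → ℝ) : Prop :=
  (InLp p volume u ∧ InLp p (zMeas n) (dq α u) ∧ ∀ᵐ x : E n, x ∉ Ω → u x = 0) ∧
    ∀ v, InLp p volume v → InLp p (zMeas n) (dq α v) → (∀ᵐ x : E n, x ∉ Ω → v x = 0) →
      ∫ z, coef m α z * (dpow p (dq α u z) * dq α v z) ∂(zMeas n) = p * ∫ x in Ω, f x * v x

lemma Admissible.isQuotSolution (S : Admissible p q Ω m mlo mhi a f) {s : ℝ} (hs : s < 1)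
    {u : E n → ℝ} (hu : IsNonlocalSolution s p Ω m f u) :
    IsQuotSolution (p * (1 - s)) p Ω m f u := by
  obtain ⟨h1, h2⟩ := (isNonlocalSolution_iff S.hpq.lt hs S.meas).1 hu
  exact ⟨h1, fun v hv1 hv2 hv3 => h2 v ⟨hv1, hv2, hv3⟩⟩

/-- Uniform energy bounds. -/
lemma Admissible.exists_energy_bound (S : Admissible p q Ω m mlo mhi a f) :
    ∃ B : ℝ, 0 ≤ B ∧ ∀ α : ℝ, 0 < α → ∀ u, IsQuotSolution α p Ω m f u →
      nrm p volume u ≤ B ∧ nrm p (zMeas n) (dq α u) ≤ B := by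
  have hp := S.hpq.lt
  have hp0 : 0 < p := by linarith
  obtain ⟨C, hC0, hC⟩ := exists_poincare hp S.isBounded
  have hfΩ := inLp_indicator S.isOpen.measurableSet S.source
  -- Testing the equation with the solution gives `mlo X^p ≤ p ‖f‖ C X` for `X = nrm p (zMeas n) (dq
  -- α u)`, with constants free of `α`.
  obtain ⟨B, hB0, hB⟩ := exists_bound_of_rpow_le hp S.pos
    (p * (nrm q volume (Ω.indicator f) * C)) 0
  refine ⟨max B (C * B), le_max_of_le_left hB0, fun α hα u hu => ?_⟩
  obtain ⟨⟨hu1, hu2, hu3⟩, hu4⟩ := hu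
  have hX : nrm p (zMeas n) (dq α u) ≤ B := by
    refine hB _ nrm_nonneg ?_
    have h1 := hu4 u hu1 hu2 hu3
    have h2 : mlo * nrm p (zMeas n) (dq α u) ^ p
        ≤ ∫ z, coef m α z * (dpow p (dq α u z) * dq α u z) ∂(zMeas n) := by
      rw [nrm_rpow hp hu2, ← integral_const_mul]
      refine integral_mono_ae ((InLp.integrable_rpow hp hu2).const_mul _)
        (integrable_form S.hpq (measurable_coef S.meas).aestronglyMeasurable
          (coef_abs_le hα S.pos S.bounds) hu2 hu2) ?_
      filter_upwards [coef_bounds hα S.bounds] with z hz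
      rw [dpow_mul_self hp, Real.norm_eq_abs]
      exact mul_le_mul_of_nonneg_right hz.1 (by positivity)
    have h3 := abs_integral_mul_le S.hpq.symm hfΩ hu1
    have h4 := hC α hα u hu1 hu3 hu2
    rw [setIntegral_mul_eq S.isOpen.measurableSet] at h1
    have h5 : p * ∫ x, Ω.indicator f x * u x
        ≤ p * (nrm q volume (Ω.indicator f) * (C * nrm p (zMeas n) (dq α u))) :=
      mul_le_mul_of_nonneg_left ((le_abs_self _).trans (h3.trans
        (mul_le_mul_of_nonneg_left h4 nrm_nonneg))) hp0.le
    linarith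
  exact ⟨((hC α hα u hu1 hu3 hu2).trans (mul_le_mul_of_nonneg_left hX hC0)).trans
    (le_max_right _ _), hX.trans (le_max_left _ _)⟩

lemma weak_of_strong (hpq : p.HolderConjugate q) {Z ι : Type*} [MeasurableSpace Z]
    {μ : Measure Z} {l : Filter ι} {w : ι → Z → ℝ} {w₀ : Z → ℝ}
    (hw : ∀ᶠ i in l, InLp p μ (w i)) (hw₀ : InLp p μ w₀)
    (h : Tendsto (fun i => nrm p μ (w i - w₀)) l (𝓝 0)) {φ : Z → ℝ} (hφ : InLp q μ φ) :
    Tendsto (fun i => ∫ x, w i x * φ x ∂μ) l (𝓝 (∫ x, w₀ x * φ x ∂μ)) := by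
  rw [tendsto_iff_dist_tendsto_zero]
  have h1 := h.mul_const (nrm q μ φ)
  rw [zero_mul] at h1
  refine squeeze_zero' (Eventually.of_forall fun _ => dist_nonneg) ?_ h1
  filter_upwards [hw] with i hi
  rw [Real.dist_eq, ← integral_sub (integrable_mul_of_inLp hpq hi hφ)
    (integrable_mul_of_inLp hpq hw₀ hφ)]
  have h2 := abs_integral_mul_le hpq (hi.sub hw₀) hφ
  simpa only [Pi.sub_apply, sub_mul] using h2

/-- The limit of the monotonicity defects between solutions and a fixed Sobolev function. -/
lemma Admissible.tendsto_defect (S : Admissible p q Ω m mlo mhi a f) {ι : Type*}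
    {l : Filter ι} {αs : ι → ℝ} (hα : Tendsto αs l (𝓝[>] 0)) {w : ι → E n → ℝ}
    (hw : ∀ᶠ i in l, IsQuotSolution (αs i) p Ω m f (w i)) {B : ℝ}
    (hB : ∀ᶠ i in l, nrm p (zMeas n) (dq (αs i) (w i)) ≤ B)
    {u : E n → ℝ} {g : E n → E n} (hu : InLp p volume u) (hg : InLp p volume g)
    {G : E n × Y n → ℝ}
    (hlim : ∀ φ, InLp q volume φ → Tendsto (fun i => ∫ x, w i x * φ x) l (𝓝 (∫ x, u x * φ x)))
    (hlimG : ∀ F, InLp q (zMeas n) F → Tendsto (fun i => ∫ z, dq (αs i) (w i) z * F z ∂(zMeas n)) l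
      (𝓝 (∫ z, G z * F z ∂(zMeas n))))
    (hGg : ∀ F : E n × Y n → ℝ, (∀ z, z.2 ∉ unitY n → F z = 0) →
      ∫ z, G z * F z ∂(zMeas n) = ∫ z, dqLim g z * F z ∂(zMeas n))
    {v : E n → ℝ} {gv : E n → E n} (hv : IsSobolevWith p v gv)
    (hv0 : ∀ᵐ x : E n, x ∉ Ω → v x = 0) :
    Tendsto (fun i => ∫ z, coef m (αs i) z * ((dpow p (dq (αs i) (w i) z) -
      dpow p (dq (αs i) v z)) * (dq (αs i) (w i) z - dq (αs i) v z)) ∂(zMeas n)) l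
      (𝓝 (p * (∫ x in Ω, f x * (u - v) x) - ∫ z, coefLim mlo a z *
        (dpow p (dqLim gv z) * (dqLim g z - dqLim gv z)) ∂(zMeas n))) := by
  have hp := S.hpq.lt
  have hfΩ := inLp_indicator S.isOpen.measurableSet S.source
  obtain ⟨hF1, hF2, hF3⟩ := tendsto_flux S.hpq S.meas S.pos S.bounds S.limit hv
  have hsmall : ∀ᶠ i in l, 0 < αs i ∧ αs i < p :=
    hα.eventually (Ioo_mem_nhdsGT (show (0:ℝ) < p by linarith))
  have hdv : ∀ᶠ i in l, InLp p (zMeas n) (dq (αs i) v) := by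
    filter_upwards [hsmall] with i hi
    exact inLp_dq S.hpq hv hi.1 hi.2
  have hsv : Tendsto (fun i => nrm p (zMeas n) (dq (αs i) v - dqLim gv)) l (𝓝 0) :=
    (tendsto_dq S.hpq hv).comp hα
  -- the source term
  have t1 : Tendsto (fun i => p * ∫ x in Ω, f x * (w i - v) x) l
      (𝓝 (p * ∫ x in Ω, f x * (u - v) x)) := by
    refine Tendsto.const_mul p ?_
    have key : ∀ k : E n → ℝ, InLp p volume k → ∫ x in Ω, f x * (k - v) x
        = (∫ x, k x * Ω.indicator f x) - ∫ x, v x * Ω.indicator f x := by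
      intro k hk
      rw [setIntegral_mul_eq S.isOpen.measurableSet, ← integral_sub
        (integrable_mul_of_inLp S.hpq hk hfΩ) (integrable_mul_of_inLp S.hpq hv.1 hfΩ)]
      refine integral_congr_ae (ae_of_all _ fun x => ?_)
      simp only [Pi.sub_apply]
      ring
    rw [key u hu]
    refine ((hlim _ hfΩ).sub_const _).congr' ?_
    filter_upwards [hw] with i hi
    exact (key _ hi.1.1).symm
  -- the flux term
  have t2 : Tendsto (fun i => ∫ z, dq (αs i) (w i) z *
      (coef m (αs i) z * dpow p (dq (αs i) v z)) ∂(zMeas n)) l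
      (𝓝 (∫ z, dqLim g z * (coefLim mlo a z * dpow p (dqLim gv z)) ∂(zMeas n))) := by
    -- The limiting flux of `v` vanishes for `t ≥ 1`, so the unidentified part of `G` does not
    -- enter.
    rw [← hGg _ fun z hz => by
      rw [show dqLim gv z = 0 from Set.indicator_of_notMem hz _, dpow_zero, mul_zero]]
    refine tendsto_integral_weak_mul_strong S.hpq (w := fun i => dq (αs i) (w i))
      (ψ := fun i z => coef m (αs i) z * dpow p (dq (αs i) v z)) (B := B) ?_ hlimG
      (hα.eventually hF1) hF2 (hF3.comp hα)
    filter_upwards [hw, hB] with i hi hBi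
    exact ⟨hi.1.2.1, hBi⟩
  have t3 : Tendsto (fun i => ∫ z, dq (αs i) v z *
      (coef m (αs i) z * dpow p (dq (αs i) v z)) ∂(zMeas n)) l
      (𝓝 (∫ z, dqLim gv z * (coefLim mlo a z * dpow p (dqLim gv z)) ∂(zMeas n))) := by
    refine tendsto_integral_weak_mul_strong S.hpq (w := fun i => dq (αs i) v)
      (ψ := fun i z => coef m (αs i) z * dpow p (dq (αs i) v z))
      (B := nrm p (zMeas n) (dqLim gv) + 1) ?_
      (fun φ hφ => weak_of_strong S.hpq hdv (inLp_dqLim hv.2.1) hsv hφ)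
      (hα.eventually hF1) hF2 (hF3.comp hα)
    filter_upwards [hdv, hsv.eventually (gt_mem_nhds one_pos)] with i hi h1
    refine ⟨hi, (nrm_le_add_sub hp hi (inLp_dqLim hv.2.1)).trans ?_⟩
    linarith
  have t4 := t1.sub (t2.sub t3)
  have elim : ∫ z, coefLim mlo a z * (dpow p (dqLim gv z) * (dqLim g z - dqLim gv z)) ∂(zMeas n)
      = (∫ z, dqLim g z * (coefLim mlo a z * dpow p (dqLim gv z)) ∂(zMeas n))
        - ∫ z, dqLim gv z * (coefLim mlo a z * dpow p (dqLim gv z)) ∂(zMeas n) := by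
    rw [← integral_sub (integrable_mul_of_inLp S.hpq (inLp_dqLim hg) hF2)
      (integrable_mul_of_inLp S.hpq (inLp_dqLim hv.2.1) hF2)]
    refine integral_congr_ae (ae_of_all _ fun z => ?_)
    simp only
    ring
  rw [elim]
  refine t4.congr' ?_
  filter_upwards [hw, hdv, hsmall, hα.eventually hF1] with i hi hvi hαi hFi
  have hk := (measurable_coef (α := αs i) S.meas).aestronglyMeasurable (μ := zMeas n)
  rw [integral_form_sub S.hpq hk (coef_abs_le hαi.1 S.pos S.bounds) hi.1.2.1 hvi]
  -- The difference `w i - v` is admissible in the nonlocal equation. This trades the flux of `w i`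
  -- against its own quotient, a product of two weakly convergent factors, for the source term.
  have h1 := hi.2 (w i - v) (hi.1.1.sub hv.1) (by rw [dq_sub]; exact hi.1.2.1.sub hvi) (by
    filter_upwards [hi.1.2.2, hv0] with x hx1 hx2 hx
    rw [Pi.sub_apply, hx1 hx, hx2 hx, sub_self])
  rw [dq_sub] at h1
  simp only [Pi.sub_apply] at h1 ⊢
  rw [h1, ← integral_sub (integrable_mul_of_inLp S.hpq hi.1.2.1 hFi)
    (integrable_mul_of_inLp S.hpq hvi hFi)]
  congr 1
  refine integral_congr_ae (ae_of_all _ fun z => ?_)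
  simp only
  ring

/-- Minty's argument: the variational inequality implies the equation. -/
lemma Admissible.minty (S : Admissible p q Ω m mlo mhi a f) {u : E n → ℝ} {g : E n → E n}
    (hu : IsSobolevWith p u g) (hu0 : ∀ᵐ x : E n, x ∉ Ω → u x = 0)
    (h : ∀ (v : E n → ℝ) (gv : E n → E n), IsSobolevWith p v gv →
      (∀ᵐ x : E n, x ∉ Ω → v x = 0) → ∫ z, coefLim mlo a z *
        (dpow p (dqLim gv z) * (dqLim g z - dqLim gv z)) ∂(zMeas n)
          ≤ p * ∫ x in Ω, f x * (u - v) x) :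
    IsLocalSolution p Ω (sobolev₀ p Ω) a (fun x => p * f x) u := by
  have hp := S.hpq.lt
  have huV : u ∈ sobolev₀ p Ω := ⟨⟨g, hu⟩, hu0⟩
  have hml := aestronglyMeasurable_coefLim (mlo := mlo) S.meas S.limit
  have key : ∀ v ∈ sobolev₀ p Ω, ∀ gv, IsSobolevWith p v gv →
      p * (∫ x in Ω, f x * v x) ≤
        ∫ z, coefLim mlo a z * (dpow p (dqLim g z) * dqLim gv z) ∂(zMeas n) := by
    intro v hv gv hgv
    have h1 := (tendsto_form_add_smul S.hpq hml S.abs_coefLim_le (inLp_dqLim hu.2.1)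
      (inLp_dqLim hgv.2.1)).mono_left (nhdsWithin_le_nhds (s := Set.Ioi (0:ℝ)))
    refine ge_of_tendsto h1 ?_
    filter_upwards [self_mem_nhdsWithin] with t ht
    have ht0 : 0 < t := ht
    -- The comparison function is `u + t v` with `t > 0`; both sides then carry a factor `-t`, which
    -- is divided out before `t ↓ 0`.
    have h2 := h _ _ (hu.comb S.hpq hgv 1 t) (sobolev₀_comb S.hpq huV hv 1 t).2
    have e1 : dqLim ((1:ℝ) • g + t • gv) = dqLim g + t • dqLim gv := by
      rw [one_smul, dqLim_add, dqLim_smul]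
    have e2 : u - ((1:ℝ) • u + t • v) = (0:ℝ) • u + (-t) • v := by
      rw [one_smul, zero_smul, neg_smul]
      abel
    rw [e1, e2, S.integral_source_comb hu.1 hgv.1, zero_mul, zero_add] at h2
    have e3 : ∫ z, coefLim mlo a z * (dpow p ((dqLim g + t • dqLim gv) z) *
        (dqLim g z - (dqLim g + t • dqLim gv) z)) ∂(zMeas n)
        = -t * ∫ z, coefLim mlo a z * (dpow p (dqLim g z + t * dqLim gv z) * dqLim gv z)
          ∂(zMeas n) := by
      rw [← integral_const_mul]
      refine integral_congr_ae (ae_of_all _ fun z => ?_)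
      simp only [Pi.add_apply, Pi.smul_apply, smul_eq_mul]
      ring
    rw [e3] at h2
    nlinarith
  refine S.isLocalSolution_iff.2 ⟨huV, g, hu, fun v hv gv hgv => le_antisymm ?_ (key v hv gv hgv)⟩
  -- The opposite inequality comes from `-v`, written as a linear combination.
  have h3 := key _ (sobolev₀_comb S.hpq hv hv (-1) 0) _ (hgv.comb S.hpq hgv (-1) 0)
  have e1 : dqLim ((-1:ℝ) • gv + (0:ℝ) • gv) = -dqLim gv := by
    rw [zero_smul, add_zero, dqLim_smul, neg_one_smul]
  rw [S.integral_source_comb hgv.1 hgv.1, e1] at h3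
  have e2 : ∫ z, coefLim mlo a z * (dpow p (dqLim g z) * (-dqLim gv) z) ∂(zMeas n)
      = -∫ z, coefLim mlo a z * (dpow p (dqLim g z) * dqLim gv z) ∂(zMeas n) := by
    rw [← integral_neg]
    refine integral_congr_ae (ae_of_all _ fun z => ?_)
    simp only [Pi.neg_apply]
    ring
  rw [e2] at h3
  linarith

/-- Along ultrafilters the nonlocal solutions converge to a local solution. -/
theorem Admissible.exists_limit (S : Admissible p q Ω m mlo mhi a f) {ι : Type*}
    (U : Ultrafilter ι) {αs : ι → ℝ} (hα : Tendsto αs U (𝓝[>] 0)) {w : ι → E n → ℝ}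
    (hw : ∀ᶠ i in (U : Filter ι), IsQuotSolution (αs i) p Ω m f (w i)) :
    ∃ u, IsLocalSolution p Ω (sobolev₀ p Ω) a (fun x => p * f x) u ∧
      Tendsto (fun i => nrm p volume (w i - u)) U (𝓝 0) := by
  have hp := S.hpq.lt
  obtain ⟨B, hB0, hB⟩ := S.exists_energy_bound
  have hαpos : ∀ᶠ i in (U : Filter ι), 0 < αs i ∧ αs i < p :=
    hα.eventually (Ioo_mem_nhdsGT (show (0:ℝ) < p by linarith))
  have hwB : ∀ᶠ i in (U : Filter ι), InLp p volume (w i) ∧ nrm p volume (w i) ≤ B := by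
    filter_upwards [hw, hαpos] with i hi hαi
    exact ⟨hi.1.1, (hB _ hαi.1 _ hi).1⟩
  have hdB : ∀ᶠ i in (U : Filter ι), InLp p (zMeas n) (dq (αs i) (w i)) ∧
      nrm p (zMeas n) (dq (αs i) (w i)) ≤ B := by
    filter_upwards [hw, hαpos] with i hi hαi
    exact ⟨hi.1.2.1, (hB _ hαi.1 _ hi).2⟩
  obtain ⟨u, hu, hlim⟩ := exists_weak_limit S.hpq U hwB
  obtain ⟨G, hG, hlimG⟩ := exists_weak_limit S.hpq U hdB
  obtain ⟨g, hg, hGg⟩ := exists_gradient_of_weak_limit S.hpq hα hwB (hdB.mono fun _ h => h.1)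
    hu hG hlim hlimG
  have hu0 := ae_zero_of_weak_limit S.hpq S.isOpen.measurableSet
    (hw.mono fun _ h => h.1.2.2) hu hlim
  have hdef := fun (v : E n → ℝ) (gv : E n → E n) (hv : IsSobolevWith p v gv)
    (hv0 : ∀ᵐ x : E n, x ∉ Ω → v x = 0) =>
    S.tendsto_defect hα hw (hdB.mono fun _ h => h.2) hu hg.2.1 hlim hlimG hGg hv hv0
  refine ⟨u, S.minty hg hu0 fun v gv hv hv0 => ?_, ?_⟩
  · have h1 := ge_of_tendsto (hdef v gv hv hv0) (b := 0) (by
      filter_upwards [hαpos] with i hi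
      refine integral_nonneg_of_ae ?_
      filter_upwards [coef_bounds hi.1 S.bounds] with z hz
      exact mul_nonneg (S.pos.le.trans hz.1) (dpow_sub_mul_nonneg hp _ _))
    linarith
  -- With `v = u` the limit of the defects is zero. Strong monotonicity makes the quotients of `w i
  -- - u` tend to zero, and the uniform Poincaré inequality carries this over to `w i - u`.
  · have h1 := hdef u g hg hu0
    simp only [sub_self, Pi.zero_apply, mul_zero, integral_zero] at h1
    have hdu : ∀ᶠ i in (U : Filter ι), InLp p (zMeas n) (dq (αs i) u) := by
      filter_upwards [hαpos] with i hi
      exact inLp_dq S.hpq hg hi.1 hi.2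
    have hsu : Tendsto (fun i => nrm p (zMeas n) (dq (αs i) u - dqLim g)) U (𝓝 0) :=
      (tendsto_dq S.hpq hg).comp hα
    have h2 := tendsto_nrm_of_monotone_form S.hpq (c := mlo) (M := mhi)
      (B := max B (nrm p (zMeas n) (dqLim g) + 1)) S.pos
      (F := fun i => dq (αs i) (w i)) (G := fun i => dq (αs i) u) (k := fun i => coef m (αs i))
      (by
        filter_upwards [hαpos] with i hi
        exact ⟨(measurable_coef S.meas).aestronglyMeasurable, coef_bounds hi.1 S.bounds⟩)
      (hdB.mono fun _ h => ⟨h.1, h.2.trans (le_max_left _ _)⟩)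
      (by
        filter_upwards [hdu, hsu.eventually (gt_mem_nhds one_pos)] with i hi h1
        refine ⟨hi, le_trans ?_ (le_max_right _ _)⟩
        refine (nrm_le_add_sub hp hi (inLp_dqLim hg.2.1)).trans ?_
        linarith) h1
    obtain ⟨C, hC0, hC⟩ := exists_poincare hp S.isBounded
    have h3 := h2.const_mul C
    rw [mul_zero] at h3
    refine squeeze_zero' (Eventually.of_forall fun _ => nrm_nonneg) ?_ h3
    filter_upwards [hw, hdu, hαpos] with i hi hdi hαi
    have h4 := hC _ hαi.1 (w i - u) (hi.1.1.sub hu) (by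
      filter_upwards [hi.1.2.2, hu0] with x hx1 hx2 hx
      rw [Pi.sub_apply, hx1 hx, hx2 hx, sub_self]) (by
        rw [dq_sub]
        exact hi.1.2.1.sub hdi)
    rwa [dq_sub] at h4

lemma tendsto_order (hp : 1 < p) : Tendsto (fun s : ℝ => p * (1 - s)) (𝓝[<] 1) (𝓝[>] 0) := by
  refine tendsto_nhdsWithin_iff.2 ⟨?_, ?_⟩
  · have h1 : Continuous fun s : ℝ => p * (1 - s) := by fun_prop
    have h2 := h1.tendsto 1
    rw [sub_self, mul_zero] at h2
    exact h2.mono_left nhdsWithin_le_nhds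
  · filter_upwards [self_mem_nhdsWithin] with s hs
    have : s < 1 := hs
    exact Set.mem_Ioi.2 (mul_pos (by linarith) (by linarith))

/-- The nonlocal solutions converge to the solution of the local problem. -/
theorem Admissible.exists_tendsto (S : Admissible p q Ω m mlo mhi a f) {us : ℝ → E n → ℝ}
    (hus : ∀ s < 1, IsNonlocalSolution s p Ω m f (us s)) :
    ∃ u, IsLocalSolution p Ω (sobolev₀ p Ω) a (fun x => p * f x) u ∧
      Tendsto (fun s => nrm p volume (us s - u)) (𝓝[<] 1) (𝓝 0) := by
  have hq : ∀ᶠ s in 𝓝[<] (1:ℝ), IsQuotSolution (p * (1 - s)) p Ω m f (us s) := by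
    filter_upwards [self_mem_nhdsWithin] with s hs
    exact S.isQuotSolution hs (hus s hs)
  have hα := tendsto_order S.hpq.lt
  have key := fun (U : Ultrafilter ℝ) (hU : (U : Filter ℝ) ≤ 𝓝[<] 1) =>
    S.exists_limit U (hα.mono_left hU) (hU hq)
  -- One ultrafilter supplies the candidate; uniqueness of the local problem shows that every other
  -- ultrafilter gives the same limit, which amounts to convergence of the whole family.
  obtain ⟨u, hu, -⟩ := key (Ultrafilter.of (𝓝[<] 1)) (Ultrafilter.of_le _)
  refine ⟨u, hu, tendsto_iff_ultrafilter _ _ _ |>.2 fun U hU => ?_⟩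
  obtain ⟨v, hv, hvt⟩ := key U hU
  refine hvt.congr fun s => nrm_congr_ae ?_
  filter_upwards [S.localSolution_unique hu hv] with x hx
  rw [Pi.sub_apply, Pi.sub_apply, hx]

end Convergence

/-! ### Mollification -/

section Mollification

set_option linter.unusedSectionVars false

variable {n : ℕ} [NeZero n] {p q : ℝ} {F : Type*} [NormedAddCommGroup F] [NormedSpace ℝ F]

/-- A mollification kernel. -/
structure IsKernel {n : ℕ} (ρ : E n → ℝ) : Prop where
  contDiff : ContDiff ℝ ∞ ρ
  hasCompactSupport : HasCompactSupport ρ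
  nonneg : ∀ w, 0 ≤ ρ w
  integral_eq_one : ∫ w, ρ w = 1

/-- The probability measure with a given density. -/
def kernelMeas {n : ℕ} (ρ : E n → ℝ) : Measure (E n) :=
  volume.withDensity fun w => ENNReal.ofReal (ρ w)

variable {ρ : E n → ℝ}

lemma IsKernel.measurable (hρ : IsKernel ρ) : Measurable fun w => ENNReal.ofReal (ρ w) :=
  hρ.contDiff.continuous.measurable.ennreal_ofReal

lemma IsKernel.isProbabilityMeasure (hρ : IsKernel ρ) : IsProbabilityMeasure (kernelMeas ρ) := by
  refine ⟨?_⟩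
  rw [kernelMeas, withDensity_apply _ MeasurableSet.univ, Measure.restrict_univ,
    ← ofReal_integral_eq_lintegral_ofReal
      (hρ.contDiff.continuous.integrable_of_hasCompactSupport hρ.hasCompactSupport)
      (ae_of_all _ hρ.nonneg), hρ.integral_eq_one, ENNReal.ofReal_one]

lemma IsKernel.integral_kernelMeas (hρ : IsKernel ρ) (k : E n → F) :
    ∫ w, k w ∂(kernelMeas ρ) = ∫ w, ρ w • k w := by
  rw [kernelMeas, integral_withDensity_eq_integral_toReal_smul hρ.measurable
    (ae_of_all _ fun _ => ENNReal.ofReal_lt_top)]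
  refine integral_congr_ae (ae_of_all _ fun w => ?_)
  simp only
  rw [ENNReal.toReal_ofReal (hρ.nonneg w)]

lemma inLp_reflect {k : E n → F} (hk : InLp p volume k) (x : E n) :
    InLp p volume (fun w => k (x - w)) :=
  MemLp.comp_measurePreserving hk (Measure.measurePreserving_sub_left volume x)

lemma IsKernel.integrable (hρ : IsKernel ρ) (hp : 1 < p) {k : E n → F} (hk : InLp p volume k)
    (x : E n) : Integrable (fun w => ρ w • k (x - w)) volume := by
  have h1 : LocallyIntegrable (fun w => k (x - w)) volume :=
    MemLp.locallyIntegrable (inLp_reflect hk x) (one_le_ofReal hp)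
  exact h1.integrable_smul_left_of_hasCompactSupport hρ.contDiff.continuous hρ.hasCompactSupport

/-- Jensen's inequality for the probability measure with density `ρ`: only shifts where `ρ` is
nonzero count. The kernel need not be centred at the origin, which allows smoothing combined with a
shift. -/
lemma nrm_sub_mollify_le (hρ : IsKernel ρ) (hpq : p.HolderConjugate q) {k : E n → F}
    [CompleteSpace F]
    (hk : InLp p volume k) {B : ℝ} (hB0 : 0 ≤ B)
    (hB : ∀ w, ρ w ≠ 0 → nrm p volume ((fun x => k (x - w)) - k) ≤ B) :
    InLp p volume (fun x => k x - ∫ w, ρ w • k (x - w)) ∧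
    nrm p volume (fun x => k x - ∫ w, ρ w • k (x - w)) ≤ B := by
  have hp := hpq.lt
  have := hρ.isProbabilityMeasure
  have hac : (volume : Measure (E n)).prod (kernelMeas ρ) ≪
      (volume : Measure (E n)).prod (volume : Measure (E n)) :=
    Measure.AbsolutelyContinuous.rfl.prod (withDensity_absolutelyContinuous _ _)
  have hm : AEStronglyMeasurable (fun z : E n × E n => k z.1 - k (z.1 - z.2))
      ((volume : Measure (E n)).prod (kernelMeas ρ)) := by
    refine AEStronglyMeasurable.mono_ac hac ?_
    exact (hk.1.comp_quasiMeasurePreserving Measure.quasiMeasurePreserving_fst).sub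
      (hk.1.comp_quasiMeasurePreserving (quasiMeasurePreserving_sub volume volume))
  have hne : ∀ᵐ w ∂(kernelMeas ρ), ρ w ≠ 0 := by
    refine (ae_withDensity_iff hρ.measurable).2 (ae_of_all _ fun w hw h0 => hw ?_)
    rw [h0, ENNReal.ofReal_zero]
  have h1 := inLp_average_of_slices hpq hm hB0 (by
    filter_upwards [hne] with w hw
    have h2 : InLp p volume (k - fun x => k (x - w)) := hk.sub (inLp_translate hk w)
    refine ⟨h2, ?_⟩
    have h3 := hB w hw
    rw [nrm_sub_comm] at h3
    exact h3)
  have h2 : (fun x => ∫ w, (k x - k (x - w)) ∂(kernelMeas ρ))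
      = fun x => k x - ∫ w, ρ w • k (x - w) := by
    funext x
    have hi : Integrable (fun w => k (x - w)) (kernelMeas ρ) := by
      refine (integrable_withDensity_iff_integrable_smul' hρ.measurable
        (ae_of_all _ fun _ => ENNReal.ofReal_lt_top)).2 ?_
      refine (hρ.integrable hp hk x).congr (ae_of_all _ fun w => ?_)
      simp only
      rw [ENNReal.toReal_ofReal (hρ.nonneg w)]
    rw [integral_sub (integrable_const _) hi, hρ.integral_kernelMeas fun w => k (x - w)]
    simp
  rw [← h2]
  exact h1

/-- The mollification of a function. -/
def mollify {n : ℕ} (ρ v : E n → ℝ) (x : E n) : ℝ := ∫ w, ρ w • v (x - w)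

lemma mollify_eq_convolution (v : E n → ℝ) :
    mollify ρ v = MeasureTheory.convolution v ρ (ContinuousLinearMap.mul ℝ ℝ) volume := by
  funext x
  rw [convolution_mul_swap, mollify]
  simp only [smul_eq_mul, mul_comm]

lemma IsKernel.contDiff_mollify (hρ : IsKernel ρ) (hp : 1 < p) {v : E n → ℝ}
    (hv : InLp p volume v) : ContDiff ℝ ∞ (mollify ρ v) := by
  rw [mollify_eq_convolution]
  exact hρ.hasCompactSupport.contDiff_convolution_right _ (locallyIntegrable_of_inLp hp hv)
    hρ.contDiff

/-- The derivative falls on the kernel, and `t ↦ ρ (x - t)` is a test function in the definition of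
the weak gradient. -/
lemma IsKernel.gradient_mollify (hρ : IsKernel ρ) (hp : 1 < p) {v : E n → ℝ} {h : E n → E n}
    (hv : IsSobolevWith p v h) (x : E n) :
    gradient (mollify ρ v) x = ∫ w, ρ w • h (x - w) := by
  have hloc := locallyIntegrable_of_inLp hp hv.1
  refine ext_inner_right ℝ fun e => ?_
  have h1 : inner ℝ (gradient (mollify ρ v) x) e = fderiv ℝ (mollify ρ v) x e := by
    rw [gradient, InnerProductSpace.toDual_symm_apply]
  have hψ : ContDiff ℝ ∞ (fun t => ρ (x - t)) := hρ.contDiff.comp (contDiff_const.sub contDiff_id)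
  have hψc : HasCompactSupport (fun t => ρ (x - t)) :=
    hρ.hasCompactSupport.comp_homeomorph (Homeomorph.subLeft x)
  have hψd : ∀ t, fderiv ℝ (fun t => ρ (x - t)) t e = -fderiv ℝ ρ (x - t) e := by
    intro t
    have h2 : HasFDerivAt (fun t : E n => x - t) (-ContinuousLinearMap.id ℝ (E n)) t :=
      (hasFDerivAt_id t).const_sub x
    have h3 := ((hρ.contDiff.differentiable (by simp)) (x - t)).hasFDerivAt.comp t h2
    have h4 : fderiv ℝ (fun t => ρ (x - t)) t = (fderiv ℝ ρ (x - t)).comp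
      (-ContinuousLinearMap.id ℝ (E n)) := h3.fderiv
    rw [h4]
    simp
  rw [h1, mollify_eq_convolution, (hρ.hasCompactSupport.hasFDerivAt_convolution_right _ hloc
    (hρ.contDiff.of_le (by simp)) x).fderiv, convolution_precompR_apply _ hloc
    (hρ.hasCompactSupport.fderiv (𝕜 := ℝ)) (hρ.contDiff.continuous_fderiv (by simp)),
    convolution_mul]
  have h5 := hv.2.2 _ hψ hψc e
  simp only [hψd, mul_neg, integral_neg, neg_inj] at h5
  rw [h5, ← integral_sub_left_eq_self _ volume x, real_inner_comm,
    ← integral_inner (hρ.integrable hp hv.2.1 x)]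
  refine integral_congr_ae (ae_of_all _ fun w => ?_)
  simp only [sub_sub_cancel, inner_smul_right, real_inner_comm e]
  ring

/-- The mollification is supported in the sum of the supports. -/
lemma tsupport_mollify_subset {v : E n → ℝ} {K A : Set (E n)} (hK : IsCompact K)
    (hA : IsCompact A) (hv : ∀ᵐ x : E n, x ∉ K → v x = 0) (hρ : ∀ w ∉ A, ρ w = 0) :
    HasCompactSupport (mollify ρ v) ∧
      tsupport (mollify ρ v) ⊆ (fun z : E n × E n => z.1 + z.2) '' K ×ˢ A := by
  have hc : IsCompact ((fun z : E n × E n => z.1 + z.2) '' K ×ˢ A) :=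
    (hK.prod hA).image continuous_add
  have h0 : ∀ x ∉ (fun z : E n × E n => z.1 + z.2) '' K ×ˢ A, mollify ρ v x = 0 := by
    intro x hx
    refine integral_eq_zero_of_ae ?_
    filter_upwards [(Measure.measurePreserving_sub_left volume x).quasiMeasurePreserving.ae hv] with w hw
    by_cases hwA : w ∈ A
    · have h1 : x - w ∉ K := fun h => hx ⟨(x - w, w), ⟨h, hwA⟩, by simp⟩
      rw [hw h1, smul_zero, Pi.zero_apply]
    · rw [hρ w hwA, zero_smul, Pi.zero_apply]
  refine ⟨HasCompactSupport.intro hc h0, closure_minimal (fun x hx => ?_) hc.isClosed⟩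
  by_contra h
  exact hx (h0 x h)

/-- The product rule. -/
lemma IsSobolevWith.mul_left (hpq : p.HolderConjugate q) {u χ : E n → ℝ} {g : E n → E n}
    (hu : IsSobolevWith p u g) (hχ : ContDiff ℝ ∞ χ) (hc : HasCompactSupport χ) :
    IsSobolevWith p (fun x => χ x * u x) (fun x => χ x • g x + u x • gradient χ x) := by
  have hp := hpq.lt
  have hgr : ∀ x e, inner ℝ (gradient χ x) e = fderiv ℝ χ x e := by
    intro x e
    rw [gradient, InnerProductSpace.toDual_symm_apply]
  obtain ⟨C, hC0, hC⟩ := exists_bound_of_hasCompactSupport hχ.continuous hc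
  obtain ⟨D, hD0, hD⟩ := exists_bound_of_hasCompactSupport (hχ.continuous_fderiv (by simp))
    (hc.fderiv (𝕜 := ℝ))
  have hgc : Continuous fun x => gradient χ x :=
    (InnerProductSpace.toDual ℝ (E n)).symm.continuous.comp (hχ.continuous_fderiv (by simp))
  refine ⟨InLp.bdd_mul_left hχ.continuous.aestronglyMeasurable (ae_of_all _ hC) hu.1,
    MemLp.add ?_ ?_, ?_⟩
  · refine hu.2.1.of_le_mul (c := C) (hχ.continuous.aestronglyMeasurable.smul hu.2.1.1)
      (ae_of_all _ fun x => ?_)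
    rw [norm_smul]
    exact mul_le_mul_of_nonneg_right (hC x) (norm_nonneg _)
  · refine hu.1.of_le_mul (c := D) (hu.1.1.smul hgc.aestronglyMeasurable)
      (ae_of_all _ fun x => ?_)
    rw [norm_smul, mul_comm]
    refine mul_le_mul_of_nonneg_right ?_ (norm_nonneg _)
    rw [gradient, LinearIsometryEquiv.norm_map]
    exact hD x
  · intro φ hφ hφc e
    have hprod := hu.2.2 (fun x => χ x * φ x) (hχ.mul hφ) (hc.mul_right) e
    have hd : ∀ x, fderiv ℝ (fun x => χ x * φ x) x e = χ x * fderiv ℝ φ x e + φ x * fderiv ℝ χ x e := by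
      intro x
      rw [fderiv_fun_mul (hχ.differentiable (by simp) x) (hφ.differentiable (by simp) x)]
      simp
    have hχf : Continuous fun x => fderiv ℝ χ x e :=
      (hχ.continuous_fderiv (by simp)).clm_apply continuous_const
    have hφf : Continuous fun x => fderiv ℝ φ x e :=
      (hφ.continuous_fderiv (by simp)).clm_apply continuous_const
    have i1 : Integrable (fun x => u x * (χ x * fderiv ℝ φ x e)) volume :=
      integrable_mul_of_hasCompactSupport (locallyIntegrable_of_inLp hp hu.1)
        (hχ.continuous.mul hφf) hc.mul_right
    have i2 : Integrable (fun x => u x * (φ x * fderiv ℝ χ x e)) volume :=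
      integrable_mul_of_hasCompactSupport (locallyIntegrable_of_inLp hp hu.1)
        (hφ.continuous.mul hχf) hφc.mul_right
    have i3 : Integrable (fun x => inner ℝ (g x) e * (χ x * φ x)) volume :=
      integrable_mul_of_hasCompactSupport (locallyIntegrable_of_inLp hp (inLp_inner hu.2.1 e))
        (hχ.continuous.mul hφ.continuous) hc.mul_right
    simp only [hd, mul_add] at hprod
    rw [integral_add i1 i2] at hprod
    calc ∫ x, χ x * u x * fderiv ℝ φ x e
        = ∫ x, u x * (χ x * fderiv ℝ φ x e) := by
          refine integral_congr_ae (ae_of_all _ fun x => ?_)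
          simp only
          ring
      _ = -(∫ x, (inner ℝ (g x) e * (χ x * φ x) + u x * (φ x * fderiv ℝ χ x e))) := by
          rw [integral_add i3 i2]
          linarith
      _ = _ := by
          congr 1
          refine integral_congr_ae (ae_of_all _ fun x => ?_)
          simp only [inner_add_left, inner_smul_left, conj_trivial, hgr]
          ring

end Mollification

/-! ### Lipschitz domains -/

section Lipschitz

set_option linter.unusedSectionVars false

variable {n : ℕ} [NeZero n] {p q : ℝ} {Ω : Set (E n)}

lemma testClosure_congr {u v : E n → ℝ} (huv : u =ᵐ[volume] v) (hu : u ∈ testClosure p Ω) :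
    v ∈ testClosure p Ω := by
  obtain ⟨g, ⟨h1, h2, h3⟩, h4⟩ := hu
  refine ⟨g, ⟨h1.ae_eq huv, h2, fun φ hφ hc e => ?_⟩, fun ε hε => ?_⟩
  · rw [← h3 φ hφ hc e]
    refine integral_congr_ae ?_
    filter_upwards [huv] with x hx
    rw [hx]
  · obtain ⟨φ, hφ1, hφ2, hφ3, hφ4, hφ5⟩ := h4 ε hε
    refine ⟨φ, hφ1, hφ2, hφ3, le_of_eq_of_le (eLpNorm_congr_ae ?_) hφ4, hφ5⟩
    filter_upwards [huv] with x hx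
    rw [hx]

lemma zero_mem_testClosure : (0 : E n → ℝ) ∈ testClosure p Ω := by
  have hz : gradient (0 : E n → ℝ) = 0 := by
    funext x
    simp [gradient]
  refine ⟨0, ⟨MemLp.zero, MemLp.zero, fun φ _ _ e => by simp⟩, fun ε _ =>
    ⟨0, contDiff_const, HasCompactSupport.zero, by simp [tsupport], ?_, ?_⟩⟩
  · simp
  · simp [hz]

lemma add_mem_testClosure (hpq : p.HolderConjugate q) {u v : E n → ℝ}
    (hu : u ∈ testClosure p Ω) (hv : v ∈ testClosure p Ω) : u + v ∈ testClosure p Ω := by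
  obtain ⟨gu, hgu, hu'⟩ := hu
  obtain ⟨gv, hgv, hv'⟩ := hv
  have hs := hgu.comb hpq hgv 1 1
  rw [one_smul, one_smul, one_smul, one_smul] at hs
  refine ⟨gu + gv, hs, fun ε hε => ?_⟩
  obtain ⟨φ, hφ1, hφ2, hφ3, hφ4, hφ5⟩ := hu' (ε / 2) (half_pos hε)
  obtain ⟨ψ, hψ1, hψ2, hψ3, hψ4, hψ5⟩ := hv' (ε / 2) (half_pos hε)
  have hgrad : ∀ x, gradient (φ + ψ) x = gradient φ x + gradient ψ x := by
    intro x
    rw [gradient, fderiv_add (hφ1.differentiable (by simp) x) (hψ1.differentiable (by simp) x),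
      map_add]
    rfl
  have hgc : ∀ k : E n → ℝ, ContDiff ℝ ∞ k →
      AEStronglyMeasurable (fun x => gradient k x) (volume : Measure (E n)) := fun k hk =>
    ((InnerProductSpace.toDual ℝ (E n)).symm.continuous.comp
      (hk.continuous_fderiv (by simp))).aestronglyMeasurable
  have hε2 : ENNReal.ofReal (ε / 2) + ENNReal.ofReal (ε / 2) = ENNReal.ofReal ε := by
    rw [← ENNReal.ofReal_add (by positivity) (by positivity), add_halves]
  refine ⟨φ + ψ, hφ1.add hψ1, hφ2.add hψ2,
    (tsupport_add φ ψ).trans (Set.union_subset hφ3 hψ3), ?_, ?_⟩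
  · have e1 : (fun x => (u + v) x - (φ + ψ) x) = (fun x => u x - φ x) + fun x => v x - ψ x := by
      funext x
      simp only [Pi.add_apply]
      ring
    rw [e1, ← hε2]
    exact (eLpNorm_add_le (hgu.1.1.sub hφ1.continuous.aestronglyMeasurable)
      (hgv.1.1.sub hψ1.continuous.aestronglyMeasurable) (one_le_ofReal hpq.lt)).trans
      (add_le_add hφ4 hψ4)
  · have e1 : (fun x => (gu + gv) x - gradient (φ + ψ) x)
        = (fun x => gu x - gradient φ x) + fun x => gv x - gradient ψ x := by
      funext x
      simp only [Pi.add_apply, hgrad]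
      abel
    rw [e1, ← hε2]
    exact (eLpNorm_add_le (hgu.2.1.1.sub (hgc φ hφ1)) (hgv.2.1.1.sub (hgc ψ hψ1))
      (one_le_ofReal hpq.lt)).trans (add_le_add hφ5 hψ5)

/-- Limits of test functions vanish outside the domain. -/
lemma testClosure_subset (hp : 1 < p) (hΩ : MeasurableSet Ω) :
    testClosure p Ω ⊆ sobolev₀ p Ω := by
  rintro u ⟨g, hg, h⟩
  refine ⟨⟨g, hg⟩, ?_⟩
  have h0 : eLpNorm (Ωᶜ.indicator u) (ENNReal.ofReal p) volume = 0 := by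
    refine le_antisymm (ENNReal.le_of_forall_pos_le_add fun ε hε _ => ?_) zero_le
    obtain ⟨φ, -, -, hφ3, hφ4, -⟩ := h ε hε
    rw [zero_add]
    refine le_trans (eLpNorm_mono fun x => ?_) (hφ4.trans_eq ENNReal.ofReal_coe_nnreal)
    by_cases hx : x ∈ Ω
    · simp [hx]
    · have h1 : φ x = 0 := image_eq_zero_of_notMem_tsupport fun h => hx (hφ3 h)
      rw [Set.indicator_of_mem (show x ∈ Ωᶜ from hx), h1, sub_zero]
  rw [eLpNorm_eq_zero_iff (hg.1.1.indicator hΩ.compl) (ofReal_ne_zero hp)] at h0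
  filter_upwards [h0] with x hx hxΩ
  rwa [Set.indicator_of_mem (show x ∈ Ωᶜ from hxΩ)] at hx

/-- Near each point of the closure, a Lipschitz domain has an inward direction. -/
lemma HasLipschitzBoundary.exists_inward (hΩ : IsOpen Ω) (hL : HasLipschitzBoundary Ω) {x : E n}
    (hx : x ∈ closure Ω) : ∃ (e : E n) (r c δ : ℝ), 0 < r ∧ 0 < c ∧ 0 < δ ∧
      ∀ y ∈ closure Ω, y ∈ ball x r → ∀ t, 0 < t → t < δ → ball (y + t • e) (c * t) ⊆ Ω := by
  by_cases hxΩ : x ∈ Ω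
  · obtain ⟨r, hr, hball⟩ := Metric.isOpen_iff.1 hΩ x hxΩ
    -- At an interior point no shift is needed, so the direction is zero and small balls already lie
    -- in `Ω`.
    refine ⟨0, r / 2, 1, r / 2, by positivity, one_pos, by positivity,
      fun y _ hy t _ htδ z hz => hball ?_⟩
    rw [smul_zero, add_zero, mem_ball, one_mul] at hz
    rw [mem_ball] at hy ⊢
    have := dist_triangle z y x
    linarith
  · obtain ⟨e, γ, K, r, he, hγ, hγe, hr, hball⟩ := hL x ⟨hx, by rwa [hΩ.interior_eq]⟩
    have hK : (0:ℝ) ≤ K := K.2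
    -- Moving by `t e` raises the height by `t` and leaves `γ` unchanged; a further displacement
    -- below `c t` costs at most `c t` in height and `K c t` in `γ`. Since `(K + 1) c < 1`, the
    -- point stays above the graph.
    set c : ℝ := 1 / (K + 2) with hc
    have hc0 : 0 < c := by positivity
    have hcK : c * (K + 2) = 1 := by rw [hc]; field_simp
    have hc1 : c ≤ 1 := by nlinarith
    refine ⟨e, r / 2, c, r / 4, by positivity, hc0, by positivity,
      fun y hyΩ hy t ht htδ z hz => ?_⟩
    rw [mem_ball] at hy hz
    have hzx : z ∈ ball x r := by
      rw [mem_ball]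
      have h1 := dist_triangle z (y + t • e) x
      have h2 := dist_triangle (y + t • e) y x
      rw [dist_self_add_left, norm_smul, he, mul_one, Real.norm_of_nonneg ht.le] at h2
      nlinarith
    refine (hball z hzx).2 ?_
    have hyle : γ y ≤ inner ℝ e y := by
      have hcl : y ∈ closure (Ω ∩ ball x r) := by
        have hyr : y ∈ ball x r := by rw [mem_ball]; linarith
        exact (mem_closure_iff_nhds.2 fun s hs => by
          obtain ⟨w, hw1, hw2⟩ := mem_closure_iff_nhds.1 hyΩ (s ∩ ball x r)
            (inter_mem hs (isOpen_ball.mem_nhds hyr))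
          exact ⟨w, hw1.1, hw2, hw1.2⟩)
      refine closure_minimal (t := {y | γ y ≤ inner ℝ e y}) (fun w hw => ?_)
        (isClosed_le hγ.continuous (continuous_const.inner continuous_id)) hcl
      exact ((hball w hw.2).1 hw.1).le
    have h1 : γ z ≤ γ y + K * (c * t) := by
      have h2 := hγ.dist_le_mul z (y + t • e)
      rw [hγe, Real.dist_eq] at h2
      have h3 := le_abs_self (γ z - γ y)
      have h4 : (K : ℝ) * dist z (y + t • e) ≤ K * (c * t) :=
        mul_le_mul_of_nonneg_left hz.le hK
      linarith
    have h2 : (inner ℝ e y : ℝ) + t - c * t < inner ℝ e z + 0 := by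
      have h3 := abs_real_inner_le_norm e (z - (y + t • e))
      rw [he, one_mul, ← dist_eq_norm] at h3
      have h4 := neg_abs_le (inner ℝ e (z - (y + t • e)) : ℝ)
      rw [inner_sub_right, inner_add_right, inner_smul_right, real_inner_self_eq_norm_sq, he] at h3 h4
      linarith
    nlinarith

lemma eLpNorm_le_of_nrm {F : Type*} [NormedAddCommGroup F] {k : E n → F} (hk : InLp p volume k)
    {ε : ℝ} (h : nrm p volume k ≤ ε) :
    eLpNorm k (ENNReal.ofReal p) volume ≤ ENNReal.ofReal ε := by
  rw [← ENNReal.ofReal_toReal hk.2.ne]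
  exact ENNReal.ofReal_le_ofReal h

/-- Localised Sobolev functions are approximated by shifting into the domain and mollifying. -/
lemma mul_mem_testClosure (hpq : p.HolderConjugate q) {u χ : E n → ℝ} (hu : u ∈ sobolev₀ p Ω)
    (hχ : ContDiff ℝ ∞ χ) (hχc : HasCompactSupport χ) {e : E n} {c δ : ℝ} (hc : 0 < c)
    (hδ : 0 < δ) (h : ∀ y ∈ closure Ω, y ∈ tsupport χ → ∀ t, 0 < t → t < δ →
      ball (y + t • e) (c * t) ⊆ Ω) : (fun x => χ x * u x) ∈ testClosure p Ω := by
  have hp := hpq.lt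
  obtain ⟨⟨g, hg⟩, hu0⟩ := hu
  have hv := hg.mul_left hpq hχ hχc
  have hK : IsCompact (closure Ω ∩ tsupport χ) :=
    IsCompact.inter_left hχc isClosed_closure
  have hv0 : ∀ᵐ x : E n, x ∉ closure Ω ∩ tsupport χ → χ x * u x = 0 := by
    filter_upwards [hu0] with x hx hxK
    by_cases hxχ : x ∈ tsupport χ
    · rw [hx fun hxΩ => hxK ⟨subset_closure hxΩ, hxχ⟩, mul_zero]
    · rw [image_eq_zero_of_notMem_tsupport hxχ, zero_mul]
  refine ⟨_, hv, fun ε hε => ?_⟩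
  obtain ⟨η₁, hη₁, h₁⟩ := Metric.eventually_nhds_iff.1
    ((tendsto_nrm_translate_sub hp hv.1).eventually (gt_mem_nhds hε))
  obtain ⟨η₂, hη₂, h₂⟩ := Metric.eventually_nhds_iff.1
    ((tendsto_nrm_translate_sub hp hv.2.1).eventually (gt_mem_nhds hε))
  set η := min η₁ η₂ with hη
  have hη0 : 0 < η := lt_min hη₁ hη₂
  -- Small enough that every shift in the support of the kernel below, of norm at most `t ‖e‖ + c t
  -- / 2`, moves the function and its gradient by less than `ε` in `L^p`.
  obtain ⟨t, ht0, htδ, htη⟩ : ∃ t : ℝ, 0 < t ∧ t < δ ∧ t * (‖e‖ + c) < η := by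
    have h3 : Tendsto (fun t : ℝ => t * (‖e‖ + c)) (𝓝[>] 0) (𝓝 0) := by
      have h4 : Continuous fun t : ℝ => t * (‖e‖ + c) := by fun_prop
      have h5 := h4.tendsto 0
      rw [zero_mul] at h5
      exact h5.mono_left nhdsWithin_le_nhds
    obtain ⟨t, ht1, ht2⟩ := ((h3.eventually (gt_mem_nhds hη0)).and (Ioo_mem_nhdsGT hδ)).exists
    exact ⟨t, ht2.1, ht2.2, ht1⟩
  -- Centring the bump at `t e` makes convolution shift inward and smooth at once. Its radius `c t /
  -- 2` stays strictly below `c t`, so even the closed support lands in `Ω`.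
  let b : ContDiffBump (t • e) := ⟨c * t / 4, c * t / 2, by positivity, by
    have : 0 < c * t := by positivity
    linarith⟩
  have hρ : IsKernel (b.normed volume) :=
    ⟨b.contDiff_normed, b.hasCompactSupport_normed, b.nonneg_normed, b.integral_normed⟩
  have hρ0 : ∀ w ∉ closedBall (t • e) (c * t / 2), b.normed volume w = 0 := by
    intro w hw
    by_contra hne
    have h3 : w ∈ Function.support (b.normed volume) := hne
    rw [b.support_normed_eq] at h3
    exact hw (ball_subset_closedBall h3)
  have hsmall : ∀ w, b.normed volume w ≠ 0 → dist w 0 < η := by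
    intro w hw
    have h3 : w ∈ closedBall (t • e) (c * t / 2) := by
      by_contra hne
      exact hw (hρ0 w hne)
    rw [mem_closedBall, dist_eq_norm] at h3
    have h4 := norm_le_norm_add_norm_sub' w (t • e)
    rw [norm_smul, Real.norm_of_nonneg ht0.le] at h4
    rw [dist_zero_right]
    nlinarith [mul_pos hc ht0]
  obtain ⟨hs1, hs2⟩ := tsupport_mollify_subset hK (isCompact_closedBall (t • e) (c * t / 2)) hv0 hρ0
  have a₁ := nrm_sub_mollify_le hρ hpq hv.1 hε.le fun w hw =>
    (h₁ ((hsmall w hw).trans_le (min_le_left _ _))).le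
  have a₂ := nrm_sub_mollify_le hρ hpq hv.2.1 hε.le fun w hw =>
    (h₂ ((hsmall w hw).trans_le (min_le_right _ _))).le
  refine ⟨_, hρ.contDiff_mollify hp hv.1, hs1, hs2.trans ?_, eLpNorm_le_of_nrm a₁.1 a₁.2, ?_⟩
  · rintro _ ⟨⟨y, w⟩, ⟨hy, hw⟩, rfl⟩
    refine h y hy.1 hy.2 t ht0 htδ ?_
    rw [mem_closedBall] at hw
    simp only
    rw [mem_ball, dist_add_left]
    have : 0 < c * t := by positivity
    linarith
  · simp only [hρ.gradient_mollify hp hv]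
    exact eLpNorm_le_of_nrm a₂.1 a₂.2

/-- On Lipschitz domains the two realisations of `W^{1,p}_0(Ω)` coincide. -/
theorem testClosure_eq_sobolev₀ (hpq : p.HolderConjugate q) (hΩo : IsOpen Ω)
    (hΩb : Bornology.IsBounded Ω) (hL : HasLipschitzBoundary Ω) :
    testClosure p Ω = sobolev₀ p Ω := by
  refine Set.Subset.antisymm (testClosure_subset hpq.lt hΩo.measurableSet) fun u hu => ?_
  have hcpt : IsCompact (closure Ω) := hΩb.isCompact_closure
  choose! e r c δ hr hc hδ hin using fun x (hx : x ∈ closure Ω) => hL.exists_inward hΩo hx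
  obtain ⟨T, hT, hcov⟩ := hcpt.elim_nhds_subcover (fun x => ball x (r x))
    fun x hx => ball_mem_nhds x (hr x hx)
  -- The inward direction is only available locally, so `u` is cut into finitely many pieces, each
  -- supported where one direction works; their sum equals `u` almost everywhere.
  obtain ⟨χ, hχ⟩ := SmoothPartitionOfUnity.exists_isSubordinate (modelWithCornersSelf ℝ (E n))
    (s := closure Ω) isClosed_closure (fun i : T => ball (i : E n) (r i)) (fun _ => isOpen_ball)
    (fun y hy => by
      obtain ⟨x, hxT, hxy⟩ := Set.mem_iUnion₂.1 (hcov hy)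
      exact Set.mem_iUnion.2 ⟨⟨x, hxT⟩, hxy⟩)
  have hmem : ∀ i : T, (fun x => χ i x * u x) ∈ testClosure p Ω := by
    intro i
    have hi := hT i i.2
    refine mul_mem_testClosure hpq hu (χ i).contMDiff.contDiff
      (HasCompactSupport.of_support_subset_isCompact (isCompact_closedBall (i : E n) (r i))
        ((subset_tsupport _).trans ((hχ i).trans ball_subset_closedBall))) (hc _ hi) (hδ _ hi)
      fun y hy hyχ => hin _ hi y hy (hχ i hyχ)
  have hsum : (∑ i : T, fun x => χ i x * u x) ∈ testClosure p Ω :=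
    Finset.sum_induction _ (fun v => v ∈ testClosure p Ω)
      (fun _ _ h1 h2 => add_mem_testClosure hpq h1 h2) zero_mem_testClosure fun i _ => hmem i
  refine testClosure_congr ?_ hsum
  filter_upwards [hu.2] with x hx
  rw [Finset.sum_apply, ← Finset.sum_mul]
  by_cases hxΩ : x ∈ Ω
  · have h1 := χ.sum_eq_one (subset_closure hxΩ)
    rw [finsum_eq_sum_of_fintype] at h1
    rw [h1, one_mul]
  · rw [hx hxΩ, mul_zero]

end Lipschitz

end

end AnisoFrac
-- Assembly of the existence, convergence and Lipschitz statements.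
theorem mainTheorem6 (n : ℕ) (hn : 1 ≤ n) (p : ℝ) (hp : 1 < p)
    (Ω : Set (AnisoFrac.E n)) (hΩo : IsOpen Ω) (hΩb : Bornology.IsBounded Ω)
    (m : AnisoFrac.E n → AnisoFrac.E n → ℝ) (hm : Measurable (Function.uncurry m))
    (mlo mhi : ℝ) (hmlo : 0 < mlo)
    (hH1 : ∀ᵐ z : AnisoFrac.E n × AnisoFrac.E n, mlo ≤ m z.1 z.2 ∧ m z.1 z.2 ≤ mhi)
    (hH2 : ∀ᵐ z : AnisoFrac.E n × AnisoFrac.E n, m z.1 z.2 = m (z.1 - z.2) (-z.2))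
    (a : AnisoFrac.E n → sphere (0 : AnisoFrac.E n) 1 → ℝ)
    (hH3 : ∀ᵐ x : AnisoFrac.E n, ∃ C : ℝ, ∀ᶠ r : ℝ in 𝓝[>] 0,
      ∀ θ : sphere (0 : AnisoFrac.E n) 1, |m x (r • (θ : AnisoFrac.E n)) - a x θ| ≤ C * r)
    (f : AnisoFrac.E n → ℝ)
    (hf : MemLp f (ENNReal.ofReal (p / (p - 1))) (volume.restrict Ω)) :
    ∃ (us : ℝ → AnisoFrac.E n → ℝ) (u : AnisoFrac.E n → ℝ),
      (∀ s ∈ Set.Ioo (0 : ℝ) 1, AnisoFrac.IsNonlocalSolution s p Ω m f (us s) ∧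
        ∀ w, AnisoFrac.IsNonlocalSolution s p Ω m f w → w =ᵐ[volume] us s) ∧
      (AnisoFrac.IsLocalSolution p Ω (AnisoFrac.sobolev₀ p Ω) a (fun x => p * f x) u ∧
        ∀ w, AnisoFrac.IsLocalSolution p Ω (AnisoFrac.sobolev₀ p Ω) a (fun x => p * f x) w →
          w =ᵐ[volume] u) ∧
      (AnisoFrac.HasLipschitzBoundary Ω →
        AnisoFrac.IsLocalSolution p Ω (AnisoFrac.testClosure p Ω) a (fun x => p * f x) u ∧
        ∀ w, AnisoFrac.IsLocalSolution p Ω (AnisoFrac.testClosure p Ω) a (fun x => p * f x) w →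
          w =ᵐ[volume] u) ∧
      Tendsto (fun s => eLpNorm (fun x => us s x - u x) (ENNReal.ofReal p) (volume.restrict Ω))
        (𝓝[<] 1) (𝓝 0) := by
  have hn0 : NeZero n := ⟨by omega⟩
  have hpq : p.HolderConjugate (p / (p - 1)) := Real.HolderConjugate.conjExponent hp
  have S : AnisoFrac.Admissible p (p / (p - 1)) Ω m mlo mhi a f :=
    ⟨hpq, hΩo, hΩb, hm, hmlo, hH1, hH3, hf⟩
  -- The existence argument works for every `s < 1`; for `s ≥ 1` the chosen function is arbitrary,
  -- since only the approach from the left matters.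
  have hex : ∀ s : ℝ, ∃ u, s < 1 → AnisoFrac.IsNonlocalSolution s p Ω m f u := by
    intro s
    by_cases hs : s < 1
    · obtain ⟨u, hu⟩ := AnisoFrac.exists_nonlocalSolution hpq hs hΩo hΩb hm hmlo hH1 hf
      exact ⟨u, fun _ => hu⟩
    · exact ⟨0, fun h => absurd h hs⟩
  choose us hus using hex
  obtain ⟨u, hu, hlim⟩ := S.exists_tendsto hus
  refine ⟨us, u, fun s hs => ⟨hus s hs.2, fun w hw =>
    AnisoFrac.nonlocalSolution_unique hpq hs.2 hΩb hm hmlo hH1 (hus s hs.2) hw⟩,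
    ⟨hu, fun w hw => S.localSolution_unique hu hw⟩, fun hL => ?_, ?_⟩
  · rw [AnisoFrac.testClosure_eq_sobolev₀ hpq hΩo hΩb hL]
    exact ⟨hu, fun w hw => S.localSolution_unique hu hw⟩
  · have hev : ∀ᶠ s in 𝓝[<] (1:ℝ), AnisoFrac.InLp p volume (us s - u) := by
      filter_upwards [self_mem_nhdsWithin] with s hs
      exact (hus s hs).1.1.sub hu.1.1.choose_spec.1
    exact tendsto_of_tendsto_of_tendsto_of_le_of_le tendsto_const_nhds
      ((AnisoFrac.tendsto_eLpNorm_iff_nrm hev).2 hlim) (fun _ => zero_le)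
      fun s => eLpNorm_restrict_le (us s - u) _ _ Ω
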